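/- **Theorem (Convergence of IBP training).** *Setting.* Let $(x_i,y_i)_{i=1}^n$ be training data with $x_i\in\mathbb R^d$, $y_i\in\{1,-1\}$, let $0\le\epsilon\le1$ be an $\ell_\infty$ perturbation radius and $\xi>0$. Assume (1) $x_i\in[\epsilon,1]^d$ and $\|x_i\|_2\ge\xi$ for all $i$; (2) for $i\ne j$ and all $x',x''$ with $\|x'-x_i\|_\infty\le\epsilon$, $\|x''-x_j\|_\infty\le\epsilon$, the vectors $x',x''$ are not parallel (they are linearly independent). Consider the network $f(W,a,x)=\frac1{\sqrt m}\sum_{r=1}^m a_r\sigma(w_r^\top x)$ with $\sigma(z)=\max(z,0)$, initialized with independent $a_r\sim\mathrm{unif}\{1,-1\}$ and $w_r\sim N(0,I_d)$; $a$ stays fixed and $W$ is trained. The IBP lower bound of the margin and the IBP robust loss are $$\underline u_i(W)=\frac1{\sqrt m}\sum_{r=1}^m\Big(\mathbf 1[y_ia_r=1]\,\sigma(w_r^\top x_i-\epsilon\|w_r\|_1)-\mathbf 1[y_ia_r=-1]\,\sigma(w_r^\top x_i+\epsilon\|w_r\|_1)\Big),\qquad \overline L(W)=\sum_{i=1}^n\log(1+e^{-\underline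 u_i(W)}).$$ The IBP-certified training error of $W$ is the fraction of $i$ with $\underline u_i(W)\le0$. Let $H_{ij}(W)=\sum_{r}\langle\partial\underline u_i/\partial w_r,\partial\underline u_j/\partial w_r\rangle$, let $H^\infty$ be the entrywise expectation of $H$ at initialization, and let $\lambda_0$ be the least eigenvalue of $H^\infty$. A gradient flow of $\overline L$ is a locally absolutely continuous curve $W:[0,\infty)\to\mathbb R^{m\times d}$ that starts at the initialization and satisfies $W'(t)\in-\partial\overline L(W(t))$ for almost every $t$, with $\partial$ the Clarke subdifferential (the gradient, wherever $\overline L$ is continuously differentiable). Put $R=\frac{c\,\delta\lambda_0}{d^{1.5}n^2}$ with $c=\frac{\sqrt{2\pi}\,\xi}{384}$. *Claim.* There is an absolute constant $K>0$, and for every $\xi>0$ there are constants $C_1,C_2>0$ depending only on $\xi$, such that the following holds for all $n,d,m$, all such data, and all $\epsilon\in[0,1]$, $\delta\in(0,1)$. Suppose $$\epsilon\le C_1\min\Big(\frac{\delta^2\lambda_0^2}{d^{2.5}n^3},\ \frac{\sqrt{2d}\,R}{\log\big(\sqrt{2\pi d/R}\;\xi\big)}\Big),$$ where the second term is omitted if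 its logarithm is not positive; suppose $\delta^2\lambda_0^2-\epsilon d^{2.5}n^4>0$, and $$m\ \ge\ C_2\Big(\frac{d^{1.5}n^4\max(1,\delta\lambda_0)}{\delta^2\lambda_0^2-\epsilon d^{2.5}n^4}\Big)^2 .$$ Then with probability at least $1-\delta$ over the initialization, a gradient flow of $\overline L$ exists, and for every gradient flow $W$, writing $\overline L(t)=\overline L(W(t))$, there is a time $T$ with $0\le T\le K\,\frac{n+\overline L(0)}{\lambda_0}$ such that - the IBP-certified training error of $W(t)$ is zero for every $t\ge T$; - the loss decays exponentially up to time $T$: for $0\le t\le T$, $$\overline L(t)\le \overline L(0)\exp\Big(-\frac{\lambda_0t}{K(n+\overline L(0))}\Big)\quad\text{and}\quad \overline L(t)\le e^{K(n+\overline L(0))}\,\overline L(0)\,e^{-\lambda_0t/2}.$$ -/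

import Mathlib

open MeasureTheory ProbabilityTheory Filter Topology Set

namespace IBP

noncomputable section

/-! ## The two-layer network, its interval bounds and the IBP loss -/

/-- First-layer weight matrices, with the Frobenius inner product; the entry `(r, k)` is the
`k`-th coordinate of the weight vector of the hidden neuron `r`. -/
abbrev Weights (m d : ℕ) : Type := EuclideanSpace ℝ (Fin m × Fin d)

def relu (z : ℝ) : ℝ := max z 0

/-- `w_r ⬝ x`. -/
def preact {m d : ℕ} (W : Weights m d) (r : Fin m) (x : Fin d → ℝ) : ℝ :=
  ∑ k, W (r, k) * x k

/-- `‖w_r‖₁`. -/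
def rowL1 {m d : ℕ} (W : Weights m d) (r : Fin m) : ℝ :=
  ∑ k, |W (r, k)|

/-- The network output `f(W, a, x)`. -/
def network {m d : ℕ} (a : Fin m → ℝ) (W : Weights m d) (x : Fin d → ℝ) : ℝ :=
  (1 / √(m : ℝ)) * ∑ r, a r * relu (preact W r x)

/-- The interval lower bound of the hidden neuron `r` on the `ℓ∞` ball of radius `ε` at `x`. -/
def neuronLower {m d : ℕ} (ε : ℝ) (W : Weights m d) (r : Fin m) (x : Fin d → ℝ) : ℝ :=
  relu (preact W r x - ε * rowL1 W r)

/-- The interval upper bound of the hidden neuron `r` on the `ℓ∞` ball of radius `ε` at `x`. -/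
def neuronUpper {m d : ℕ} (ε : ℝ) (W : Weights m d) (r : Fin m) (x : Fin d → ℝ) : ℝ :=
  relu (preact W r x + ε * rowL1 W r)

/-- The IBP lower bound of the margin `y f(W, a, x + Δ)` over `‖Δ‖∞ ≤ ε`, for `y` and all `a r`
in `{1, -1}`: a neuron with `y a_r = 1` enters with its lower bound, a neuron with
`y a_r = -1` with minus its upper bound. -/
def marginLower {m d : ℕ} (ε : ℝ) (a : Fin m → ℝ) (W : Weights m d)
    (x : Fin d → ℝ) (y : ℝ) : ℝ :=
  (1 / √(m : ℝ)) * ∑ r,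
    ((if y * a r = 1 then neuronLower ε W r x else 0)
      - (if y * a r = -1 then neuronUpper ε W r x else 0))

/-- The logistic loss. -/
def logistic (u : ℝ) : ℝ := Real.log (1 + Real.exp (-u))

/-- The IBP robust loss on the training set `(x_i, y_i)`. -/
def robustLoss {n m d : ℕ} (ε : ℝ) (x : Fin n → Fin d → ℝ) (y : Fin n → ℝ)
    (a : Fin m → ℝ) (W : Weights m d) : ℝ :=
  ∑ i, logistic (marginLower ε a W (x i) (y i))

/-- The IBP-certified training error: the fraction of training examples that are not certified,
where an example is certified when its IBP margin bound is positive. -/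
def certifiedError {n m d : ℕ} (ε : ℝ) (x : Fin n → Fin d → ℝ) (y : Fin n → ℝ)
    (a : Fin m → ℝ) (W : Weights m d) : ℝ :=
  (Set.ncard {i : Fin n | ¬ 0 < marginLower ε a W (x i) (y i)} : ℝ) / n

/-! ## Random initialization -/

/-- The uniform distribution on `{1, -1}`. -/
def signMeasure : Measure ℝ :=
  (2⁻¹ : ENNReal) • (Measure.dirac 1 + Measure.dirac (-1))

/-- The law of the initialization: independent uniform signs `a_r` for the second layer and
independent standard Gaussian entries for the first layer. -/
def initMeasure (m d : ℕ) : Measure ((Fin m → ℝ) × (Fin m × Fin d → ℝ)) :=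
  (Measure.pi fun _ => signMeasure).prod (Measure.pi fun _ => gaussianReal 0 1)

/-! ## The Gram matrix -/

/-- The partial derivative of the IBP margin bound with respect to the weights:
`m^{-1/2} y a_r (A⁺ (x - ε sign w_r) + A⁻ (x + ε sign w_r))`, where `A⁺` and `A⁻` are the
indicators of `y a_r = 1, w_r ⬝ x - ε ‖w_r‖₁ > 0` and of `y a_r = -1, w_r ⬝ x + ε ‖w_r‖₁ > 0`. -/
def marginGrad {m d : ℕ} (ε : ℝ) (a : Fin m → ℝ) (W : Weights m d)
    (x : Fin d → ℝ) (y : ℝ) (p : Fin m × Fin d) : ℝ :=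
  open Classical in
  (1 / √(m : ℝ)) * (y * a p.1) *
    ((if y * a p.1 = 1 ∧ 0 < preact W p.1 x - ε * rowL1 W p.1
        then x p.2 - ε * Real.sign (W p) else 0)
      + (if y * a p.1 = -1 ∧ 0 < preact W p.1 x + ε * rowL1 W p.1
        then x p.2 + ε * Real.sign (W p) else 0))

/-- The Gram matrix `H` of these derivatives. -/
def gram {n m d : ℕ} (ε : ℝ) (x : Fin n → Fin d → ℝ) (y : Fin n → ℝ)
    (a : Fin m → ℝ) (W : Weights m d) : Matrix (Fin n) (Fin n) ℝ :=
  Matrix.of fun i j =>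
    ∑ p, marginGrad ε a W (x i) (y i) p * marginGrad ε a W (x j) (y j) p

/-- `H^∞`, the entrywise expectation of the Gram matrix at initialization. -/
def gramInf {n d : ℕ} (m : ℕ) (ε : ℝ) (x : Fin n → Fin d → ℝ) (y : Fin n → ℝ) :
    Matrix (Fin n) (Fin n) ℝ :=
  Matrix.of fun i j =>
    ∫ ω, gram ε x y ω.1 (WithLp.toLp 2 ω.2 : Weights m d) i j ∂(initMeasure m d)

/-! ## Gradient flow of a locally Lipschitz function -/

/-- The Clarke subdifferential of a locally Lipschitz function on a finite-dimensional space: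
the convex hull of all limits of gradients at points of differentiability. -/
def clarkeSubdifferential {E : Type*} [NormedAddCommGroup E] [InnerProductSpace ℝ E]
    [CompleteSpace E] (f : E → ℝ) (w : E) : Set E :=
  convexHull ℝ {g | ∃ z p : ℕ → E, (∀ k, HasGradientAt f (p k) (z k)) ∧
    Tendsto z atTop (𝓝 w) ∧ Tendsto p atTop (𝓝 g)}

/-- `w` is a gradient flow of `f` on `[0, ∞)` started at `w₀`: it is locally absolutely
continuous, and `w'(t) ∈ -∂f(w(t))` for almost every `t > 0`. -/
structure IsGradientFlow {E : Type*} [NormedAddCommGroup E] [InnerProductSpace ℝ E]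
    [CompleteSpace E] (f : E → ℝ) (w₀ : E) (w : ℝ → E) : Prop where
  init : w 0 = w₀
  absCont : ∀ T : ℝ, 0 ≤ T → AbsolutelyContinuousOnInterval w 0 T
  flow : ∀ᵐ t ∂(volume.restrict (Ioi (0 : ℝ))),
    ∃ g ∈ clarkeSubdifferential f (w t), HasDerivAt w (-g) t

/-! ## Assumptions on the data -/

/-- Every input lies in `[ε, 1]^d` and has Euclidean norm at least `ξ`. -/
def InputRange {n d : ℕ} (ε ξ : ℝ) (x : Fin n → Fin d → ℝ) : Prop :=
  ∀ i, (∀ k, x i k ∈ Icc ε 1) ∧ ξ ≤ √(∑ k, x i k ^ 2)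

/-- No two inputs become parallel under `ℓ∞` perturbations of size at most `ε`. -/
def NonParallel {n d : ℕ} (ε : ℝ) (x : Fin n → Fin d → ℝ) : Prop :=
  ∀ i j, i ≠ j → ∀ x' x'' : Fin d → ℝ,
    (∀ k, |x' k - x i k| ≤ ε) → (∀ k, |x'' k - x j k| ≤ ε) →
      LinearIndependent ℝ ![x', x'']

/-- `R = c δ λ₀ / (d^{1.5} n²)` with `c = √(2π) ξ / 384`. -/
def radius (ξ δ lam : ℝ) (d n : ℕ) : ℝ :=
  (√(2 * Real.pi) * ξ / 384) * δ * lam / ((d : ℝ) ^ (3 / 2 : ℝ) * (n : ℝ) ^ 2)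

end

end IBP

/-!
The proof is a neural tangent kernel argument for the interval bounds. Up to the sign of the weights
and of the preactivation bounds, the IBP margin `u_i` of an example is a linear function of the
weights, and for a wide network few of these signs change during training.

*Gradient flows.* For fixed signs in the second layer the loss is Lipschitz, so that Euler schemes
have limits which are gradient flows (`exists_isGradientFlow`). Conversely, along every curve the
margins are, at almost every time, affine in the direction of the velocity, since a quantity that
vanishes at a nonisolated zero has zero derivative there; this gives the energy identity
`d/dt L = -‖W'‖²` (`IsGradientFlow.ae_hasDerivAt_loss`).

*Training near the initialization.* Suppose that every hidden neuron has moved by less than `R`.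
Then every Clarke subgradient of the loss is `-∑ i, c_i G_i` up to a drift error, where `G_i` is the
gradient of the margin at the initialization and `c_i = 1 / (1 + e^{u_i})`; the drift error is
governed by the number of signs that a displacement by `R` can change. This has two consequences.
If the Gram matrix of the `G_i` is at least `(3/4) λ₀`, the squared speed is at least
`(λ₀/2) ∑ c_i²`, which forces the loss down to `1/2` in time `16 (n + L(0)) / λ₀`, and a loss of
`1/2` certifies all examples. And if the linearized margins are of order `τ ≥ 16 n` at
`W(0) + ΔW`, then as long as the loss exceeds `1/2` the distance to this reference point decreases
at a rate that bounds `τ ∫ ∑ c_i` by a multiple of `‖ΔW‖²`. A neuron moves at a speed of order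
`√(d/m) ∑ c_i`, so no neuron leaves the ball of radius `R` (`IsGradientFlow.l2_row_sub_lt`,
`IsGradientFlow.converges`).

*The reference point.* The choice `ΔW = ∑ v_i G_i` with `v = (H^∞)⁻¹ (τ - u)` gives linearized
margins close to `τ` (`interpolation_bounds`). Its norm is controlled by the quadratic form of
`(H^∞)⁻¹` at `u`, for which the bound `‖u‖² / λ₀` would be too large. Instead, the part of the
margins that is odd in the second layer satisfies `E ⟨c, u⟩² ≤ C n cᵀ H^∞ c`
(`lintegral_sum_midRelu_sq_le`), hence `E uᵀ (H^∞)⁻¹ u ≤ C n²`. The reason is Euler's identity: a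
linear combination of unperturbed neurons is the inner product of its gradient with the projection
of the weight vector to the span of the inputs, and the gradient is invariant under scaling of this
projection, whose dimension is at most `n` (`lintegral_sum_relu_sq_le`). The even part of the
margins is of order `ε d √m`.

*Probability.* A preactivation bound grows at a rate of order `‖x_i‖` in the direction `x_i`, so
that the translates by multiples of `x_i` of the event that it is small are disjoint; hence this event is
unlikely (`gaussianPi_abs_le`). Together with the variance of the Gram matrix and the second moment
above, Markov's inequality shows that all the conditions hold with probability at least `1 - δ`
(`initMeasure_not_goodInit_le`), and for the given `ε` and `m` they imply convergence
(`GoodInit.converges`).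
-/

namespace IBP

/-! ### Clarke subdifferentials and existence of gradient flows -/

section Clarke

variable {E : Type*} [NormedAddCommGroup E] [InnerProductSpace ℝ E]

/-- In finite dimension the convex hull of a compact set is compact (Carathéodory). -/
theorem isCompact_convexHull_of_isCompact [FiniteDimensional ℝ E] {s : Set E}
    (hs : IsCompact s) : IsCompact (convexHull ℝ s) := by
  classical
  rcases s.eq_empty_or_nonempty with rfl | ⟨x₀, hx₀⟩
  · simp
  set D := Module.finrank ℝ E + 1 with hD
  let F : (Fin D → ℝ) × (Fin D → E) → E := fun q => ∑ i, q.1 i • q.2 i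
  have hF : Continuous F := by fun_prop
  have hcomp : IsCompact (stdSimplex ℝ (Fin D) ×ˢ (Set.univ.pi fun _ : Fin D => s)) :=
    (isCompact_stdSimplex ℝ (Fin D)).prod (isCompact_univ_pi fun _ => hs)
  have : convexHull ℝ s = F '' (stdSimplex ℝ (Fin D) ×ˢ (Set.univ.pi fun _ : Fin D => s)) := by
    apply Set.Subset.antisymm
    · intro x hx
      obtain ⟨ι, hι, z, w, hz, haff, hw, hw1, hwz⟩ := eq_pos_convex_span_of_mem_convexHull hx
      -- By Carathéodory at most `finrank + 1` points are needed; the other weights are set to `0`.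
      have hcard : Fintype.card ι ≤ D :=
        haff.card_le_finrank_succ.trans
          (Nat.succ_le_succ (Submodule.finrank_le _))
      obtain ⟨e⟩ : Nonempty (ι ↪ Fin D) := by
        apply Function.Embedding.nonempty_of_card_le
        simpa using hcard
      refine ⟨(fun k => if h : ∃ i, e i = k then w h.choose else 0,
        fun k => if h : ∃ i, e i = k then z h.choose else x₀), ⟨⟨?_, ?_⟩, ?_⟩, ?_⟩
      · intro k
        dsimp only
        split_ifs with h
        · exact (hw _).le
        · exact le_rfl
      · dsimp only
        rw [← hw1, ← Finset.sum_subset (Finset.subset_univ (Finset.univ.map e))]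
        · rw [Finset.sum_map]
          refine Finset.sum_congr rfl fun i _ => ?_
          have h : ∃ j, e j = e i := ⟨i, rfl⟩
          rw [dif_pos h, e.injective h.choose_spec]
        · intro k _ hk
          rw [dif_neg]
          rintro ⟨i, rfl⟩
          exact hk (by simp)
      · intro k _
        dsimp only
        split_ifs with h
        · exact hz ⟨_, rfl⟩
        · exact hx₀
      · simp only [F]
        rw [← hwz, ← Finset.sum_subset (Finset.subset_univ (Finset.univ.map e))]
        · rw [Finset.sum_map]
          refine Finset.sum_congr rfl fun i _ => ?_
          have h : ∃ j, e j = e i := ⟨i, rfl⟩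
          rw [dif_pos h, dif_pos h, e.injective h.choose_spec]
        · intro k _ hk
          rw [dif_neg, zero_smul]
          rintro ⟨i, rfl⟩
          exact hk (by simp)
    · rintro _ ⟨q, ⟨hq1, hq2⟩, rfl⟩
      exact (convex_convexHull ℝ s).sum_mem (fun i _ => hq1.1 i) hq1.2
        fun i _ => subset_convexHull ℝ s (hq2 i (mem_univ i))
  rw [this]
  exact hcomp.image hF

variable [CompleteSpace E]

/-- The graph of the gradient of `f`, over the points where `f` is differentiable. -/
def gradientGraph (f : E → ℝ) : Set (E × E) := {q | HasGradientAt f q.2 q.1}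

/-- The limits of gradients of `f` along sequences converging to `w`. -/
def limitingGradients (f : E → ℝ) (w : E) : Set E := {g | (w, g) ∈ closure (gradientGraph f)}

theorem clarkeSubdifferential_eq (f : E → ℝ) (w : E) :
    clarkeSubdifferential f w = convexHull ℝ (limitingGradients f w) := by
  unfold clarkeSubdifferential limitingGradients
  congr 1
  ext g
  simp only [mem_ofPred_eq, mem_closure_iff_seq_limit]
  constructor
  · rintro ⟨z, p, h, hz, hp⟩
    exact ⟨fun k => (z k, p k), h, hz.prodMk_nhds hp⟩
  · rintro ⟨q, h, hq⟩
    exact ⟨fun k => (q k).1, fun k => (q k).2, h, (continuous_fst.tendsto _).comp hq,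
      (continuous_snd.tendsto _).comp hq⟩

/-- A bound on the gradients in a varying direction passes to the Clarke subdifferential. -/
theorem inner_le_of_mem_clarkeSubdifferential {f : E → ℝ} {w : E} {V : E → E} {b : E → ℝ}
    (hV : ContinuousAt V w) (hb : ContinuousAt b w)
    (h : ∀ᶠ z in 𝓝 w, ∀ p, HasGradientAt f p z → inner ℝ p (V z) ≤ b z)
    {g : E} (hg : g ∈ clarkeSubdifferential f w) : inner ℝ g (V w) ≤ b w := by
  have hconv : Convex ℝ {g : E | inner ℝ g (V w) ≤ b w} := by
    refine convex_halfSpace_le ⟨fun x y => inner_add_left _ _ _, fun c x => ?_⟩ _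
    simp [real_inner_smul_left]
  refine convexHull_min ?_ hconv hg
  rintro p ⟨z, q, hq, hz, hqp⟩
  refine le_of_tendsto_of_tendsto (hqp.inner (hV.tendsto.comp hz)) (hb.tendsto.comp hz) ?_
  filter_upwards [hz.eventually h] with k hk using hk _ (hq k)

theorem HasGradientAt.norm_le_of_lipschitz {f : E → ℝ} {K : NNReal} (hf : LipschitzWith K f)
    {z p : E} (h : HasGradientAt f p z) : ‖p‖ ≤ K := by
  have := (hasGradientAt_iff_hasFDerivAt.1 h).le_of_lipschitz hf
  simpa using this

/-- A one-sided estimate of `f` along a ray bounds its gradient in that direction. -/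
theorem HasGradientAt.inner_le {f : E → ℝ} {z p V : E} (h : HasGradientAt f p z) {ψ : ℝ → ℝ}
    {b : ℝ} (hψ : HasDerivAt ψ b 0) (h0 : ψ 0 = f z)
    (hle : ∀ᶠ s in 𝓝[>] (0 : ℝ), f (z + s • V) ≤ ψ s) : inner ℝ p V ≤ b := by
  have h1 : HasDerivAt (fun s : ℝ => f (z + s • V)) (inner ℝ p V) 0 := by
    have hl : HasDerivAt (fun s : ℝ => z + s • V) V 0 := by
      simpa using ((hasDerivAt_id (0 : ℝ)).smul_const V).const_add z
    have hf : HasFDerivAt f ((InnerProductSpace.toDual ℝ E) p) (z + (0 : ℝ) • V) := by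
      simpa using hasGradientAt_iff_hasFDerivAt.1 h
    have := hf.comp_hasDerivAt (0 : ℝ) hl
    rw [InnerProductSpace.toDual_apply_apply] at this
    exact this
  have t1 := (hasDerivAt_iff_tendsto_slope_zero.1 h1).mono_left
    (nhdsWithin_mono (0 : ℝ) (fun x hx => (ne_of_gt hx : x ≠ 0) : Ioi (0 : ℝ) ⊆ {0}ᶜ))
  have t2 := (hasDerivAt_iff_tendsto_slope_zero.1 hψ).mono_left
    (nhdsWithin_mono (0 : ℝ) (fun x hx => (ne_of_gt hx : x ≠ 0) : Ioi (0 : ℝ) ⊆ {0}ᶜ))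
  refine le_of_tendsto_of_tendsto t1 t2 ?_
  filter_upwards [hle, self_mem_nhdsWithin] with s hs hs0
  have hs0' : 0 < s := hs0
  simp only [zero_add, zero_smul, add_zero, smul_eq_mul]
  rw [h0]
  gcongr

variable [FiniteDimensional ℝ E]

theorem limitingGradients_isCompact {f : E → ℝ} {K : NNReal} (hf : LipschitzWith K f) (w : E) :
    IsCompact (limitingGradients f w) := by
  have hclosed : IsClosed (limitingGradients f w) :=
    isClosed_closure.preimage (Continuous.prodMk_right w)
  refine (isCompact_closedBall (0 : E) K).of_isClosed_subset hclosed ?_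
  intro g hg
  have : closure (gradientGraph f) ⊆ {q : E × E | q.2 ∈ Metric.closedBall (0 : E) K} := by
    refine closure_minimal ?_ (Metric.isClosed_closedBall.preimage continuous_snd)
    intro q hq
    simpa using HasGradientAt.norm_le_of_lipschitz hf hq
  exact this hg

/-- Upper semicontinuity: a strict linear bound on the limiting gradients at `w` holds for the
gradients at all points near `w`. -/
theorem eventually_inner_gradient_lt {f : E → ℝ} {K : NNReal} (hf : LipschitzWith K f) {w q : E}
    {α : ℝ} (h : ∀ g ∈ limitingGradients f w, inner ℝ q g < α) :
    ∀ᶠ z in 𝓝 w, ∀ p, HasGradientAt f p z → inner ℝ q p < α := by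
  by_contra hcon
  rw [not_eventually] at hcon
  obtain ⟨z, hz, hzp⟩ := exists_seq_forall_of_frequently hcon
  simp only [not_forall, not_lt] at hzp
  choose p hp hpα using hzp
  obtain ⟨g, -, φ, hφ, hg⟩ := (isCompact_closedBall (0 : E) K).tendsto_subseq
    (fun k => by simpa using HasGradientAt.norm_le_of_lipschitz hf (hp k) : ∀ k, p k ∈ _)
  have hmem : g ∈ limitingGradients f w := by
    refine mem_closure_iff_seq_limit.2 ⟨fun k => (z (φ k), p (φ k)), fun k => hp _, ?_⟩
    exact (hz.comp hφ.tendsto_atTop).prodMk_nhds hg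
  refine absurd (h g hmem) (not_lt.2 ?_)
  exact ge_of_tendsto' (tendsto_const_nhds.inner hg) fun k => hpα _

/-- Points of differentiability of a Lipschitz function are dense (Rademacher). -/
theorem exists_hasGradientAt_near {f : E → ℝ} {K : NNReal} (hf : LipschitzWith K f) (z : E)
    {h : ℝ} (hh : 0 < h) : ∃ z' p, dist z' z < h ∧ HasGradientAt f p z' := by
  borelize E
  let μ : Measure E := Measure.addHaar
  have hd : Dense {x | DifferentiableAt ℝ f x} :=
    Measure.dense_of_ae (hf.ae_differentiableAt (μ := μ))
  obtain ⟨z', hz', hd'⟩ := hd.exists_dist_lt z hh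
  exact ⟨z', _, by rwa [dist_comm], hz'.hasGradientAt⟩

section Euler

/-- The nodes of the explicit Euler scheme with step `h` and slope field `-p`. -/
def eulerNode (h : ℝ) (p : E → E) (w₀ : E) : ℕ → E
  | 0 => w₀
  | k + 1 => eulerNode h p w₀ k - h • p (eulerNode h p w₀ k)

omit [CompleteSpace E] [FiniteDimensional ℝ E] in
theorem eulerNode_sub (h : ℝ) (p : E → E) (w₀ : E) {a b : ℕ} (hab : a ≤ b) :
    eulerNode h p w₀ b - eulerNode h p w₀ a
      = -(h • ∑ k ∈ Finset.Ico a b, p (eulerNode h p w₀ k)) := by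
  induction b, hab using Nat.le_induction with
  | base => simp
  | succ b hab ih =>
    rw [Finset.sum_Ico_succ_top hab, smul_add, eulerNode]
    rw [show ∀ x y z : E, x - y - z = (x - z) - y by intros; abel, ih]
    abel

end Euler

/-- A Lipschitz function on a finite-dimensional space has a gradient flow from every point: a
limit, along an ultrafilter, of Euler schemes whose slopes are gradients at nearby points of
differentiability. -/
theorem exists_isGradientFlow {f : E → ℝ} {K : NNReal} (hf : LipschitzWith K f) (w₀ : E) :
    ∃ w : ℝ → E, IsGradientFlow f w₀ w := by
  let h : ℕ → ℝ := fun N => 1 / ((N : ℝ) + 1)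
  have hpos : ∀ N, 0 < h N := fun N => Nat.one_div_pos_of_nat
  have hle1 : ∀ N, h N ≤ 1 := fun N => by
    simp only [h]; rw [div_le_one (by positivity)]; linarith [Nat.cast_nonneg (α := ℝ) N]
  have hlim : Tendsto h atTop (𝓝 0) := tendsto_one_div_add_atTop_nhds_zero_nat
  -- Slopes: the gradient at a point of differentiability within distance `h N` of the node.
  choose z' p hz' hp using fun (N : ℕ) (z : E) => exists_hasGradientAt_near hf z (hpos N)
  let x : ℕ → ℕ → E := fun N => eulerNode (h N) (p N) w₀
  have hpn : ∀ N z, ‖p N z‖ ≤ K := fun N z => HasGradientAt.norm_le_of_lipschitz hf (hp N z)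
  have hxd : ∀ N a b, a ≤ b → ‖x N b - x N a‖ ≤ K * (h N * ((b : ℝ) - a)) := by
    intro N a b hab
    simp only [x]
    rw [eulerNode_sub _ _ _ hab, norm_neg, norm_smul, Real.norm_of_nonneg (hpos N).le]
    have : ‖∑ k ∈ Finset.Ico a b, p N (eulerNode (h N) (p N) w₀ k)‖ ≤ ((b : ℝ) - a) * K := by
      refine (norm_sum_le _ _).trans ?_
      refine (Finset.sum_le_card_nsmul _ _ (K : ℝ) fun k _ => hpn _ _).trans ?_
      simp [Nat.cast_sub hab]
    nlinarith [mul_le_mul_of_nonneg_left this (hpos N).le]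
  -- `c N t` is the index of the node at time `t`.
  let c : ℕ → ℝ → ℕ := fun N t => ⌊t / h N⌋₊
  have hc1 : ∀ N t, 0 ≤ t → h N * c N t ≤ t := by
    intro N t ht
    have := Nat.floor_le (div_nonneg ht (hpos N).le)
    rw [le_div_iff₀ (hpos N)] at this
    linarith
  have hc2 : ∀ N t, t - h N ≤ h N * c N t := by
    intro N t
    have := (Nat.lt_floor_add_one (t / h N)).le
    rw [div_le_iff₀ (hpos N)] at this
    simp only [c]
    linarith
  have hcm : ∀ N s t, s ≤ t → c N s ≤ c N t := fun N s t hst =>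
    Nat.floor_le_floor (div_le_div_of_nonneg_right hst (hpos N).le)
  have hwd : ∀ N s t, 0 ≤ s → s ≤ t → ‖x N (c N t) - x N (c N s)‖ ≤ K * ((t - s) + h N) := by
    intro N s t hs hst
    refine (hxd N _ _ (hcm N s t hst)).trans ?_
    have := hc1 N t (hs.trans hst)
    have := hc2 N s
    gcongr
    linarith
  -- Along an ultrafilter the bounded values at each time converge, without extraction of a
  -- subsequence.
  let l : Ultrafilter ℕ := hyperfilter ℕ
  have hl : (l : Filter ℕ) ≤ atTop := by
    rw [← Nat.cofinite_eq_atTop]; exact hyperfilter_le_cofinite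
  have hlimit : ∀ t : ℝ, ∃ y, 0 ≤ t → Tendsto (fun N => x N (c N t)) l (𝓝 y) := by
    intro t
    by_cases ht : 0 ≤ t
    · have hmem : ∀ N, x N (c N t) ∈ Metric.closedBall w₀ (K * (t + 1)) := by
        intro N
        have h1 := hwd N 0 t le_rfl ht
        have h2 : x N (c N 0) = w₀ := by simp [c, x, eulerNode]
        rw [h2] at h1
        rw [mem_closedBall_iff_norm]
        refine h1.trans ?_
        have := hle1 N
        gcongr
        linarith
      obtain ⟨y, -, hy⟩ := (isCompact_closedBall w₀ (K * (t + 1))).ultrafilter_le_nhds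
        (l.map fun N => x N (c N t)) (by
          rw [le_principal_iff]
          exact Eventually.of_forall (f := (l : Filter ℕ)) hmem)
      exact ⟨y, fun _ => hy⟩
    · exact ⟨0, fun h => absurd h ht⟩
  choose y hy using hlimit
  have hylip : ∀ s t, 0 ≤ s → s ≤ t → ‖y t - y s‖ ≤ K * (t - s) := by
    intro s t hs hst
    have h1 : Tendsto (fun N => ‖x N (c N t) - x N (c N s)‖) l (𝓝 ‖y t - y s‖) :=
      ((hy t (hs.trans hst)).sub (hy s hs)).norm
    have h2 : Tendsto (fun N => (K : ℝ) * ((t - s) + h N)) l (𝓝 (K * ((t - s) + 0))) :=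
      ((hlim.mono_left hl).const_add _).const_mul _
    rw [add_zero] at h2
    exact le_of_tendsto_of_tendsto' h1 h2 fun N => hwd N s t hs hst
  let w : ℝ → E := fun t => y (max t 0)
  have hwlip : LipschitzWith K w := by
    refine LipschitzWith.of_dist_le_mul fun s t => ?_
    wlog hst : t ≤ s generalizing s t
    · rw [dist_comm, dist_comm s t]; exact this t s (le_of_not_ge hst)
    rw [dist_eq_norm, Real.dist_eq, abs_of_nonneg (sub_nonneg.2 hst)]
    refine (hylip _ _ (le_max_right _ _) (max_le_max_right 0 hst)).trans ?_
    refine mul_le_mul_of_nonneg_left ?_ K.2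
    simp only [max_def]
    split_ifs <;> linarith
  refine ⟨w, ?_, fun T _ => hwlip.lipschitzOnWith.absolutelyContinuousOnInterval, ?_⟩
  · have h1 : Tendsto (fun N => x N (c N 0)) l (𝓝 (y 0)) := hy 0 le_rfl
    have h2 : (fun N => x N (c N 0)) = fun _ => w₀ := by
      ext N; simp [c, x, eulerNode]
    rw [h2] at h1
    simp only [w, max_self]
    exact tendsto_nhds_unique h1 tendsto_const_nhds
  rw [ae_restrict_iff' measurableSet_Ioi]
  filter_upwards [hwlip.ae_differentiableAt_real] with t htd ht
  have ht0 : (0 : ℝ) < t := ht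
  obtain ⟨v, hv⟩ : ∃ v, HasDerivAt w v t := ⟨_, htd.hasDerivAt⟩
  refine ⟨-v, ?_, by simpa using hv⟩
  -- If `-v` is not in the Clarke subdifferential, a hyperplane separates it from the limiting
  -- gradients; by upper semicontinuity it separates it from the slopes used near time `t`.
  by_contra hnot
  rw [clarkeSubdifferential_eq] at hnot
  have hcl : IsClosed (convexHull ℝ (limitingGradients f (w t))) :=
    (isCompact_convexHull_of_isCompact (limitingGradients_isCompact hf (w t))).isClosed
  obtain ⟨φ, α, hφ, hφv⟩ := geometric_hahn_banach_closed_point (convex_convexHull ℝ _) hcl hnot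
  let q : E := (InnerProductSpace.toDual ℝ E).symm φ
  have hq : ∀ g, φ g = inner ℝ q g := fun g => by simp [q]
  have husc := eventually_inner_gradient_lt hf (w := w t) (q := q) (α := α)
    (fun g hg => by rw [← hq]; exact hφ g (subset_convexHull ℝ _ hg))
  obtain ⟨r, hr, hball⟩ := Metric.eventually_nhds_iff.1 husc
  -- The Euler increments over `[t, t + s]` use slopes on one side of the hyperplane, and this
  -- passes to the limit.
  have hkey : ∀ᶠ s in 𝓝[>] (0 : ℝ), -(α * s) ≤ inner ℝ q (w (t + s) - w t) := by
    have hsmall : ∀ᶠ s in 𝓝[>] (0 : ℝ), (K : ℝ) * s < r / 4 := by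
      have : Tendsto (fun s : ℝ => (K : ℝ) * s) (𝓝[>] 0) (𝓝 (K * 0)) :=
        (tendsto_id.const_mul _).mono_left nhdsWithin_le_nhds
      rw [mul_zero] at this
      exact this.eventually (gt_mem_nhds (by positivity))
    filter_upwards [hsmall, self_mem_nhdsWithin] with s hs hs0
    have hs0' : 0 < s := hs0
    have e1 : w t = y t := by simp [w, max_eq_left ht0.le]
    have e2 : w (t + s) = y (t + s) := by simp [w, max_eq_left (add_pos ht0 hs0').le]
    have l1 : Tendsto (fun N => inner ℝ q (x N (c N (t + s)) - x N (c N t))) l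
        (𝓝 (inner ℝ q (w (t + s) - w t))) := by
      rw [e1, e2]
      exact tendsto_const_nhds.inner ((hy _ (add_pos ht0 hs0').le).sub (hy t ht0.le))
    have l2 : Tendsto (fun N => -(α * s) - |α| * h N) l (𝓝 (-(α * s) - |α| * 0)) :=
      ((hlim.mono_left hl).const_mul _).const_sub _
    rw [mul_zero, sub_zero] at l2
    refine le_of_tendsto_of_tendsto l2 l1 ?_
    have n1 : ∀ᶠ N in (l : Filter ℕ), dist (x N (c N t)) (w t) < r / 4 := by
      rw [e1]; exact (Metric.tendsto_nhds.1 (hy t ht0.le)) _ (by positivity)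
    have n2 : ∀ᶠ N in (l : Filter ℕ), h N < r / 4 :=
      (hlim.mono_left hl).eventually (gt_mem_nhds (by positivity))
    have n3 : ∀ᶠ N in (l : Filter ℕ), (K : ℝ) * h N < r / 4 := by
      have := (hlim.mono_left hl).const_mul (K : ℝ)
      rw [mul_zero] at this
      exact this.eventually (gt_mem_nhds (by positivity))
    filter_upwards [n1, n2, n3] with N h1 h2 h3
    have hcc : c N t ≤ c N (t + s) := hcm N _ _ (by linarith)
    have hterm : ∀ k ∈ Finset.Ico (c N t) (c N (t + s)), inner ℝ q (p N (x N k)) ≤ α := by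
      intro k hk
      rw [Finset.mem_Ico] at hk
      refine (hball (y := z' N (x N k)) ?_ _ (hp N (x N k))).le
      have d1 : dist (x N k) (x N (c N t)) ≤ K * (s + h N) := by
        rw [dist_eq_norm]
        refine (hxd N _ _ hk.1).trans ?_
        have := hc1 N (t + s) (add_pos ht0 hs0').le
        have := hc2 N t
        have hk2 : (k : ℝ) ≤ c N (t + s) := by exact_mod_cast hk.2.le
        have := mul_le_mul_of_nonneg_left hk2 (hpos N).le
        gcongr
        linarith
      have d2 := hz' N (x N k)
      have d3 := dist_triangle4 (z' N (x N k)) (x N k) (x N (c N t)) (w t)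
      nlinarith
    have e3 : x N (c N (t + s)) - x N (c N t)
        = -(h N • ∑ k ∈ Finset.Ico (c N t) (c N (t + s)), p N (x N k)) :=
      eulerNode_sub _ _ _ hcc
    rw [e3, inner_neg_right, real_inner_smul_right, inner_sum]
    have hsum := Finset.sum_le_card_nsmul _ _ α hterm
    rw [Nat.card_Ico, nsmul_eq_mul, Nat.cast_sub hcc] at hsum
    have := mul_le_mul_of_nonneg_left hsum (hpos N).le
    have b1 := hc1 N (t + s) (add_pos ht0 hs0').le
    have b2 := hc2 N (t + s)
    have b3 := hc1 N t ht0.le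
    have b4 := hc2 N t
    have hb : |h N * ((c N (t + s) : ℝ) - c N t) - s| ≤ h N := by
      rw [abs_le]; constructor <;> linarith
    have hb2 : α * (h N * ((c N (t + s) : ℝ) - c N t) - s) ≤ |α| * h N := by
      refine (le_abs_self _).trans ?_
      rw [abs_mul]
      gcongr
    linarith
  have hd : Tendsto (fun s : ℝ => inner ℝ q (s⁻¹ • (w (t + s) - w t))) (𝓝[>] 0)
      (𝓝 (inner ℝ q v)) :=
    tendsto_const_nhds.inner ((hasDerivAt_iff_tendsto_slope_zero.1 hv).mono_left
      (nhdsWithin_mono (0 : ℝ) (fun x hx => (ne_of_gt hx : x ≠ 0) : Ioi (0 : ℝ) ⊆ {0}ᶜ)))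
  have hge : -α ≤ inner ℝ q v := by
    refine ge_of_tendsto hd ?_
    filter_upwards [hkey, self_mem_nhdsWithin] with s hs hs0
    have hs0' : 0 < s := hs0
    rw [real_inner_smul_right, ← div_eq_inv_mul, le_div_iff₀ hs0']
    linarith
  rw [hq, inner_neg_right] at hφv
  linarith

end Clarke

/-! ### Sums of logistic losses -/

section Logistic

/-- `1 / (1 + e^u)`, minus the derivative of the logistic loss. -/
noncomputable def logisticWeight (u : ℝ) : ℝ := 1 / (1 + Real.exp u)

theorem logisticWeight_pos (u : ℝ) : 0 < logisticWeight u := by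
  unfold logisticWeight; positivity

theorem logisticWeight_le_one (u : ℝ) : logisticWeight u ≤ 1 := by
  unfold logisticWeight
  rw [div_le_one (by positivity)]
  linarith [Real.exp_pos u]

theorem continuous_logisticWeight : Continuous logisticWeight := by
  unfold logisticWeight
  exact continuous_const.div (by fun_prop) fun u => by positivity

theorem hasDerivAt_logistic (u : ℝ) : HasDerivAt logistic (-logisticWeight u) u := by
  have h1 : HasDerivAt (fun u : ℝ => 1 + Real.exp (-u)) (-Real.exp (-u)) u := by
    simpa using ((hasDerivAt_neg u).exp).const_add 1
  have h2 := h1.log (by positivity)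
  refine h2.congr_deriv ?_
  unfold logisticWeight
  rw [Real.exp_neg]
  field_simp
  ring

theorem logistic_pos (u : ℝ) : 0 < logistic u :=
  Real.log_pos (by linarith [Real.exp_pos (-u)])

theorem logistic_antitone : Antitone logistic := by
  intro a b hab
  unfold logistic
  gcongr

theorem logistic_lipschitz : LipschitzWith 1 logistic := by
  refine lipschitzWith_of_nnnorm_deriv_le (fun u => (hasDerivAt_logistic u).differentiableAt) ?_
  intro u
  rw [(hasDerivAt_logistic u).deriv, nnnorm_neg, ← NNReal.coe_le_coe, coe_nnnorm,
    Real.norm_of_nonneg (logisticWeight_pos u).le]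
  exact logisticWeight_le_one u

theorem logistic_le_exp_neg (u : ℝ) : logistic u ≤ Real.exp (-u) := by
  unfold logistic
  have := Real.log_le_sub_one_of_pos (show 0 < 1 + Real.exp (-u) by positivity)
  linarith

/-- A nonpositive margin costs a loss of at least `log 2 > 1/2`, so that a total loss of at most
`1/2` certifies every example. -/
theorem pos_of_logistic_lt {u : ℝ} (h : logistic u ≤ 1 / 2) : 0 < u := by
  by_contra hu
  have h1 := logistic_antitone (not_lt.1 hu)
  have h2 : logistic 0 = Real.log 2 := by unfold logistic; norm_num
  have := Real.log_two_gt_d9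
  linarith

theorem half_le_logisticWeight {u : ℝ} (h : u ≤ 0) : 1 / 2 ≤ logisticWeight u := by
  unfold logisticWeight
  have : Real.exp u ≤ 1 := Real.exp_le_one_iff.2 h
  gcongr
  linarith

theorem half_logistic_le_logisticWeight {u : ℝ} (h : 0 ≤ u) :
    logistic u / 2 ≤ logisticWeight u := by
  have h1 := logistic_le_exp_neg u
  have h2 : Real.exp (-u) / 2 ≤ logisticWeight u := by
    unfold logisticWeight
    have : 1 ≤ Real.exp u := Real.one_le_exp h
    rw [Real.exp_neg, div_le_div_iff₀ (by positivity) (by positivity)]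
    field_simp
    linarith
  linarith

/-- For positive margins the weight is at most the inverse of the margin: examples with a large
margin hardly contribute to the gradient of the loss. -/
theorem logisticWeight_mul_self_le_one (u : ℝ) : logisticWeight u * u ≤ 1 := by
  unfold logisticWeight
  rw [div_mul_eq_mul_div, div_le_one (by positivity)]
  linarith [Real.add_one_le_exp u]

variable {E : Type*} [NormedAddCommGroup E] [InnerProductSpace ℝ E] [CompleteSpace E] {n : ℕ}

/-- Lower bounds on the growth of the margins in a direction bound every Clarke subgradient of the
logistic loss of these margins in this direction. No differentiability of the margins is needed;
the direction and the bounds may vary with the point. -/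
theorem inner_le_of_mem_clarke_logistic {u : Fin n → E → ℝ} (hu : ∀ i, Continuous (u i)) {w : E}
    {V : E → E} {b : Fin n → E → ℝ} (hV : ContinuousAt V w) (hb : ∀ i, ContinuousAt (b i) w)
    (h : ∀ᶠ z in 𝓝 w, ∀ i, ∀ᶠ s in 𝓝[>] (0 : ℝ), u i z + s * b i z ≤ u i (z + s • V z))
    {g : E} (hg : g ∈ clarkeSubdifferential (fun z => ∑ i, logistic (u i z)) w) :
    inner ℝ g (V w) ≤ -∑ i, logisticWeight (u i w) * b i w := by
  refine inner_le_of_mem_clarkeSubdifferential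
    (b := fun z => -∑ i, logisticWeight (u i z) * b i z) hV ?_ ?_ hg
  · refine ContinuousAt.neg (tendsto_finsetSum _ fun i _ => ?_)
    exact ((continuous_logisticWeight.comp (hu i)).continuousAt).mul (hb i)
  filter_upwards [h] with z hz p hp
  refine HasGradientAt.inner_le hp (ψ := fun s => ∑ i, logistic (u i z + s * b i z)) ?_ ?_ ?_
  · rw [← Finset.sum_neg_distrib]
    refine HasDerivAt.fun_sum fun i _ => ?_
    have h1 : HasDerivAt (fun s : ℝ => u i z + s * b i z) (b i z) 0 := by
      simpa using ((hasDerivAt_id (0 : ℝ)).mul_const (b i z)).const_add (u i z)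
    have h2 : HasDerivAt logistic (-logisticWeight (u i z)) (u i z + 0 * b i z) := by
      simpa using hasDerivAt_logistic (u i z)
    have := h2.comp (0 : ℝ) h1
    rw [neg_mul] at this
    exact this
  · simp
  · filter_upwards [eventually_all.2 hz] with s hs
    exact Finset.sum_le_sum fun i _ => logistic_antitone (hs i)

end Logistic

/-! ### Functions affine along a direction, and the chain rule along a flow -/

section AffineAlong

variable {E : Type*} [NormedAddCommGroup E] [InnerProductSpace ℝ E]

/-- Near `w`, the function `f` is affine in the direction `v`, with the slope `c` at all nearby
base points. -/
def AffineAlong (f : E → ℝ) (w v : E) (c : ℝ) : Prop :=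
  ∀ᶠ q : E × ℝ in 𝓝 (w, 0), f (q.1 + q.2 • v) = f q.1 + q.2 * c

theorem AffineAlong.add {f g : E → ℝ} {w v : E} {c c' : ℝ} (hf : AffineAlong f w v c)
    (hg : AffineAlong g w v c') : AffineAlong (fun z => f z + g z) w v (c + c') := by
  filter_upwards [hf, hg] with q h1 h2
  rw [h1, h2]; ring

theorem AffineAlong.const_mul {f : E → ℝ} {w v : E} {c : ℝ} (hf : AffineAlong f w v c) (a : ℝ) :
    AffineAlong (fun z => a * f z) w v (a * c) := by
  filter_upwards [hf] with q h1
  rw [h1]; ring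

theorem AffineAlong.sum {ι : Type*} {s : Finset ι} {f : ι → E → ℝ} {w v : E} {c : ι → ℝ}
    (hf : ∀ i ∈ s, AffineAlong (f i) w v (c i)) :
    AffineAlong (fun z => ∑ i ∈ s, f i z) w v (∑ i ∈ s, c i) := by
  have := (Finset.eventually_all s).2 hf
  filter_upwards [this] with q hq
  rw [Finset.mul_sum, ← Finset.sum_add_distrib]
  exact Finset.sum_congr rfl hq

theorem affineAlong_of_linear {f : E → ℝ} {w v : E}
    (hf : ∀ z (s : ℝ), f (z + s • v) = f z + s * f v) : AffineAlong f w v (f v) :=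
  Eventually.of_forall fun _ => hf _ _

/-- Composition with a function that is affine near the value `f w`; if the slope of `f` vanishes
the outer function is arbitrary. -/
theorem AffineAlong.comp {f : E → ℝ} (hf : Continuous f) {w v : E} {c : ℝ}
    (h : AffineAlong f w v c) {φ : ℝ → ℝ} {κ : ℝ}
    (hφ : c = 0 ∨ ∀ᶠ p in 𝓝 (f w), φ p = φ (f w) + κ * (p - f w)) :
    ∃ c', AffineAlong (fun z => φ (f z)) w v c' := by
  rcases hφ with rfl | hφ
  · refine ⟨0, ?_⟩
    filter_upwards [h] with q hq
    simp only [hq, mul_zero, add_zero]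
  · refine ⟨κ * c, ?_⟩
    have t1 : Tendsto (fun q : E × ℝ => f q.1) (𝓝 (w, 0)) (𝓝 (f w)) :=
      (hf.comp continuous_fst).tendsto (w, (0 : ℝ))
    have t2 : Tendsto (fun q : E × ℝ => f (q.1 + q.2 • v)) (𝓝 (w, 0)) (𝓝 (f w)) := by
      have : Continuous fun q : E × ℝ => f (q.1 + q.2 • v) := by fun_prop
      simpa using this.tendsto (w, (0 : ℝ))
    filter_upwards [h, t1.eventually hφ, t2.eventually hφ] with q hq h1 h2
    rw [h1, h2, hq]; ring

theorem eventually_abs_affine {a : ℝ} (ha : a ≠ 0) :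
    ∀ᶠ p in 𝓝 a, |p| = |a| + SignType.sign a * (p - a) := by
  rcases lt_or_gt_of_ne ha with h | h
  · filter_upwards [Iio_mem_nhds h] with p hp
    rw [abs_of_neg hp, abs_of_neg h, sign_neg h]; simp; ring
  · filter_upwards [Ioi_mem_nhds h] with p hp
    rw [abs_of_pos hp, abs_of_pos h, sign_pos h]; simp

theorem eventually_relu_affine {a : ℝ} (ha : a ≠ 0) :
    ∀ᶠ p in 𝓝 a, relu p = relu a + (if 0 < a then 1 else 0) * (p - a) := by
  unfold relu
  rcases lt_or_gt_of_ne ha with h | h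
  · filter_upwards [Iio_mem_nhds h] with p hp
    rw [max_eq_right hp.le, max_eq_right h.le, if_neg (not_lt.2 h.le)]; simp
  · filter_upwards [Ioi_mem_nhds h] with p hp
    rw [max_eq_left (le_of_lt hp), max_eq_left h.le, if_pos h]; simp

/-- A Lipschitz function that is affine along the velocity of a curve is differentiable along the
curve. -/
theorem AffineAlong.hasDerivAt_comp {f : E → ℝ} {K : NNReal} (hf : LipschitzWith K f) {W : ℝ → E}
    {t : ℝ} {v : E} {c : ℝ} (hW : HasDerivAt W v t) (h : AffineAlong f (W t) v c) :
    HasDerivAt (fun s => f (W s)) c t := by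
  rw [hasDerivAt_iff_isLittleO_nhds_zero] at hW ⊢
  have h1 : (fun s : ℝ => f (W (t + s)) - f (W t + s • v)) =o[𝓝 0] fun s => s := by
    refine Asymptotics.IsBigO.trans_isLittleO ?_ hW
    refine Asymptotics.IsBigO.of_bound K (Eventually.of_forall fun s => ?_)
    have := hf.dist_le_mul (W (t + s)) (W t + s • v)
    rw [dist_eq_norm, dist_eq_norm] at this
    rwa [sub_sub]
  refine h1.congr' ?_ EventuallyEq.rfl
  have t2 : Tendsto (fun s : ℝ => (W t, s)) (𝓝 0) (𝓝 (W t, 0)) :=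
    (Continuous.prodMk_right (W t)).tendsto 0
  filter_upwards [t2.eventually h] with s hs
  rw [hs, smul_eq_mul]; ring

/-- At almost every zero of a function of one variable its derivative, if it exists, vanishes:
the other zeros are isolated. -/
theorem ae_deriv_eq_zero_of_zero (g : ℝ → ℝ) :
    ∀ᵐ t : ℝ, ∀ c, HasDerivAt g c t → g t = 0 → c = 0 := by
  have hc := countable_setOfPred_isolated_right_within (s := {t : ℝ | g t = 0})
  have : ∀ᵐ t : ℝ, t ∉ {x ∈ {t : ℝ | g t = 0} | 𝓝[{t : ℝ | g t = 0} ∩ Ioi x] x = ⊥} :=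
    measure_eq_zero_iff_ae_notMem.1 (hc.measure_zero volume)
  filter_upwards [this] with t ht c hd h0
  by_contra hne
  refine ht ⟨h0, ?_⟩
  have hev := hd.eventually_ne hne (c := 0)
  rw [← empty_mem_iff_bot, mem_nhdsWithin_iff_eventually]
  rw [eventually_nhdsWithin_iff] at hev
  filter_upwards [hev] with z hz hz2
  exact (hz (ne_of_gt hz2.2) hz2.1).elim

end AffineAlong

/-! ### The margins as functions of the weights -/

section Network

variable {n m d : ℕ}

/-- The Euclidean norm of a vector of `Fin d → ℝ`. -/
noncomputable def l2 (v : Fin d → ℝ) : ℝ := √(∑ k, v k ^ 2)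

theorem l2_nonneg (v : Fin d → ℝ) : 0 ≤ l2 v := Real.sqrt_nonneg _

theorem l2_sq (v : Fin d → ℝ) : l2 v ^ 2 = ∑ k, v k ^ 2 :=
  Real.sq_sqrt (Finset.sum_nonneg fun _ _ => sq_nonneg _)

theorem abs_apply_le_l2 (v : Fin d → ℝ) (k : Fin d) : |v k| ≤ l2 v := by
  rw [l2]
  refine Real.le_sqrt_of_sq_le ?_
  rw [sq_abs]
  exact Finset.single_le_sum (f := fun k => v k ^ 2) (fun _ _ => sq_nonneg _) (Finset.mem_univ k)

theorem sum_abs_mul_le (v x : Fin d → ℝ) : ∑ k, |v k| * |x k| ≤ l2 v * l2 x := by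
  have := Real.sum_mul_le_sqrt_mul_sqrt Finset.univ (fun k => |v k|) fun k => |x k|
  simpa [l2] using this

/-- The interval bound of a preactivation, lower for `s = 1` and upper for `s = -1`. -/
def rowQ (ε s : ℝ) (x w : Fin d → ℝ) : ℝ := ∑ k, w k * x k - s * ε * ∑ k, |w k|

/-- The weight vector of the neuron `r`. -/
def row (W : Weights m d) (r : Fin m) : Fin d → ℝ := fun k => W (r, k)

/-- The linear functional by which `rowQ` is given on the orthant of `w`. -/
noncomputable def rowLin (ε s : ℝ) (x w v : Fin d → ℝ) : ℝ :=
  ∑ k, v k * (x k - s * ε * Real.sign (w k))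

/-- The gradient of `s * relu (rowQ ε s x w)` in `w`, with the value `0` of the derivative of
`relu` at `0` and of the sign at `0`. -/
noncomputable def rowGrad (ε s : ℝ) (x w : Fin d → ℝ) (k : Fin d) : ℝ :=
  s * if 0 < rowQ ε s x w then x k - s * ε * Real.sign (w k) else 0

theorem abs_relu_sub_le (p q : ℝ) : |relu p - relu q| ≤ |p - q| := abs_max_sub_max_le_abs p q 0

theorem continuous_relu : Continuous relu := by unfold relu; fun_prop

theorem continuous_rowQ (ε s : ℝ) (x : Fin d → ℝ) : Continuous (rowQ ε s x) := by
  unfold rowQ; fun_prop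

theorem rowQ_smul (ε s : ℝ) (x w : Fin d → ℝ) {c : ℝ} (hc : 0 ≤ c) :
    rowQ ε s x (c • w) = c * rowQ ε s x w := by
  unfold rowQ
  simp only [Pi.smul_apply, smul_eq_mul, abs_mul, abs_of_nonneg hc, mul_sub, Finset.mul_sum]
  congr 1 <;> refine Finset.sum_congr rfl fun _ _ => by ring

theorem relu_mul {c : ℝ} (hc : 0 ≤ c) (z : ℝ) : relu (c * z) = c * relu z := by
  unfold relu
  rw [mul_max_of_nonneg _ _ hc, mul_zero]

theorem mul_eq_one_or {y a : ℝ} (hy : y = 1 ∨ y = -1) (ha : a = 1 ∨ a = -1) :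
    y * a = 1 ∨ y * a = -1 := by
  rcases hy with rfl | rfl <;> rcases ha with rfl | rfl <;> norm_num

theorem marginLower_eq (ε : ℝ) {a : Fin m → ℝ} (ha : ∀ r, a r = 1 ∨ a r = -1) (W : Weights m d)
    (x : Fin d → ℝ) {y : ℝ} (hy : y = 1 ∨ y = -1) :
    marginLower ε a W x y = (1 / √(m : ℝ)) *
      ∑ r, (y * a r) * relu (rowQ ε (y * a r) x (row W r)) := by
  unfold marginLower
  congr 1
  refine Finset.sum_congr rfl fun r _ => ?_
  rcases mul_eq_one_or hy (ha r) with h | h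
  · rw [h]; norm_num [neuronLower, rowQ, preact, rowL1, row]
  · rw [h]; norm_num [neuronUpper, rowQ, preact, rowL1, row]

theorem marginGrad_eq (ε : ℝ) {a : Fin m → ℝ} (ha : ∀ r, a r = 1 ∨ a r = -1) (W : Weights m d)
    (x : Fin d → ℝ) {y : ℝ} (hy : y = 1 ∨ y = -1) (p : Fin m × Fin d) :
    marginGrad ε a W x y p = (1 / √(m : ℝ)) * rowGrad ε (y * a p.1) x (row W p.1) p.2 := by
  unfold marginGrad rowGrad
  rw [mul_assoc]
  congr 2
  rcases mul_eq_one_or hy (ha p.1) with h | h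
  · rw [h]; norm_num [rowQ, preact, rowL1, row]
  · rw [h]; norm_num [rowQ, preact, rowL1, row]

theorem abs_rowQ_sub_le {ε s : ℝ} (hε : 0 ≤ ε) (hs : s = 1 ∨ s = -1) {x : Fin d → ℝ}
    (hx : ∀ k, ε ≤ x k) (w w' : Fin d → ℝ) :
    |rowQ ε s x w' - rowQ ε s x w| ≤ 2 * l2 x * l2 (w' - w) := by
  have h1 : rowQ ε s x w' - rowQ ε s x w
      = ∑ k, ((w' k - w k) * x k - s * ε * (|w' k| - |w k|)) := by
    unfold rowQ
    simp only [Finset.sum_sub_distrib, sub_mul, ← Finset.mul_sum]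
    ring
  rw [h1]
  refine (Finset.abs_sum_le_sum_abs _ _).trans ?_
  have h2 : ∀ k, |(w' k - w k) * x k - s * ε * (|w' k| - |w k|)|
      ≤ 2 * (|(w' - w) k| * |x k|) := by
    intro k
    refine (abs_sub _ _).trans ?_
    have hs1 : |s| = 1 := by rcases hs with rfl | rfl <;> simp
    have h3 := abs_abs_sub_abs_le_abs_sub (w' k) (w k)
    have h4 : ε ≤ |x k| := (hx k).trans (le_abs_self _)
    rw [abs_mul, abs_mul, abs_mul, hs1, one_mul, abs_of_nonneg hε, Pi.sub_apply]
    nlinarith [mul_le_mul h4 h3 (abs_nonneg _) (abs_nonneg _)]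
  refine (Finset.sum_le_sum fun k _ => h2 k).trans ?_
  rw [← Finset.mul_sum]
  have := sum_abs_mul_le (w' - w) x
  linarith

theorem norm_sq_eq_sum_row (V : Weights m d) : ‖V‖ ^ 2 = ∑ r, l2 (row V r) ^ 2 := by
  rw [EuclideanSpace.real_norm_sq_eq, Fintype.sum_prod_type]
  simp only [l2_sq, row]

theorem sum_l2_row_le (V : Weights m d) : ∑ r, l2 (row V r) ≤ √(m : ℝ) * ‖V‖ := by
  have h := Real.sum_mul_le_sqrt_mul_sqrt Finset.univ (fun _ : Fin m => (1 : ℝ))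
    fun r => l2 (row V r)
  rw [← norm_sq_eq_sum_row, Real.sqrt_sq (norm_nonneg _)] at h
  simpa using h

theorem row_sub (V W : Weights m d) (r : Fin m) : row (V - W) r = row V r - row W r := rfl

theorem marginLower_lipschitz {ε : ℝ} (hε : 0 ≤ ε) {a : Fin m → ℝ}
    (ha : ∀ r, a r = 1 ∨ a r = -1) {x : Fin d → ℝ} (hx : ∀ k, ε ≤ x k) {y : ℝ}
    (hy : y = 1 ∨ y = -1) :
    LipschitzWith (2 * l2 x).toNNReal fun W : Weights m d => marginLower ε a W x y := by
  refine LipschitzWith.of_dist_le_mul fun W V => ?_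
  rw [Real.coe_toNNReal _ (mul_nonneg zero_le_two (l2_nonneg x)), Real.dist_eq, dist_eq_norm,
    marginLower_eq ε ha W x hy, marginLower_eq ε ha V x hy, ← mul_sub, ← Finset.sum_sub_distrib,
    abs_mul, abs_of_nonneg (by positivity : (0 : ℝ) ≤ 1 / √(m : ℝ))]
  have h1 : |∑ r, ((y * a r) * relu (rowQ ε (y * a r) x (row W r))
      - (y * a r) * relu (rowQ ε (y * a r) x (row V r)))| ≤ 2 * l2 x * (√(m : ℝ) * ‖W - V‖) := by
    refine (Finset.abs_sum_le_sum_abs _ _).trans ?_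
    refine (Finset.sum_le_sum (g := fun r => 2 * l2 x * l2 (row (W - V) r)) fun r _ => ?_).trans ?_
    · have hs := mul_eq_one_or hy (ha r)
      have hs1 : |y * a r| = 1 := by rcases hs with h | h <;> simp [h]
      rw [← mul_sub, abs_mul, hs1, one_mul]
      exact (abs_relu_sub_le _ _).trans (abs_rowQ_sub_le hε hs hx _ _)
    · rw [← Finset.mul_sum]
      exact mul_le_mul_of_nonneg_left (sum_l2_row_le _) (mul_nonneg zero_le_two (l2_nonneg x))
  rcases Nat.eq_zero_or_pos m with rfl | hm
  · simp only [Nat.cast_zero, Real.sqrt_zero, div_zero, zero_mul]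
    exact mul_nonneg (mul_nonneg zero_le_two (l2_nonneg x)) (norm_nonneg _)
  · have hm' : 0 < √(m : ℝ) := Real.sqrt_pos.2 (by exact_mod_cast hm)
    calc 1 / √(m : ℝ) * _ ≤ 1 / √(m : ℝ) * (2 * l2 x * (√(m : ℝ) * ‖W - V‖)) := by gcongr
      _ = 2 * l2 x * ‖W - V‖ := by field_simp

/-- The margins are positively homogeneous of degree one in the weights. -/
theorem marginLower_smul (ε : ℝ) {a : Fin m → ℝ} (ha : ∀ r, a r = 1 ∨ a r = -1)
    (W : Weights m d) (x : Fin d → ℝ) {y : ℝ} (hy : y = 1 ∨ y = -1) {c : ℝ} (hc : 0 ≤ c) :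
    marginLower ε a (c • W) x y = c * marginLower ε a W x y := by
  rw [marginLower_eq ε ha _ x hy, marginLower_eq ε ha _ x hy, mul_left_comm, Finset.mul_sum _ _ c]
  congr 1
  refine Finset.sum_congr rfl fun r _ => ?_
  rw [show row (c • W) r = c • row W r from rfl, rowQ_smul _ _ _ _ hc, relu_mul hc]
  ring

theorem robustLoss_lipschitz {ε : ℝ} (hε : 0 ≤ ε) {a : Fin m → ℝ}
    (ha : ∀ r, a r = 1 ∨ a r = -1) {x : Fin n → Fin d → ℝ} (hx : ∀ i k, ε ≤ x i k)
    {y : Fin n → ℝ} (hy : ∀ i, y i = 1 ∨ y i = -1) :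
    ∃ K, LipschitzWith K (robustLoss ε x y a : Weights m d → ℝ) := by
  refine ⟨∑ i, 1 * (2 * l2 (x i)).toNNReal, ?_⟩
  refine LipschitzWith.of_dist_le_mul fun W V => ?_
  unfold robustLoss
  rw [Real.dist_eq, ← Finset.sum_sub_distrib, NNReal.coe_sum, Finset.sum_mul]
  refine (Finset.abs_sum_le_sum_abs _ _).trans (Finset.sum_le_sum fun i _ => ?_)
  have := (logistic_lipschitz.comp (marginLower_lipschitz hε ha (hx i) (hy i))).dist_le_mul W V
  rwa [Real.dist_eq] at this

end Network

section Network

variable {n m d : ℕ}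

/-! ### Energy identity along gradient flows -/

/-- The IBP margins of a training set. -/
noncomputable def margin (ε : ℝ) (x : Fin n → Fin d → ℝ) (y : Fin n → ℝ) (a : Fin m → ℝ)
    (i : Fin n) (W : Weights m d) : ℝ := marginLower ε a W (x i) (y i)

theorem robustLoss_eq (ε : ℝ) (x : Fin n → Fin d → ℝ) (y : Fin n → ℝ) (a : Fin m → ℝ) :
    (robustLoss ε x y a : Weights m d → ℝ) = fun W => ∑ i, logistic (margin ε x y a i W) := rfl

/-- Along a curve, at almost every time a margin is affine in the direction of the velocity: a
coordinate or a preactivation bound that vanishes has zero derivative at almost every such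
time, so that the kinks are not seen. -/
theorem ae_affineAlong_margin {ε : ℝ} (hε : 0 ≤ ε) {a : Fin m → ℝ}
    (ha : ∀ r, a r = 1 ∨ a r = -1) {x : Fin d → ℝ} (hx : ∀ k, ε ≤ x k) {y : ℝ}
    (hy : y = 1 ∨ y = -1) (W : ℝ → Weights m d) :
    ∀ᵐ t : ℝ, ∀ v, HasDerivAt W v t →
      ∃ D, AffineAlong (fun z : Weights m d => marginLower ε a z x y) (W t) v D := by
  have h1 : ∀ᵐ t : ℝ, ∀ p : Fin m × Fin d, ∀ c,
    HasDerivAt (fun s => W s p) c t → W t p = 0 → c = 0 :=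
    ae_all_iff.2 fun p => ae_deriv_eq_zero_of_zero fun s => W s p
  have h2 : ∀ᵐ t : ℝ, ∀ r : Fin m, ∀ c,
      HasDerivAt (fun s => rowQ ε (y * a r) x (row (W s) r)) c t →
        rowQ ε (y * a r) x (row (W t) r) = 0 → c = 0 :=
    ae_all_iff.2 fun r => ae_deriv_eq_zero_of_zero fun s => rowQ ε (y * a r) x (row (W s) r)
  filter_upwards [h1, h2] with t ht1 ht2 v hv
  have hcoord : ∀ p : Fin m × Fin d, HasDerivAt (fun s => W s p) (v p) t := fun p =>
    ((EuclideanSpace.proj p : Weights m d →L[ℝ] ℝ).hasFDerivAt).comp_hasDerivAt t hv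
  have habs : ∀ p : Fin m × Fin d, ∃ c, AffineAlong (fun z : Weights m d => |z p|) (W t) v c := by
    intro p
    have hlin : AffineAlong (fun z : Weights m d => z p) (W t) v (v p) :=
      affineAlong_of_linear fun z s => by simp
    refine AffineAlong.comp (by fun_prop) hlin (φ := fun r => |r|) ?_
      (κ := SignType.sign (W t p))
    by_cases h : W t p = 0
    · exact Or.inl (ht1 p _ (hcoord p) h)
    · exact Or.inr (eventually_abs_affine h)
  choose c hc using habs
  have hq : ∀ r, ∃ c,
      AffineAlong (fun z : Weights m d => rowQ ε (y * a r) x (row z r)) (W t) v c := by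
    intro r
    have e1 : AffineAlong (fun z : Weights m d => ∑ k, row z r k * x k) (W t) v
        (∑ k, row v r k * x k) := by
      refine affineAlong_of_linear (f := fun z : Weights m d => ∑ k, row z r k * x k) fun z s => ?_
      simp only [row, PiLp.add_apply, PiLp.smul_apply, smul_eq_mul, Finset.mul_sum,
        ← Finset.sum_add_distrib]
      exact Finset.sum_congr rfl fun _ _ => by ring
    have e2 : AffineAlong (fun z : Weights m d => ∑ k, |z (r, k)|) (W t) v (∑ k, c (r, k)) :=
      AffineAlong.sum fun k _ => hc (r, k)
    have e3 : (fun z : Weights m d => rowQ ε (y * a r) x (row z r))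
        = fun z => ∑ k, row z r k * x k + -(y * a r * ε) * ∑ k, |z (r, k)| := by
      funext z
      simp only [rowQ, row]
      ring
    rw [e3]
    exact ⟨_, e1.add (e2.const_mul (-(y * a r * ε)))⟩
  have hrelu : ∀ r, ∃ c, AffineAlong
      (fun z : Weights m d => relu (rowQ ε (y * a r) x (row z r))) (W t) v c := by
    intro r
    obtain ⟨c, hc⟩ := hq r
    have hcont : Continuous fun z : Weights m d => rowQ ε (y * a r) x (row z r) :=
      (continuous_rowQ _ _ _).comp (by unfold row; fun_prop)
    refine AffineAlong.comp hcont hc (φ := relu)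
      (κ := if 0 < rowQ ε (y * a r) x (row (W t) r) then 1 else 0) ?_
    by_cases h : rowQ ε (y * a r) x (row (W t) r) = 0
    · refine Or.inl (ht2 r c ?_ h)
      have hlip : LipschitzWith (2 * l2 x).toNNReal
          fun z : Weights m d => rowQ ε (y * a r) x (row z r) := by
        refine LipschitzWith.of_dist_le_mul fun z z' => ?_
        rw [Real.coe_toNNReal _ (mul_nonneg zero_le_two (l2_nonneg x)), Real.dist_eq, dist_eq_norm]
        refine (abs_rowQ_sub_le hε (mul_eq_one_or hy (ha r)) hx _ _).trans ?_
        refine mul_le_mul_of_nonneg_left ?_ (mul_nonneg zero_le_two (l2_nonneg x))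
        rw [← row_sub]
        refine (pow_le_pow_iff_left₀ (l2_nonneg _) (norm_nonneg _) two_ne_zero).1 ?_
        rw [norm_sq_eq_sum_row]
        exact Finset.single_le_sum (f := fun r => l2 (row (z - z') r) ^ 2)
          (fun _ _ => sq_nonneg _) (Finset.mem_univ r)
      exact hc.hasDerivAt_comp hlip hv
    · exact Or.inr (eventually_relu_affine h)
  choose D hD using hrelu
  refine ⟨(1 / √(m : ℝ)) * ∑ r, (y * a r) * D r, ?_⟩
  have := (AffineAlong.sum (s := Finset.univ) fun r _ => (hD r).const_mul (y * a r)).const_mul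
    (1 / √(m : ℝ))
  simpa only [marginLower_eq ε ha _ x hy] using this

/-- The chain rule for the robust loss along its gradient flows: at almost every time the loss
decreases at the rate of the squared velocity. -/
theorem IsGradientFlow.ae_hasDerivAt_loss {ε : ℝ} (hε : 0 ≤ ε) {a : Fin m → ℝ}
    (ha : ∀ r, a r = 1 ∨ a r = -1) {x : Fin n → Fin d → ℝ} (hx : ∀ i k, ε ≤ x i k)
    {y : Fin n → ℝ} (hy : ∀ i, y i = 1 ∨ y i = -1) {w₀ : Weights m d} {W : ℝ → Weights m d}
    (hW : IsGradientFlow (robustLoss ε x y a) w₀ W) :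
    ∀ᵐ t : ℝ, 0 < t → ∃ v, HasDerivAt W v t ∧
      -v ∈ clarkeSubdifferential (robustLoss ε x y a) (W t) ∧
      HasDerivAt (fun s => robustLoss ε x y a (W s)) (-‖v‖ ^ 2) t := by
  have h1 := (ae_restrict_iff' measurableSet_Ioi).1 hW.flow
  have h2 : ∀ᵐ t : ℝ, ∀ i, ∀ v, HasDerivAt W v t →
      ∃ D, AffineAlong (margin ε x y a i) (W t) v D :=
    ae_all_iff.2 fun i => ae_affineAlong_margin hε ha (hx i) (hy i) W
  filter_upwards [h1, h2] with t ht1 ht2 ht0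
  obtain ⟨g, hg, hd⟩ := ht1 ht0
  choose D hD using fun i => ht2 i _ hd
  have hcont : ∀ i, Continuous (margin ε x y a i : Weights m d → ℝ) := fun i =>
    (marginLower_lipschitz hε ha (hx i) (hy i)).continuous
  have hloss : HasDerivAt (fun s => robustLoss ε x y a (W s))
      (∑ i, -logisticWeight (margin ε x y a i (W t)) * D i) t := by
    rw [robustLoss_eq]
    refine HasDerivAt.fun_sum fun i _ => ?_
    exact (hasDerivAt_logistic _).comp t
      ((hD i).hasDerivAt_comp (marginLower_lipschitz hε ha (hx i) (hy i)) hd)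
  have key : ∀ σ : ℝ, σ = 1 ∨ σ = -1 →
      inner ℝ g (σ • -g) ≤ -∑ i, logisticWeight (margin ε x y a i (W t)) * (σ * D i) := by
    intro σ hσ
    refine inner_le_of_mem_clarke_logistic (V := fun _ => σ • -g) (b := fun i _ => σ * D i) hcont
      continuousAt_const (fun i => continuousAt_const) ?_ hg
    have hall : ∀ᶠ q : Weights m d × ℝ in 𝓝 (W t, 0), ∀ i,
        margin ε x y a i (q.1 + q.2 • -g) = margin ε x y a i q.1 + q.2 * D i :=
      eventually_all.2 hD
    have hmap : Tendsto (fun q : Weights m d × ℝ => (q.1, q.2 * σ)) (𝓝 (W t, 0)) (𝓝 (W t, 0)) := by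
      have : Continuous fun q : Weights m d × ℝ => (q.1, q.2 * σ) := by fun_prop
      simpa using this.tendsto (W t, (0 : ℝ))
    have := hmap.eventually hall
    rw [nhds_prod_eq] at this
    filter_upwards [this.curry] with z hz i
    filter_upwards [nhdsWithin_le_nhds hz] with s hs
    have := hs i
    rw [smul_smul, this]
    exact le_of_eq (by ring)
  refine ⟨-g, hd, by simpa using hg, ?_⟩
  convert hloss using 1
  have k1 := key 1 (Or.inl rfl)
  have k2 := key (-1) (Or.inr rfl)
  simp only [one_smul, neg_smul, neg_neg, inner_neg_right, real_inner_self_eq_norm_sq, one_mul,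
    neg_mul, mul_neg, Finset.sum_neg_distrib] at k1 k2 ⊢
  rw [norm_neg]
  linarith

/-! ### Stability of the activation pattern near the initialization -/

/-- The gradient of the margin, as a weight matrix. -/
noncomputable def gradVec (ε : ℝ) (a : Fin m → ℝ) (W : Weights m d) (x : Fin d → ℝ) (y : ℝ) :
    Weights m d := WithLp.toLp 2 (marginGrad ε a W x y)

/-- The error, in the direction `v`, of using at a weight vector near `w` the derivative at `w` of
one hidden neuron: only an unstable preactivation bound and unstable coordinates contribute.
Stability means that the sign cannot change while the weight vector moves by less than `R`. -/
noncomputable def rowError (R ε s : ℝ) (x w v : Fin d → ℝ) : ℝ :=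
  (if |rowQ ε s x w| ≤ 2 * l2 x * R then 2 * |rowLin ε s x w v| else 0)
    + 2 * ε * ∑ k, if |w k| ≤ R then |v k| else 0

/-- The error, in the direction `V`, of using near `W` the gradient of the margin at `W`. -/
noncomputable def driftError (R ε : ℝ) (a : Fin m → ℝ) (W : Weights m d) (x : Fin d → ℝ) (y : ℝ)
    (V : Weights m d) : ℝ :=
  (1 / √(m : ℝ)) * ∑ r, rowError R ε (y * a r) x (row W r) (row V r)

theorem sign_eq_of_abs_sub_lt {p q : ℝ} (h : |q - p| < |p|) :
    SignType.sign q = SignType.sign p := by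
  rcases lt_trichotomy p 0 with hp | rfl | hp
  · rw [abs_of_neg hp, abs_lt] at h
    rw [sign_neg hp, sign_neg (by linarith)]
  · simp at h
    exact absurd h (not_lt.2 (abs_nonneg _))
  · rw [abs_of_pos hp, abs_lt] at h
    rw [sign_pos hp, sign_pos (by linarith)]

theorem abs_eq_of_abs_sub_lt {p q : ℝ} (h : |q - p| < |p|) : |q| = Real.sign p * q := by
  have h1 := sign_eq_of_abs_sub_lt h
  rcases lt_trichotomy p 0 with hp | rfl | hp
  · rw [sign_neg hp, sign_eq_neg_one_iff] at h1
    rw [Real.sign_of_neg hp, abs_of_neg h1]; ring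
  · simp at h
    exact absurd h (not_lt.2 (abs_nonneg _))
  · rw [sign_pos hp, sign_eq_one_iff] at h1
    rw [Real.sign_of_pos hp, abs_of_pos h1]; ring

theorem abs_real_sign_le_one (p : ℝ) : |Real.sign p| ≤ 1 := by
  rcases Real.sign_apply_eq p with h | h | h <;> simp [h]

/-- First-order expansion of one neuron at `z`, with the derivative taken at a nearby `w`. The
estimate is one-sided in `t` and holds at kinks of the neuron, where it is not differentiable. -/
theorem eventually_abs_relu_sub_le {R ε s : ℝ} (hε : 0 ≤ ε) (hs : s = 1 ∨ s = -1)
    {x w z : Fin d → ℝ} (hx : ∀ k, ε ≤ x k) (hz : l2 (z - w) < R) (v : Fin d → ℝ) :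
    ∀ᶠ t in 𝓝[>] (0 : ℝ), |relu (rowQ ε s x (z + t • v)) - relu (rowQ ε s x z)
        - t * (if 0 < rowQ ε s x w then rowLin ε s x w v else 0)|
      ≤ t * rowError R ε s x w v := by
  have hcontz : ContinuousAt (fun t : ℝ => z + t • v) 0 := by fun_prop
  have ev1 : ∀ᶠ t in 𝓝[>] (0 : ℝ), ∀ k, |(z + t • v) k - w k| < R := by
    refine nhdsWithin_le_nhds (eventually_all.2 fun k => ?_)
    have hc : ContinuousAt (fun t : ℝ => |(z + t • v) k - w k|) 0 := by
      simp only [Pi.add_apply, Pi.smul_apply]; fun_prop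
    refine hc.eventually_lt continuousAt_const ?_
    simpa using (abs_apply_le_l2 (z - w) k).trans_lt hz
  have hqz : |rowQ ε s x z - rowQ ε s x w| ≤ 2 * l2 x * l2 (z - w) := abs_rowQ_sub_le hε hs hx w z
  have ev2 : ∀ᶠ t in 𝓝[>] (0 : ℝ), 2 * l2 x * R < |rowQ ε s x w| →
      |rowQ ε s x (z + t • v) - rowQ ε s x w| < |rowQ ε s x w| := by
    by_cases hu : 2 * l2 x * R < |rowQ ε s x w|
    · refine nhdsWithin_le_nhds ?_
      have hc : ContinuousAt (fun t : ℝ => |rowQ ε s x (z + t • v) - rowQ ε s x w|) 0 :=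
        (((continuous_rowQ ε s x).continuousAt.comp hcontz).sub continuousAt_const).abs
      refine (hc.eventually_lt continuousAt_const ?_).mono fun t ht _ => ht
      simp only [zero_smul, add_zero]
      refine (hqz.trans ?_).trans_lt hu
      exact mul_le_mul_of_nonneg_left hz.le (mul_nonneg zero_le_two (l2_nonneg x))
    · exact Eventually.of_forall fun t h => absurd h hu
  filter_upwards [ev1, ev2, self_mem_nhdsWithin] with t h1 h2 ht
  have ht0 : 0 < t := ht
  have hs1 : |s| = 1 := by rcases hs with h | h <;> simp [h]
  set e : ℝ := 2 * ε * ∑ k, if |w k| ≤ R then |v k| else 0 with he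
  have he0 : 0 ≤ e := mul_nonneg (by linarith) (Finset.sum_nonneg fun k _ => by
    split_ifs
    · exact abs_nonneg _
    · exact le_rfl)
  -- The interval bound is linear up to the coordinates of the weight vector that are unstable.
  have hlin : |rowQ ε s x (z + t • v) - rowQ ε s x z - t * rowLin ε s x w v| ≤ t * e := by
    have e1 : rowQ ε s x (z + t • v) - rowQ ε s x z - t * rowLin ε s x w v
        = -(s * ε * ∑ k, (|z k + t * v k| - |z k| - t * (Real.sign (w k) * v k))) := by
      unfold rowQ rowLin
      simp only [Pi.add_apply, Pi.smul_apply, smul_eq_mul, Finset.sum_sub_distrib, mul_sub, add_mul,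
        Finset.sum_add_distrib, Finset.mul_sum]
      have e2 : ∑ k, t * v k * x k = ∑ k, t * (v k * x k) :=
        Finset.sum_congr rfl fun _ _ => by ring
      have e3 : ∑ k, t * (v k * (s * ε * Real.sign (w k)))
          = ∑ k, s * ε * (t * (Real.sign (w k) * v k)) :=
        Finset.sum_congr rfl fun _ _ => by ring
      rw [e2, e3]; ring
    rw [e1, abs_neg, abs_mul, abs_mul, hs1, one_mul, abs_of_nonneg hε, he]
    have e4 : ∀ k, |(|z k + t * v k| - |z k| - t * (Real.sign (w k) * v k))|
        ≤ 2 * t * if |w k| ≤ R then |v k| else 0 := by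
      intro k
      split_ifs with hk
      · have a1 := abs_abs_sub_abs_le_abs_sub (z k + t * v k) (z k)
        rw [add_sub_cancel_left, abs_mul, abs_of_pos ht0] at a1
        have a2 : |t * (Real.sign (w k) * v k)| ≤ t * |v k| := by
          rw [abs_mul, abs_mul, abs_of_pos ht0]
          have := abs_real_sign_le_one (w k)
          have := mul_le_mul_of_nonneg_right this (abs_nonneg (v k))
          rw [one_mul] at this
          exact mul_le_mul_of_nonneg_left this ht0.le
        refine (abs_sub _ _).trans ?_
        linarith
      · rw [not_le] at hk
        have a1 : |z k + t * v k| = Real.sign (w k) * (z k + t * v k) :=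
          abs_eq_of_abs_sub_lt ((by simpa using h1 k : |z k + t * v k - w k| < R).trans hk)
        have a2 : |z k| = Real.sign (w k) * z k :=
          abs_eq_of_abs_sub_lt (((abs_apply_le_l2 (z - w) k).trans_lt hz).trans hk)
        rw [a1, a2]
        have : Real.sign (w k) * (z k + t * v k) - Real.sign (w k) * z k
          - t * (Real.sign (w k) * v k) = 0 := by ring
        rw [this]; simp
    calc ε * |∑ k, (|z k + t * v k| - |z k| - t * (Real.sign (w k) * v k))|
        ≤ ε * ∑ k, 2 * t * (if |w k| ≤ R then |v k| else 0) :=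
          mul_le_mul_of_nonneg_left ((Finset.abs_sum_le_sum_abs _ _).trans
            (Finset.sum_le_sum fun k _ => e4 k)) hε
      _ = _ := by rw [← Finset.mul_sum]; ring
  unfold rowError
  rw [← he]
  -- For an unstable bound both slopes of `relu` are possible; for a stable bound its sign at `z`
  -- and at `z + t • v` is that at `w`.
  by_cases hu : |rowQ ε s x w| ≤ 2 * l2 x * R
  · rw [if_pos hu]
    have b1 := abs_relu_sub_le (rowQ ε s x (z + t • v)) (rowQ ε s x z)
    have b2 : |t * (if 0 < rowQ ε s x w then rowLin ε s x w v else 0)|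
        ≤ t * |rowLin ε s x w v| := by
      rw [abs_mul, abs_of_pos ht0]
      refine mul_le_mul_of_nonneg_left ?_ ht0.le
      split_ifs
      · exact le_rfl
      · simp
    have b3 : |rowQ ε s x (z + t • v) - rowQ ε s x z| ≤ t * e + t * |rowLin ε s x w v| := by
      have : |t * rowLin ε s x w v| = t * |rowLin ε s x w v| := by rw [abs_mul, abs_of_pos ht0]
      rw [← this]
      have := abs_add_le (rowQ ε s x (z + t • v) - rowQ ε s x z - t * rowLin ε s x w v)
        (t * rowLin ε s x w v)
      rw [sub_add_cancel] at this
      linarith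
    refine (abs_sub _ _).trans ?_
    linarith
  · rw [if_neg hu, zero_add]
    rw [not_le] at hu
    have g1 := sign_eq_of_abs_sub_lt (h2 hu)
    have g2 : SignType.sign (rowQ ε s x z) = SignType.sign (rowQ ε s x w) := by
      refine sign_eq_of_abs_sub_lt ((hqz.trans ?_).trans_lt hu)
      exact mul_le_mul_of_nonneg_left hz.le (mul_nonneg zero_le_two (l2_nonneg x))
    split_ifs with hpos
    · rw [sign_pos hpos, sign_eq_one_iff] at g1 g2
      simpa only [relu, max_eq_left g1.le, max_eq_left g2.le] using hlin
    · rw [not_lt] at hpos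
      have hne : rowQ ε s x w ≠ 0 := by
        intro h0
        have h3 := h2 hu
        rw [h0, abs_zero] at h3
        exact absurd h3 (not_lt.2 (abs_nonneg _))
      rw [sign_neg (lt_of_le_of_ne hpos hne), sign_eq_neg_one_iff] at g1 g2
      simp only [relu, max_eq_right g1.le, max_eq_right g2.le, sub_self, mul_zero, abs_zero]
      exact mul_nonneg ht0.le he0

theorem inner_gradVec {ε : ℝ} {a : Fin m → ℝ} (ha : ∀ r, a r = 1 ∨ a r = -1)
    (W V : Weights m d) (x : Fin d → ℝ) {y : ℝ} (hy : y = 1 ∨ y = -1) :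
    inner ℝ (gradVec ε a W x y) V = (1 / √(m : ℝ)) * ∑ r, (y * a r) *
      (if 0 < rowQ ε (y * a r) x (row W r) then rowLin ε (y * a r) x (row W r) (row V r)
        else 0) := by
  rw [PiLp.inner_apply, Fintype.sum_prod_type, Finset.mul_sum]
  refine Finset.sum_congr rfl fun r _ => ?_
  simp only [gradVec, marginGrad_eq ε ha W x hy, rowGrad]
  split_ifs with h
  · simp only [rowLin, Finset.mul_sum, RCLike.inner_apply, conj_trivial, row]
    exact Finset.sum_congr rfl fun k _ => by ring
  · simp

/-- As long as every weight vector has moved by less than `R`, the margins expand to first order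
with the gradients at initialization, up to the drift error. -/
theorem eventually_abs_margin_sub_le {R ε : ℝ} (hε : 0 ≤ ε) {a : Fin m → ℝ}
    (ha : ∀ r, a r = 1 ∨ a r = -1) {x : Fin d → ℝ} (hx : ∀ k, ε ≤ x k) {y : ℝ}
    (hy : y = 1 ∨ y = -1) {W z : Weights m d} (hz : ∀ r, l2 (row z r - row W r) < R)
    (V : Weights m d) :
    ∀ᶠ t in 𝓝[>] (0 : ℝ), |marginLower ε a (z + t • V) x y - marginLower ε a z x y
      - t * inner ℝ (gradVec ε a W x y) V| ≤ t * driftError R ε a W x y V := by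
  have hall := eventually_all.2 fun r =>
    eventually_abs_relu_sub_le hε (mul_eq_one_or hy (ha r)) hx (hz r) (row V r)
  filter_upwards [hall] with t ht
  rw [marginLower_eq ε ha _ x hy, marginLower_eq ε ha _ x hy, inner_gradVec ha W V x hy,
    driftError, mul_left_comm t, mul_left_comm t, ← mul_sub, ← mul_sub, abs_mul,
    abs_of_nonneg (by positivity : (0 : ℝ) ≤ 1 / √(m : ℝ)), Finset.mul_sum _ _ t,
    Finset.mul_sum _ _ t, ← Finset.sum_sub_distrib, ← Finset.sum_sub_distrib]
  refine mul_le_mul_of_nonneg_left ?_ (by positivity)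
  refine (Finset.abs_sum_le_sum_abs _ _).trans (Finset.sum_le_sum fun r _ => ?_)
  have hs1 : |y * a r| = 1 := by rcases mul_eq_one_or hy (ha r) with h | h <;> simp [h]
  rw [mul_left_comm t, ← mul_sub, ← mul_sub, abs_mul, hs1, one_mul]
  exact ht r

end Network

/-! ### Differential inequalities for absolutely continuous functions -/

theorem absolutelyContinuousOnInterval_comp {X Y : Type*} [PseudoMetricSpace X]
    [PseudoMetricSpace Y] {f : ℝ → X} {g : X → Y} {s : Set X} {K : NNReal} {a b : ℝ}
    (hf : AbsolutelyContinuousOnInterval f a b) (hg : LipschitzOnWith K g s)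
    (hs : ∀ t ∈ uIcc a b, f t ∈ s) : AbsolutelyContinuousOnInterval (fun t => g (f t)) a b := by
  rw [absolutelyContinuousOnInterval_iff] at hf ⊢
  intro e he
  obtain ⟨δ, hδ, h⟩ := hf (e / (K + 1)) (by positivity)
  refine ⟨δ, hδ, fun E hE hlen => ?_⟩
  calc ∑ i ∈ Finset.range E.1, dist (g (f (E.2 i).1)) (g (f (E.2 i).2))
      ≤ ∑ i ∈ Finset.range E.1, K * dist (f (E.2 i).1) (f (E.2 i).2) := by
        refine Finset.sum_le_sum fun i hi => ?_
        exact hg.dist_le_mul _ (hs _ (hE.1 i hi).1) _ (hs _ (hE.1 i hi).2)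
    _ = K * ∑ i ∈ Finset.range E.1, dist (f (E.2 i).1) (f (E.2 i).2) := (Finset.mul_sum _ _ _).symm
    _ ≤ K * (e / (K + 1)) := by
        have := (h E hE hlen).le
        gcongr
    _ < (K + 1) * (e / (K + 1)) := by gcongr; linarith
    _ = e := by field_simp

theorem absolutelyContinuousOnInterval_sub_le {φ ψ : ℝ → ℝ} {a b : ℝ} (hab : a ≤ b)
    (hφ : AbsolutelyContinuousOnInterval φ a b) (hψ : IntervalIntegrable ψ volume a b)
    (h : ∀ᵐ t : ℝ, t ∈ Ioo a b → ∃ c, HasDerivAt φ c t ∧ c ≤ ψ t) :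
    φ b - φ a ≤ ∫ t in a..b, ψ t := by
  rw [← hφ.integral_deriv_eq_sub]
  refine intervalIntegral.integral_mono_ae_restrict hab hφ.intervalIntegrable_deriv hψ ?_
  rw [← restrict_Ioo_eq_restrict_Icc]
  refine (ae_restrict_iff' measurableSet_Ioo).2 ?_
  filter_upwards [h] with t ht htm
  obtain ⟨c, hc, hle⟩ := ht htm
  rwa [hc.deriv]

section Training

variable {n m d : ℕ}

/-! ### Pointwise estimates for subgradients -/

theorem rowLin_self (ε s : ℝ) (x w : Fin d → ℝ) : rowLin ε s x w w = rowQ ε s x w := by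
  unfold rowLin rowQ
  rw [Finset.mul_sum, ← Finset.sum_sub_distrib]
  refine Finset.sum_congr rfl fun k _ => ?_
  have : |w k| = Real.sign (w k) * w k := by
    rcases lt_trichotomy (w k) 0 with h | h | h
    · rw [Real.sign_of_neg h, abs_of_neg h]; ring
    · rw [h]; simp
    · rw [Real.sign_of_pos h, abs_of_pos h]; ring
  rw [this]; ring

theorem inner_gradVec_self {ε : ℝ} {a : Fin m → ℝ} (ha : ∀ r, a r = 1 ∨ a r = -1)
    (W : Weights m d) (x : Fin d → ℝ) {y : ℝ} (hy : y = 1 ∨ y = -1) :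
    inner ℝ (gradVec ε a W x y) W = marginLower ε a W x y := by
  rw [inner_gradVec ha W W x hy, marginLower_eq ε ha W x hy]
  congr 1
  refine Finset.sum_congr rfl fun r _ => ?_
  congr 1
  rw [rowLin_self, relu]
  split_ifs with h0
  · rw [max_eq_left h0.le]
  · rw [max_eq_right (not_lt.1 h0)]

/-- The weights `1 / (1 + e^{u_i})` with which the margin gradients enter the loss gradient. -/
noncomputable def lossWeight (ε : ℝ) (x : Fin n → Fin d → ℝ) (y : Fin n → ℝ) (a : Fin m → ℝ)
    (W : Weights m d) (i : Fin n) : ℝ := logisticWeight (margin ε x y a i W)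

theorem lossWeight_pos (ε : ℝ) (x : Fin n → Fin d → ℝ) (y : Fin n → ℝ) (a : Fin m → ℝ)
    (W : Weights m d) (i : Fin n) : 0 < lossWeight ε x y a W i := logisticWeight_pos _

variable {ε : ℝ} {x : Fin n → Fin d → ℝ} {y : Fin n → ℝ} {a : Fin m → ℝ}

/-- While the loss exceeds `1/2`, either an example is uncertified and has a weight of at least
`1/2`, or all weights are comparable to the individual losses. -/
theorem lossWeight_cases {W : Weights m d} :
    (∃ i, 1 / 2 ≤ lossWeight ε x y a W i) ∨
      ∀ i, logistic (margin ε x y a i W) / 2 ≤ lossWeight ε x y a W i := by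
  by_cases h : ∃ i, margin ε x y a i W ≤ 0
  · obtain ⟨i, hi⟩ := h
    exact Or.inl ⟨i, half_le_logisticWeight hi⟩
  · push Not at h
    exact Or.inr fun i => half_logistic_le_logisticWeight (h i).le

theorem quarter_le_sum_lossWeight {W : Weights m d} (hL : 1 / 2 ≤ robustLoss ε x y a W) :
    1 / 4 ≤ ∑ i, lossWeight ε x y a W i := by
  rcases lossWeight_cases (ε := ε) (x := x) (y := y) (a := a) (W := W) with ⟨i, hi⟩ | h
  · have := Finset.single_le_sum (f := lossWeight ε x y a W)
      (fun i _ => (lossWeight_pos ε x y a W i).le) (Finset.mem_univ i)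
    linarith
  · have := Finset.sum_le_sum fun i (_ : i ∈ Finset.univ) => h i
    rw [← Finset.sum_div] at this
    have h2 : robustLoss ε x y a W = ∑ i, logistic (margin ε x y a i W) := rfl
    linarith

theorem min_le_sum_sq_lossWeight {W : Weights m d} :
    1 / 4 ≤ ∑ i, lossWeight ε x y a W i ^ 2 ∨
      robustLoss ε x y a W ^ 2 ≤ 4 * n * ∑ i, lossWeight ε x y a W i ^ 2 := by
  rcases lossWeight_cases (ε := ε) (x := x) (y := y) (a := a) (W := W) with ⟨i, hi⟩ | h
  · left
    have := Finset.single_le_sum (f := fun i => lossWeight ε x y a W i ^ 2)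
      (fun i _ => sq_nonneg _) (Finset.mem_univ i)
    nlinarith
  · right
    have h2 : robustLoss ε x y a W = ∑ i, logistic (margin ε x y a i W) := rfl
    have h3 := sq_sum_le_card_mul_sum_sq (s := (Finset.univ : Finset (Fin n)))
      (f := fun i => logistic (margin ε x y a i W))
    have h4 : ∑ i, logistic (margin ε x y a i W) ^ 2 ≤ ∑ i, 4 * lossWeight ε x y a W i ^ 2 := by
      refine Finset.sum_le_sum fun i _ => ?_
      have := h i
      have := (logistic_pos (margin ε x y a i W)).le
      nlinarith
    rw [← Finset.mul_sum] at h4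
    rw [h2]
    simp only [Finset.card_univ, Fintype.card_fin] at h3
    have := mul_le_mul_of_nonneg_left h4 (Nat.cast_nonneg (α := ℝ) n)
    linarith

variable (hε : 0 ≤ ε) (ha : ∀ r, a r = 1 ∨ a r = -1) (hx : ∀ i k, ε ≤ x i k)
  (hy : ∀ i, y i = 1 ∨ y i = -1)

include hε ha hx hy

theorem continuous_margin (i : Fin n) : Continuous (margin ε x y a i : Weights m d → ℝ) :=
  (marginLower_lipschitz hε ha (hx i) (hy i)).continuous

theorem continuous_lossWeight (i : Fin n) :
    Continuous fun W : Weights m d => lossWeight ε x y a W i :=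
  continuous_logisticWeight.comp (continuous_margin hε ha hx hy i)

theorem continuous_robustLoss : Continuous (robustLoss ε x y a : Weights m d → ℝ) := by
  obtain ⟨K, hK⟩ := robustLoss_lipschitz (m := m) hε ha hx hy
  exact hK.continuous

/-- Every hidden neuron moves slowly: its part of a subgradient of the loss is of order
`m^{-1/2}`. -/
theorem l2_row_le_of_mem_clarke {M : ℝ} (hM : ∀ i, l2 (x i) ≤ M) {W g : Weights m d}
    (hg : g ∈ clarkeSubdifferential (robustLoss ε x y a) W) (r : Fin m) :
    l2 (row g r) ≤ 2 * M / √(m : ℝ) * ∑ i, lossWeight ε x y a W i := by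
  let V : Weights m d := WithLp.toLp 2 fun p => if p.1 = r then g p else 0
  have hrowV : row V r = row g r := by ext k; simp [row, V]
  have hrow0 : ∀ r', r' ≠ r → row V r' = 0 := fun r' h => by ext k; simp [row, V, h]
  have hinner : inner ℝ g V = l2 (row g r) ^ 2 := by
    rw [PiLp.inner_apply, Fintype.sum_prod_type, Finset.sum_eq_single r]
    · rw [l2_sq]
      refine Finset.sum_congr rfl fun k _ => ?_
      simp [V, row, sq]
    · intro r' _ hr'
      simp [V, hr']
    · simp
  have hkey := inner_le_of_mem_clarke_logistic (u := margin ε x y a) (V := fun _ => V)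
    (b := fun i _ => -(2 * M / √(m : ℝ) * l2 (row g r))) (continuous_margin hε ha hx hy)
    continuousAt_const (fun _ => continuousAt_const) (Eventually.of_forall fun z i => ?_) hg
  · rw [hinner] at hkey
    have h2 : -∑ i, logisticWeight (margin ε x y a i W) * -(2 * M / √(m : ℝ) * l2 (row g r))
        = (2 * M / √(m : ℝ) * ∑ i, lossWeight ε x y a W i) * l2 (row g r) := by
      simp only [mul_neg, Finset.sum_neg_distrib, neg_neg, ← Finset.sum_mul]
      simp only [lossWeight]; ring
    rw [h2, sq] at hkey
    rcases (l2_nonneg (row g r)).eq_or_lt with h0 | h0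
    · rw [← h0]
      rcases isEmpty_or_nonempty (Fin n) with hn | ⟨⟨i⟩⟩
      · simp
      · have : 0 ≤ M := (l2_nonneg _).trans (hM i)
        have := Finset.sum_nonneg fun i (_ : i ∈ Finset.univ) => (lossWeight_pos ε x y a W i).le
        positivity
    · exact le_of_mul_le_mul_right hkey h0
  · filter_upwards [self_mem_nhdsWithin] with s hs
    have hs0 : 0 < s := hs
    have e1 : marginLower ε a (z + s • V) (x i) (y i) - marginLower ε a z (x i) (y i)
        = 1 / √(m : ℝ) * ((y i * a r) * (relu (rowQ ε (y i * a r) (x i) (row (z + s • V) r))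
          - relu (rowQ ε (y i * a r) (x i) (row z r)))) := by
      rw [marginLower_eq ε ha _ _ (hy i), marginLower_eq ε ha _ _ (hy i), ← mul_sub,
        ← Finset.sum_sub_distrib, Finset.sum_eq_single r]
      · rw [mul_sub (y i * a r)]
      · intro r' _ hr'
        have : row (z + s • V) r' = row z r' := by
          have : row (z + s • V) r' = row z r' + s • row V r' := rfl
          rw [this, hrow0 r' hr']; simp
        rw [this, sub_self]
      · simp
    have hs1 : |y i * a r| = 1 := by rcases mul_eq_one_or (hy i) (ha r) with h | h <;> simp [h]
    have e2 := abs_rowQ_sub_le hε (mul_eq_one_or (hy i) (ha r)) (hx i) (row z r)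
      (row (z + s • V) r)
    have e3 : row (z + s • V) r - row z r = s • row g r := by
      have : row (z + s • V) r = row z r + s • row V r := rfl
      rw [this, hrowV]; simp
    have e4 : l2 (s • row g r) = s * l2 (row g r) := by
      unfold l2
      simp only [Pi.smul_apply, smul_eq_mul, mul_pow, ← Finset.mul_sum]
      rw [Real.sqrt_mul (sq_nonneg s), Real.sqrt_sq hs0.le]
    rw [e3, e4] at e2
    have e5 : |(y i * a r) * (relu (rowQ ε (y i * a r) (x i) (row (z + s • V) r))
          - relu (rowQ ε (y i * a r) (x i) (row z r)))| ≤ 2 * M * (s * l2 (row g r)) := by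
      rw [abs_mul, hs1, one_mul]
      refine (abs_relu_sub_le _ _).trans (e2.trans ?_)
      have := hM i
      have := mul_nonneg hs0.le (l2_nonneg (row g r))
      gcongr
    have e6 := (abs_le.1 e5).1
    have e7 := mul_le_mul_of_nonneg_left e6 (by positivity : (0 : ℝ) ≤ 1 / √(m : ℝ))
    unfold margin
    rw [← e1] at e7
    have e8 : 1 / √(m : ℝ) * -(2 * M * (s * l2 (row g r)))
        = s * -(2 * M / √(m : ℝ) * l2 (row g r)) := by ring
    linarith

/-- Euler's identity bounds the radial component of a subgradient. -/
theorem inner_self_of_mem_clarke {W g : Weights m d}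
    (hg : g ∈ clarkeSubdifferential (robustLoss ε x y a) W) :
    inner ℝ (-g) W ≤ ∑ i, lossWeight ε x y a W i * margin ε x y a i W := by
  have := inner_le_of_mem_clarke_logistic (u := margin ε x y a) (V := fun z => -z)
    (b := fun i z => -margin ε x y a i z) (continuous_margin hε ha hx hy)
    continuous_neg.continuousAt (fun i => (continuous_margin hε ha hx hy i).neg.continuousAt)
    (Eventually.of_forall fun z i => ?_) hg
  · simpa [lossWeight, inner_neg_left, inner_neg_right] using this
  · have h1 : Ioo (0 : ℝ) 1 ∈ 𝓝[>] (0 : ℝ) := Ioo_mem_nhdsGT one_pos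
    filter_upwards [h1] with s hs
    have e : z + s • -z = (1 - s) • z := by rw [sub_smul, one_smul, smul_neg, sub_eq_add_neg]
    unfold margin
    rw [e, marginLower_smul ε ha z (x i) (hy i) (by linarith [hs.2])]
    linarith

/-- Near the initialization, subgradients are almost combinations of the initial margin
gradients. -/
theorem sum_le_inner_of_mem_clarke {R : ℝ} {w₀ W g : Weights m d}
    (hR : ∀ r, l2 (row W r - row w₀ r) < R)
    (hg : g ∈ clarkeSubdifferential (robustLoss ε x y a) W) (V : Weights m d) :
    ∑ i, lossWeight ε x y a W i *
      (inner ℝ (gradVec ε a w₀ (x i) (y i)) V - driftError R ε a w₀ (x i) (y i) V)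
      ≤ inner ℝ (-g) V := by
  have hopen : ∀ᶠ z in 𝓝 W, ∀ r, l2 (row z r - row w₀ r) < R := by
    refine eventually_all.2 fun r => ?_
    have hc : Continuous fun z : Weights m d => l2 (row z r - row w₀ r) := by
      unfold l2 row; simp only [Pi.sub_apply]; fun_prop
    exact hc.continuousAt.eventually_lt continuousAt_const (hR r)
  have := inner_le_of_mem_clarke_logistic (u := margin ε x y a) (V := fun _ => V)
    (b := fun i _ => inner ℝ (gradVec ε a w₀ (x i) (y i)) V - driftError R ε a w₀ (x i) (y i) V)
    (continuous_margin hε ha hx hy) continuousAt_const (fun _ => continuousAt_const) ?_ hg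
  · rw [inner_neg_left]
    simp only [lossWeight]
    linarith
  · filter_upwards [hopen] with z hz i
    filter_upwards [eventually_abs_margin_sub_le hε ha (hx i) (hy i) hz V] with s hs
    have := (abs_le.1 hs).1
    unfold margin
    linarith

/-- The gradient domination inequality near the initialization. -/
theorem sum_sq_le_norm_sq_of_mem_clarke {R lam η : ℝ} {w₀ W g : Weights m d} (hlam : 0 < lam)
    (h1 : ∀ c : Fin n → ℝ, 3 / 4 * lam * ∑ i, c i ^ 2
      ≤ ‖∑ i, c i • gradVec ε a w₀ (x i) (y i)‖ ^ 2)
    (h2 : ∀ (c : Fin n → ℝ) (V : Weights m d), (∀ i, 0 ≤ c i) →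
      ∑ i, c i * driftError R ε a w₀ (x i) (y i) V ≤ η * l2 c * ‖V‖)
    (hη : η ≤ √lam / 8) (hR : ∀ r, l2 (row W r - row w₀ r) < R)
    (hg : g ∈ clarkeSubdifferential (robustLoss ε x y a) W) :
    lam / 2 * ∑ i, lossWeight ε x y a W i ^ 2 ≤ ‖g‖ ^ 2 := by
  set c := lossWeight ε x y a W
  have hc : ∀ i, 0 ≤ c i := fun i => (lossWeight_pos ε x y a W i).le
  set V : Weights m d := ∑ i, c i • gradVec ε a w₀ (x i) (y i) with hV
  have k1 := sum_le_inner_of_mem_clarke hε ha hx hy hR hg V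
  have k2 := h2 c V hc
  have k3 := h1 c
  rw [← l2_sq] at k3 ⊢
  have k4 : ∑ i, c i * inner ℝ (gradVec ε a w₀ (x i) (y i)) V = ‖V‖ ^ 2 := by
    rw [← real_inner_self_eq_norm_sq]
    conv_rhs => rw [hV, sum_inner]
    simp only [real_inner_smul_left, ← hV]
  simp only [mul_sub, Finset.sum_sub_distrib] at k1
  rw [k4] at k1
  have k5 : inner ℝ (-g) V ≤ ‖g‖ * ‖V‖ := by
    have := real_inner_le_norm (-g) V
    rwa [norm_neg] at this
  have hsq := Real.sq_sqrt hlam.le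
  have hs0 := Real.sqrt_nonneg lam
  have hl0 := l2_nonneg c
  have k6 : 86 / 100 * (√lam * l2 c) ≤ ‖V‖ := by
    refine le_of_sq_le_sq ?_ (norm_nonneg _)
    nlinarith [mul_nonneg hlam.le (sq_nonneg (l2 c))]
  have k7 : η * l2 c ≤ √lam / 8 * l2 c := mul_le_mul_of_nonneg_right hη hl0
  have k8 : 72 / 100 * (√lam * l2 c) ≤ ‖g‖ := by
    rcases (norm_nonneg V).eq_or_lt with h0 | h0
    · rw [← h0] at k6
      have := norm_nonneg g
      nlinarith
    · have : ‖V‖ - √lam / 8 * l2 c ≤ ‖g‖ := by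
        refine le_of_mul_le_mul_right ?_ h0
        nlinarith
      nlinarith
  have k9 := pow_le_pow_left₀ (by positivity) k8 2
  nlinarith [mul_nonneg hlam.le (sq_nonneg (l2 c))]

/-- Near the initialization, the velocity points towards the reference point `w₀ + ΔW`, at
which the margins linearized at `w₀` are of order `τ`. -/
theorem inner_sub_reference_le {R η τ : ℝ} {w₀ W g ΔW : Weights m d}
    (h2 : ∀ (c : Fin n → ℝ) (V : Weights m d), (∀ i, 0 ≤ c i) →
      ∑ i, c i * driftError R ε a w₀ (x i) (y i) V ≤ η * l2 c * ‖V‖)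
    (h3 : ∀ i, driftError R ε a w₀ (x i) (y i) w₀ ≤ τ / 8)
    (h4 : ∀ i, 7 / 8 * τ ≤ margin ε x y a i w₀ + inner ℝ (gradVec ε a w₀ (x i) (y i)) ΔW)
    (hη0 : 0 ≤ η) (h5 : η * ‖ΔW‖ ≤ τ / 8) (hτ : 16 * n ≤ τ)
    (hR : ∀ r, l2 (row W r - row w₀ r) < R) (hL : 1 / 2 ≤ robustLoss ε x y a W)
    (hg : g ∈ clarkeSubdifferential (robustLoss ε x y a) W) :
    inner ℝ (-g) (W - (w₀ + ΔW)) ≤ -(3 / 8 * τ * ∑ i, lossWeight ε x y a W i) := by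
  set c := lossWeight ε x y a W with hcdef
  have hc : ∀ i, 0 ≤ c i := fun i => (lossWeight_pos ε x y a W i).le
  have k1 := inner_self_of_mem_clarke hε ha hx hy hg
  have k2 := sum_le_inner_of_mem_clarke hε ha hx hy hR hg w₀
  have k3 := sum_le_inner_of_mem_clarke hε ha hx hy hR hg ΔW
  have k4 := h2 c ΔW hc
  have hS := quarter_le_sum_lossWeight hL
  have hl2 : l2 c ≤ ∑ i, c i := by
    refine Real.sqrt_le_iff.2 ⟨Finset.sum_nonneg fun i _ => hc i, ?_⟩
    exact Finset.sum_sq_le_sq_sum_of_nonneg fun i _ => hc i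
  have k5 : ∑ i, c i * margin ε x y a i W ≤ n := by
    refine (Finset.sum_le_sum fun i _ =>
      logisticWeight_mul_self_le_one (margin ε x y a i W)).trans ?_
    simp
  have k6 : ∑ i, c i * (7 / 8 * τ) ≤ ∑ i, c i * (margin ε x y a i w₀
      + inner ℝ (gradVec ε a w₀ (x i) (y i)) ΔW) :=
    Finset.sum_le_sum fun i _ => mul_le_mul_of_nonneg_left (h4 i) (hc i)
  have k7 : ∑ i, c i * driftError R ε a w₀ (x i) (y i) w₀ ≤ ∑ i, c i * (τ / 8) :=
    Finset.sum_le_sum fun i _ => mul_le_mul_of_nonneg_left (h3 i) (hc i)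
  have k8 : η * l2 c * ‖ΔW‖ ≤ (∑ i, c i) * (τ / 8) := by
    have : η * l2 c * ‖ΔW‖ = l2 c * (η * ‖ΔW‖) := by ring
    rw [this]
    exact mul_le_mul hl2 h5 (mul_nonneg hη0 (norm_nonneg _)) (Finset.sum_nonneg fun i _ => hc i)
  simp only [mul_sub, mul_add, Finset.sum_sub_distrib, Finset.sum_add_distrib,
    inner_gradVec_self ha _ _ (hy _)] at k2 k3 k6
  rw [← Finset.sum_mul] at k6 k7
  have k9 : ∑ i, c i * margin ε x y a i w₀ = ∑ i, c i * marginLower ε a w₀ (x i) (y i) := rfl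
  rw [inner_sub_right, inner_add_right]
  have hn := Nat.cast_nonneg (α := ℝ) n
  nlinarith

end Training

section Training

variable {n m d : ℕ} {ε : ℝ} {x : Fin n → Fin d → ℝ} {y : Fin n → ℝ} {a : Fin m → ℝ}

/-! ### Training near the initialization -/

theorem IsGradientFlow.continuousOn {E : Type*} [NormedAddCommGroup E] [InnerProductSpace ℝ E]
    [CompleteSpace E] {f : E → ℝ} {w₀ : E} {W : ℝ → E} (hW : IsGradientFlow f w₀ W) :
    ContinuousOn W (Ici 0) := by
  intro t ht
  have h1 := (hW.absCont (t + 1) (by linarith [mem_Ici.1 ht])).continuousOn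
  rw [uIcc_of_le (by linarith [mem_Ici.1 ht])] at h1
  refine (h1 t ⟨ht, by linarith⟩).mono_of_mem_nhdsWithin ?_
  filter_upwards [self_mem_nhdsWithin, nhdsWithin_le_nhds (Iio_mem_nhds (lt_add_one t))]
    with s h1 h2
  exact ⟨h1, le_of_lt h2⟩

/-- Restriction of an absolutely continuous curve to a subinterval of `[0, ∞)`. -/
theorem IsGradientFlow.absCont' {E : Type*} [NormedAddCommGroup E] [InnerProductSpace ℝ E]
    [CompleteSpace E] {f : E → ℝ} {w₀ : E} {W : ℝ → E} (hW : IsGradientFlow f w₀ W) {s t : ℝ}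
    (hs : 0 ≤ s) (hst : s ≤ t) : AbsolutelyContinuousOnInterval W s t := by
  refine (hW.absCont t (hs.trans hst)).mono ?_
  rw [uIcc_of_le hst, uIcc_of_le (hs.trans hst)]
  exact Icc_subset_Icc_left hs

theorem absolutelyContinuousOnInterval_norm_sub_sq {E : Type*} [NormedAddCommGroup E] {W : ℝ → E}
    {s t : ℝ} (hW : AbsolutelyContinuousOnInterval W s t) (q : E) :
    AbsolutelyContinuousOnInterval (fun t => ‖W t - q‖ ^ 2) s t := by
  obtain ⟨C, hC⟩ := hW.exists_bound
  have hC0 : 0 ≤ C := (norm_nonneg _).trans (hC s left_mem_uIcc)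
  have hlip : LipschitzOnWith (2 * (C + ‖q‖)).toNNReal (fun z : E => ‖z - q‖ ^ 2)
      (Metric.closedBall 0 C) := by
    refine LipschitzOnWith.of_dist_le_mul fun z hz z' hz' => ?_
    rw [mem_closedBall_zero_iff] at hz hz'
    have e2 := abs_norm_sub_norm_le (z - q) (z' - q)
    rw [sub_sub_sub_cancel_right] at e2
    have e3 := norm_sub_le z q
    have e4 := norm_sub_le z' q
    have e5 : ‖z - q‖ + ‖z' - q‖ ≤ 2 * (C + ‖q‖) := by linarith
    rw [Real.dist_eq, dist_eq_norm, Real.coe_toNNReal _ (by positivity), sq_sub_sq, abs_mul,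
      abs_of_nonneg (by positivity)]
    exact mul_le_mul e5 e2 (abs_nonneg _) (by positivity)
  have hmem : ∀ u ∈ uIcc s t, W u ∈ Metric.closedBall (0 : E) C := fun u hu =>
    mem_closedBall_zero_iff.2 (hC u hu)
  exact absolutelyContinuousOnInterval_comp (g := fun z : E => ‖z - q‖ ^ 2) hW hlip hmem

/-- A monotone change of the dependent variable in a differential inequality, on values above
`1/2`. -/
theorem sub_le_of_potential {L Φ Φ' : ℝ → ℝ} {K : NNReal} {κ t₁ : ℝ} (h0 : 0 ≤ t₁)
    (hac : AbsolutelyContinuousOnInterval L 0 t₁) (hge : ∀ t ∈ Icc 0 t₁, 1 / 2 ≤ L t)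
    (hΦ : ∀ l, 1 / 2 ≤ l → HasDerivAt Φ (Φ' l) l) (hK : ∀ l, 1 / 2 ≤ l → ‖Φ' l‖ ≤ K)
    (h : ∀ᵐ t : ℝ, t ∈ Ioo 0 t₁ → ∃ c, HasDerivAt L c t ∧ Φ' (L t) * c ≤ κ) :
    Φ (L t₁) - Φ (L 0) ≤ κ * t₁ := by
  have hlip : LipschitzOnWith K Φ (Ici (1 / 2)) :=
    (convex_Ici (1 / 2 : ℝ)).lipschitzOnWith_of_nnnorm_hasDerivWithin_le
      (fun l hl => (hΦ l hl).hasDerivWithinAt) fun l hl => by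
        rw [← NNReal.coe_le_coe, coe_nnnorm]; exact hK l hl
  have := absolutelyContinuousOnInterval_sub_le h0
    (absolutelyContinuousOnInterval_comp hac hlip
      fun t ht => hge t (by rwa [uIcc_of_le h0] at ht))
      (ψ := fun _ => κ) intervalIntegrable_const ?_
  · simpa [mul_comm] using this
  · filter_upwards [h] with t ht htm
    obtain ⟨c, hc, hle⟩ := ht htm
    exact ⟨_, (hΦ (L t) (hge t ⟨htm.1.le, htm.2.le⟩)).comp t hc, hle⟩

theorem continuous_l2_row_sub (w₀ : Weights m d) (r : Fin m) :
    Continuous fun z : Weights m d => l2 (row z r - row w₀ r) := by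
  unfold l2 row
  simp only [Pi.sub_apply]
  fun_prop

/-- The inner product with the part of a weight matrix that belongs to the neuron `r`. -/
theorem abs_inner_single_row_le (v : Weights m d) (r : Fin m) (u : Fin d → ℝ) :
    |inner ℝ (WithLp.toLp 2 (fun p : Fin m × Fin d => if p.1 = r then u p.2 else 0)
        : Weights m d) v|
      ≤ l2 u * l2 (row v r) := by
  have h : inner ℝ (WithLp.toLp 2 (fun p : Fin m × Fin d => if p.1 = r then u p.2 else 0) :
      Weights m d) v = ∑ k, u k * row v r k := by
    rw [PiLp.inner_apply, Fintype.sum_prod_type, Finset.sum_eq_single r]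
    · refine Finset.sum_congr rfl fun k _ => ?_
      simp [row, mul_comm]
    · intro r' _ hr'
      simp [hr']
    · simp
  rw [h]
  refine (Finset.abs_sum_le_sum_abs _ _).trans ?_
  simp only [abs_mul]
  exact sum_abs_mul_le _ _

variable (hε : 0 ≤ ε) (ha : ∀ r, a r = 1 ∨ a r = -1) (hx : ∀ i k, ε ≤ x i k)
  (hy : ∀ i, y i = 1 ∨ y i = -1)

include hε ha hx hy

theorem IsGradientFlow.loss_absCont {w₀ : Weights m d} {W : ℝ → Weights m d}
    (hW : IsGradientFlow (robustLoss ε x y a) w₀ W) {s t : ℝ} (hs : 0 ≤ s) (hst : s ≤ t) :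
    AbsolutelyContinuousOnInterval (fun t => robustLoss ε x y a (W t)) s t := by
  obtain ⟨K, hK⟩ := robustLoss_lipschitz (m := m) hε ha hx hy
  exact absolutelyContinuousOnInterval_comp (hW.absCont' hs hst) (hK.lipschitzOnWith (s := univ))
    fun _ _ => mem_univ _

theorem IsGradientFlow.loss_antitone {w₀ : Weights m d} {W : ℝ → Weights m d}
    (hW : IsGradientFlow (robustLoss ε x y a) w₀ W) {s t : ℝ} (hs : 0 ≤ s) (hst : s ≤ t) :
    robustLoss ε x y a (W t) ≤ robustLoss ε x y a (W s) := by
  have := absolutelyContinuousOnInterval_sub_le hst (hW.loss_absCont hε ha hx hy hs hst)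
    (ψ := fun _ => 0) intervalIntegrable_const ?_
  · simpa using this
  · filter_upwards [hW.ae_hasDerivAt_loss hε ha hx hy] with t ht htm
    obtain ⟨v, -, -, h⟩ := ht (hs.trans_lt htm.1)
    exact ⟨_, h, by simp⟩

/-- A first exit argument: while the loss exceeds `1/2`, no hidden neuron leaves the ball of radius
`R` around its initialization. The distance to the reference point `w₀ + ΔW` controls the time
integral of the loss weights, and this integral controls the movement of every neuron. -/
theorem IsGradientFlow.l2_row_sub_lt {M R η τ : ℝ} {w₀ ΔW : Weights m d}
    {W : ℝ → Weights m d} (hW : IsGradientFlow (robustLoss ε x y a) w₀ W)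
    (hM : ∀ i, l2 (x i) ≤ M) (hM0 : 0 ≤ M)
    (h2 : ∀ (c : Fin n → ℝ) (V : Weights m d), (∀ i, 0 ≤ c i) →
      ∑ i, c i * driftError R ε a w₀ (x i) (y i) V ≤ η * l2 c * ‖V‖)
    (h3 : ∀ i, driftError R ε a w₀ (x i) (y i) w₀ ≤ τ / 8)
    (h4 : ∀ i, 7 / 8 * τ ≤ margin ε x y a i w₀ + inner ℝ (gradVec ε a w₀ (x i) (y i)) ΔW)
    (hη0 : 0 ≤ η) (h5 : η * ‖ΔW‖ ≤ τ / 8) (hτ : 16 * n ≤ τ) (hτ0 : 0 < τ)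
    (h6 : 2 * M / √(m : ℝ) * (2 * ‖ΔW‖ ^ 2 / τ) < R) {t₁ : ℝ}
    (hL : ∀ s, 0 ≤ s → s < t₁ → 1 / 2 ≤ robustLoss ε x y a (W s)) {s : ℝ} (hs0 : 0 ≤ s)
    (hs1 : s ≤ t₁) (r : Fin m) : l2 (row (W s) r - row w₀ r) < R := by
  by_contra hcon
  rw [not_lt] at hcon
  -- `σ` is the first time at which some neuron `r₁` is at distance `R` from its initialization.
  set X : Set ℝ := ⋃ r : Fin m, Icc 0 t₁ ∩ (fun s => l2 (row (W s) r - row w₀ r)) ⁻¹' Ici R with hX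
  have hXc : IsClosed X := by
    refine isClosed_iUnion_of_finite fun r => ?_
    refine ContinuousOn.preimage_isClosed_of_isClosed ?_ isClosed_Icc isClosed_Ici
    exact (continuous_l2_row_sub w₀ r).comp_continuousOn
      (hW.continuousOn.mono Icc_subset_Ici_self)
  have hXne : X.Nonempty := ⟨s, mem_iUnion.2 ⟨r, ⟨hs0, hs1⟩, hcon⟩⟩
  have hXb : BddBelow X := ⟨0, by
    intro u hu
    obtain ⟨r, hu, -⟩ := mem_iUnion.1 hu
    exact hu.1⟩
  obtain ⟨r₁, ⟨hσ0, hσ1⟩, hσR⟩ := mem_iUnion.1 (hXc.csInf_mem hXne hXb)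
  set σ := sInf X with hσ
  rw [mem_preimage, mem_Ici] at hσR
  have hstable : ∀ u, 0 ≤ u → u < σ → ∀ r, l2 (row (W u) r - row w₀ r) < R := by
    intro u hu0 hu r
    by_contra h
    rw [not_lt] at h
    have : u ∈ X := mem_iUnion.2 ⟨r, ⟨hu0, hu.le.trans hσ1⟩, h⟩
    exact absurd (csInf_le hXb this) (not_le.2 hu)
  have hcont0 : ContinuousOn (fun t => ∑ i, lossWeight ε x y a (W t) i) (Icc 0 σ) :=
    continuousOn_finsetSum _ fun i _ => (continuous_lossWeight hε ha hx hy i).comp_continuousOn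
      (hW.continuousOn.mono Icc_subset_Ici_self)
  have hint : IntervalIntegrable (fun t => ∑ i, lossWeight ε x y a (W t) i) volume 0 σ :=
    ContinuousOn.intervalIntegrable (by rwa [uIcc_of_le hσ0])
  set I := ∫ t in (0)..σ, ∑ i, lossWeight ε x y a (W t) i with hI
  -- The squared distance to the reference point decreases at least at the rate
  -- `(3 / 4) τ ∑ i, lossWeight i`.
  have hIbound : 3 / 4 * τ * I ≤ ‖ΔW‖ ^ 2 := by
    have hac : AbsolutelyContinuousOnInterval (fun t => ‖W t - (w₀ + ΔW)‖ ^ 2) 0 σ :=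
      absolutelyContinuousOnInterval_norm_sub_sq (hW.absCont σ hσ0) _
    have := absolutelyContinuousOnInterval_sub_le hσ0 hac
      (ψ := fun t => -(3 / 4 * τ) * ∑ i, lossWeight ε x y a (W t) i) (hint.const_mul _) ?_
    · rw [intervalIntegral.integral_const_mul, ← hI, hW.init] at this
      have e1 : w₀ - (w₀ + ΔW) = -ΔW := by abel
      rw [e1, norm_neg] at this
      have := sq_nonneg ‖W σ - (w₀ + ΔW)‖
      linarith
    · filter_upwards [hW.ae_hasDerivAt_loss hε ha hx hy] with t ht htm
      obtain ⟨v, hv, hg, -⟩ := ht htm.1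
      refine ⟨_, (hv.sub_const (w₀ + ΔW)).norm_sq, ?_⟩
      have := inner_sub_reference_le hε ha hx hy h2 h3 h4 hη0 h5 hτ
        (hstable t htm.1.le htm.2) (hL t htm.1.le (htm.2.trans_le hσ1)) hg
      rw [neg_neg] at this
      rw [real_inner_comm]
      linarith
  -- The displacement of the neuron `r₁` is at most the integral of its speed; the curve is tested
  -- against the displacement itself.
  have hδ : l2 (row (W σ) r₁ - row w₀ r₁) ^ 2
      ≤ 2 * M / √(m : ℝ) * l2 (row (W σ) r₁ - row w₀ r₁) * I := by
    set u := row (W σ) r₁ - row w₀ r₁ with hu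
    let V : Weights m d := WithLp.toLp 2 fun p => if p.1 = r₁ then u p.2 else 0
    have hac : AbsolutelyContinuousOnInterval (fun t => inner ℝ V (W t)) 0 σ :=
      absolutelyContinuousOnInterval_comp (hW.absCont σ hσ0)
        ((innerSL ℝ V).lipschitz.lipschitzOnWith (s := univ)) fun _ _ => mem_univ _
    have := absolutelyContinuousOnInterval_sub_le hσ0 hac
      (ψ := fun t => 2 * M / √(m : ℝ) * l2 u * ∑ i, lossWeight ε x y a (W t) i)
      (hint.const_mul _) ?_
    · rw [intervalIntegral.integral_const_mul, ← hI, ← inner_sub_right, hW.init] at this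
      refine le_trans (le_of_eq ?_) this
      rw [PiLp.inner_apply, Fintype.sum_prod_type, Finset.sum_eq_single r₁, l2_sq]
      · refine Finset.sum_congr rfl fun k _ => ?_
        simp [V, hu, row, sq]
      · intro r' _ hr'
        simp [V, hr']
      · simp
    · filter_upwards [hW.ae_hasDerivAt_loss hε ha hx hy] with t ht htm
      obtain ⟨v, hv, hg, -⟩ := ht htm.1
      refine ⟨inner ℝ V v, (innerSL ℝ V).hasFDerivAt.comp_hasDerivAt t hv, ?_⟩
      have k1 := l2_row_le_of_mem_clarke hε ha hx hy hM hg r₁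
      have k2 : l2 (row (-v) r₁) = l2 (row v r₁) := by simp [l2, row]
      rw [k2] at k1
      have k3 := (le_abs_self _).trans (abs_inner_single_row_le v r₁ u)
      refine k3.trans ?_
      calc l2 u * l2 (row v r₁) ≤ l2 u * (2 * M / √(m : ℝ) * ∑ i, lossWeight ε x y a (W t) i) :=
            mul_le_mul_of_nonneg_left k1 (l2_nonneg _)
        _ = _ := by ring
  set δ := l2 (row (W σ) r₁ - row w₀ r₁)
  have hA : 0 ≤ 2 * M / √(m : ℝ) := by positivity
  have hIle : I ≤ 2 * ‖ΔW‖ ^ 2 / τ := by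
    rw [le_div_iff₀ hτ0]
    nlinarith [sq_nonneg ‖ΔW‖]
  have hRpos : 0 < R := lt_of_le_of_lt (by positivity) h6
  have hδpos : 0 < δ := hRpos.trans_le hσR
  have : δ ≤ 2 * M / √(m : ℝ) * I := by
    refine le_of_mul_le_mul_right ?_ hδpos
    nlinarith
  have := mul_le_mul_of_nonneg_left hIle hA
  linarith

/-- Convergence of training under deterministic conditions on the initialization: the Gram matrix
is well conditioned, the drift error is small, and a reference point with large linearized margins
lies nearby. -/
theorem IsGradientFlow.converges {M R lam η τ : ℝ} {w₀ ΔW : Weights m d}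
    {W : ℝ → Weights m d} (hW : IsGradientFlow (robustLoss ε x y a) w₀ W) (hlam : 0 < lam)
    (hM : ∀ i, l2 (x i) ≤ M) (hM0 : 0 ≤ M)
    (h1 : ∀ c : Fin n → ℝ, 3 / 4 * lam * ∑ i, c i ^ 2
      ≤ ‖∑ i, c i • gradVec ε a w₀ (x i) (y i)‖ ^ 2)
    (h2 : ∀ (c : Fin n → ℝ) (V : Weights m d), (∀ i, 0 ≤ c i) →
      ∑ i, c i * driftError R ε a w₀ (x i) (y i) V ≤ η * l2 c * ‖V‖)
    (h3 : ∀ i, driftError R ε a w₀ (x i) (y i) w₀ ≤ τ / 8)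
    (h4 : ∀ i, 7 / 8 * τ ≤ margin ε x y a i w₀ + inner ℝ (gradVec ε a w₀ (x i) (y i)) ΔW)
    (hη0 : 0 ≤ η) (hη : η ≤ √lam / 8) (h5 : η * ‖ΔW‖ ≤ τ / 8) (hτ : 16 * n ≤ τ) (hτ0 : 0 < τ)
    (h6 : 2 * M / √(m : ℝ) * (2 * ‖ΔW‖ ^ 2 / τ) < R) :
    ∃ T : ℝ, 0 ≤ T ∧ T ≤ 16 * (n + robustLoss ε x y a (W 0)) / lam ∧
      (∀ t, T ≤ t → certifiedError ε x y a (W t) = 0) ∧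
      ∀ t, 0 ≤ t → t ≤ T →
        robustLoss ε x y a (W t) ≤ robustLoss ε x y a (W 0)
          * Real.exp (-(lam * t / (16 * (n + robustLoss ε x y a (W 0))))) ∧
        robustLoss ε x y a (W t) ≤ Real.exp (16 * (n + robustLoss ε x y a (W 0)))
          * robustLoss ε x y a (W 0) * Real.exp (-(lam * t / 2)) := by
  set L : ℝ → ℝ := fun t => robustLoss ε x y a (W t) with hLdef
  have hLnn : ∀ t, 0 ≤ L t := fun t => Finset.sum_nonneg fun i _ => (logistic_pos _).le
  have hanti : ∀ s t, 0 ≤ s → s ≤ t → L t ≤ L s := fun s t hs hst =>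
    hW.loss_antitone hε ha hx hy hs hst
  have hLcont : ContinuousOn L (Ici 0) :=
    (continuous_robustLoss hε ha hx hy).comp_continuousOn hW.continuousOn
  have hn0 := Nat.cast_nonneg (α := ℝ) n
  -- While the loss exceeds `1/2`, it decreases at a rate of at least `lam / 8`, or at a rate of at
  -- least `lam L² / (8 n)`: the two cases of the lower bound for the sum of the squared weights.
  have hderiv : ∀ t₁, (∀ s, 0 ≤ s → s < t₁ → 1 / 2 ≤ L s) → ∀ᵐ t : ℝ, t ∈ Ioo 0 t₁ →
      ∃ c, HasDerivAt L c t ∧ c ≤ 0 ∧ (c ≤ -(lam / 8) ∨ 8 * n * c ≤ -(lam * L t ^ 2)) := by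
    intro t₁ ht₁
    filter_upwards [hW.ae_hasDerivAt_loss hε ha hx hy] with t ht htm
    obtain ⟨v, -, hg, hd⟩ := ht htm.1
    refine ⟨_, hd, by simp, ?_⟩
    have hst := fun r => hW.l2_row_sub_lt hε ha hx hy hM hM0 h2 h3 h4 hη0 h5 hτ hτ0 h6 ht₁
      htm.1.le htm.2.le r
    have k1 := sum_sq_le_norm_sq_of_mem_clarke hε ha hx hy hlam h1 h2 hη hst hg
    rw [norm_neg] at k1
    rcases min_le_sum_sq_lossWeight (ε := ε) (x := x) (y := y) (a := a) (W := W t) with h | h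
    · left; nlinarith
    · right
      have h' : L t ^ 2 ≤ 4 * n * ∑ i, lossWeight ε x y a (W t) i ^ 2 := h
      have e1 := mul_le_mul_of_nonneg_left k1 hn0
      have e2 := mul_le_mul_of_nonneg_left h' hlam.le
      linarith
  have hge : ∀ t₁, 0 < t₁ → (∀ s, 0 ≤ s → s < t₁ → 1 / 2 ≤ L s) → 1 / 2 ≤ L t₁ := by
    intro t₁ h0 h
    have hc : Tendsto L (𝓝[Ico 0 t₁] t₁) (𝓝 (L t₁)) :=
      (hLcont t₁ h0.le).mono Ico_subset_Ici_self
    have : (𝓝[Ico 0 t₁] t₁).NeBot := by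
      rw [← mem_closure_iff_nhdsWithin_neBot, closure_Ico h0.ne]
      exact right_mem_Icc.2 h0.le
    exact ge_of_tendsto hc (eventually_mem_nhdsWithin.mono fun s hs => h s hs.1 hs.2)
  have htime : ∀ t₁, 0 ≤ t₁ → (∀ s, 0 ≤ s → s < t₁ → 1 / 2 ≤ L s) →
      t₁ ≤ 16 * (n + L 0) / lam := by
    intro t₁ h0 h
    rcases h0.eq_or_lt with rfl | h0'
    · have := hLnn 0
      positivity
    have hLge : ∀ t ∈ Icc 0 t₁, 1 / 2 ≤ L t := by
      rintro t ⟨u0, u1⟩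
      rcases u1.eq_or_lt with rfl | u1
      · exact hge _ h0' h
      · exact h t u0 u1
    -- The potential `8 L - 8 n / L` decreases at least at the rate `lam`, in both cases.
    have hfin := sub_le_of_potential (Φ := fun l => 8 * l - 8 * n * l⁻¹)
      (Φ' := fun l => 8 + 8 * n / l ^ 2) (K := 8 + 32 * (n : NNReal)) (κ := -lam) h0
      (hW.loss_absCont hε ha hx hy le_rfl h0) hLge ?_ ?_ ?_
    · have b1 := hLge t₁ ⟨h0, le_rfl⟩
      have b3 : (L t₁)⁻¹ ≤ 2 := by
        rw [inv_le_comm₀ (by linarith) two_pos]; linarith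
      have b4 : 0 ≤ (L 0)⁻¹ := inv_nonneg.2 (hLnn 0)
      rw [le_div_iff₀ hlam]
      have hfin' : 8 * L t₁ - 8 * n * (L t₁)⁻¹ - (8 * L 0 - 8 * n * (L 0)⁻¹) ≤ -lam * t₁ := hfin
      have b5 := mul_le_mul_of_nonneg_left b3 hn0
      have b6 := mul_nonneg hn0 b4
      have b7 := hLnn 0
      linarith
    · intro l hl
      have hl0 : l ≠ 0 := by positivity
      refine (((hasDerivAt_id l).const_mul 8).sub
        ((hasDerivAt_inv hl0).const_mul (8 * (n : ℝ)))).congr_deriv ?_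
      field_simp
      ring
    · intro l hl
      rw [Real.norm_of_nonneg (by positivity)]
      push_cast
      have : 8 * (n : ℝ) / l ^ 2 ≤ 32 * n := by
        have hl2 : 1 / 4 ≤ l ^ 2 := by nlinarith
        rw [div_le_iff₀ (by positivity)]
        nlinarith
      linarith
    · filter_upwards [hderiv t₁ h] with t ht htm
      obtain ⟨c, hc, hc0, hcase⟩ := ht htm
      have hl := hLge t ⟨htm.1.le, htm.2.le⟩
      have hl0 : 0 < L t := by linarith
      refine ⟨c, hc, ?_⟩
      have e : (8 + 8 * n / L t ^ 2) * c = 8 * c + 8 * n * c / L t ^ 2 := by ring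
      have e2 : 8 * n * c / L t ^ 2 ≤ 0 :=
        div_nonpos_of_nonpos_of_nonneg (mul_nonpos_of_nonneg_of_nonpos (by positivity) hc0)
          (by positivity)
      change (8 + 8 * n / L t ^ 2) * c ≤ -lam
      rw [e]
      rcases hcase with h | h
      · linarith
      · have : 8 * n * c / L t ^ 2 ≤ -lam := by
          rw [div_le_iff₀ (by positivity)]; linarith
        linarith
  have hexp : ∀ t₁, 0 ≤ t₁ → (∀ s, 0 ≤ s → s < t₁ → 1 / 2 ≤ L s) →
      L t₁ ≤ L 0 * Real.exp (-(lam * t₁ / (16 * (n + L 0)))) := by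
    intro t₁ h0 h
    rcases h0.eq_or_lt with rfl | h0'
    · simp
    have hLge : ∀ t ∈ Icc 0 t₁, 1 / 2 ≤ L t := by
      rintro t ⟨u0, u1⟩
      rcases u1.eq_or_lt with rfl | u1
      · exact hge _ h0' h
      · exact h t u0 u1
    have b0 := hLge 0 ⟨le_rfl, h0⟩
    have b1 := hLge t₁ ⟨h0, le_rfl⟩
    have hfin := sub_le_of_potential (Φ := Real.log) (Φ' := fun l => l⁻¹) (K := 2)
      (κ := -(lam / (16 * (n + L 0)))) h0 (hW.loss_absCont hε ha hx hy le_rfl h0) hLge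
      (fun l hl => Real.hasDerivAt_log (by positivity)) ?_ ?_
    · have hfin' : Real.log (L t₁) - Real.log (L 0) ≤ -(lam / (16 * (n + L 0))) * t₁ := hfin
      have e1 : Real.log (L t₁) ≤ Real.log (L 0) + -(lam * t₁ / (16 * (n + L 0))) := by
        have : -(lam / (16 * (n + L 0))) * t₁ = -(lam * t₁ / (16 * (n + L 0))) := by ring
        linarith
      have e2 := Real.exp_le_exp.2 e1
      rwa [Real.exp_add, Real.exp_log (by linarith), Real.exp_log (by linarith)] at e2
    · intro l hl
      rw [Real.norm_of_nonneg (by positivity)]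
      push_cast
      rw [inv_le_comm₀ (by linarith) two_pos]; linarith
    · filter_upwards [hderiv t₁ h] with t ht htm
      obtain ⟨c, hc, hc0, hcase⟩ := ht htm
      have hl := hLge t ⟨htm.1.le, htm.2.le⟩
      have hl0 : 0 < L t := by linarith
      have hla := hanti 0 t le_rfl htm.1.le
      refine ⟨c, hc, ?_⟩
      change (L t)⁻¹ * c ≤ -(lam / (16 * (n + L 0)))
      rw [inv_mul_le_iff₀ hl0, mul_neg, mul_div_assoc', le_neg, div_le_iff₀ (by positivity)]
      rcases hcase with h | h
      · have := mul_le_mul_of_nonneg_left hla hlam.le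
        have : lam / 8 * (16 * (n + L 0)) ≤ -c * (16 * (n + L 0)) :=
          mul_le_mul_of_nonneg_right (by linarith) (by positivity)
        have := mul_nonneg hlam.le hn0
        nlinarith
      · have h1 : 0 ≤ -c * (16 * L 0) := mul_nonneg (by linarith) (by linarith)
        have h2 : lam * L t * (1 / 2) ≤ lam * L t * L t :=
          mul_le_mul_of_nonneg_left hl (by positivity)
        nlinarith
  -- `T` is the first time at which the loss is at most `1/2`.
  set X : Set ℝ := {t | 0 ≤ t ∧ L t ≤ 1 / 2} with hX
  have hXc : IsClosed X := by
    have : X = Ici 0 ∩ L ⁻¹' Iic (1 / 2) := by ext t; simp [hX]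
    rw [this]
    exact hLcont.preimage_isClosed_of_isClosed isClosed_Ici isClosed_Iic
  have hB : 0 ≤ 16 * (n + L 0) / lam := by
    have := hLnn 0
    positivity
  have hXne : X.Nonempty := by
    by_contra hemp
    have hall : ∀ s, 0 ≤ s → 1 / 2 ≤ L s := by
      intro s hs
      by_contra h
      exact hemp ⟨s, hs, (not_le.1 h).le⟩
    have := htime (16 * (n + L 0) / lam + 1) (by linarith) fun s hs _ => hall s hs
    linarith
  have hXb : BddBelow X := ⟨0, fun t ht => ht.1⟩
  obtain ⟨hT0, hT1⟩ := hXc.csInf_mem hXne hXb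
  set T := sInf X with hT
  have hbefore : ∀ s, 0 ≤ s → s < T → 1 / 2 ≤ L s := by
    intro s hs hsT
    by_contra h
    exact absurd (csInf_le hXb (⟨hs, (not_le.1 h).le⟩ : s ∈ X)) (not_le.2 hsT)
  have hTle := htime T hT0 hbefore
  refine ⟨T, hT0, hTle, ?_, ?_⟩
  · intro t ht
    have hLt : L t ≤ 1 / 2 := (hanti T t hT0 ht).trans hT1
    have : {i : Fin n | ¬ 0 < marginLower ε a (W t) (x i) (y i)} = ∅ := by
      ext i
      simp only [mem_ofPred_eq, mem_empty_iff_false, iff_false, not_not]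
      refine pos_of_logistic_lt (le_trans ?_ hLt)
      exact Finset.single_le_sum
        (f := fun i => logistic (marginLower ε a (W t) (x i) (y i)))
        (fun i _ => (logistic_pos _).le) (Finset.mem_univ i)
    rw [certifiedError, this, ncard_empty, Nat.cast_zero, zero_div]
  · intro t ht0 htT
    refine ⟨hexp t ht0 fun s h h' => hbefore s h (h'.trans_le htT), ?_⟩
    -- Up to time `T` the two exponentials multiply to at least `1`, and the loss does not increase.
    have e1 : L t ≤ L 0 := hanti 0 t le_rfl ht0
    have e2 : lam * t ≤ 16 * (n + L 0) := by
      have := htT.trans hTle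
      rw [le_div_iff₀ hlam] at this
      linarith
    change L t ≤ Real.exp (16 * (n + L 0)) * L 0 * Real.exp (-(lam * t / 2))
    have e3 : Real.exp (16 * (n + L 0)) * L 0 * Real.exp (-(lam * t / 2))
        = Real.exp (16 * (n + L 0) - lam * t / 2) * L 0 := by
      rw [sub_eq_add_neg, Real.exp_add]; ring
    have e4 : 1 ≤ Real.exp (16 * (n + L 0) - lam * t / 2) := by
      refine Real.one_le_exp ?_
      have := hLnn 0
      have := mul_nonneg hlam.le ht0
      linarith
    rw [e3]
    nlinarith [hLnn 0]

end Training

/-! ### Standard Gaussian vectors -/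

section Gaussian

variable {ι : Type*} [Fintype ι]

/-- The law of a vector of independent standard Gaussian variables. -/
noncomputable def gaussianPi (ι : Type*) [Fintype ι] : Measure (ι → ℝ) :=
  Measure.pi fun _ => gaussianReal 0 1

instance : IsProbabilityMeasure (gaussianPi ι) := by unfold gaussianPi; infer_instance

/-- The density of `gaussianPi`. -/
noncomputable def gaussianDensity (w : ι → ℝ) : ℝ :=
  ((√(2 * Real.pi))⁻¹) ^ Fintype.card ι * Real.exp (-(∑ k, w k ^ 2) / 2)

theorem gaussianDensity_eq_prod (w : ι → ℝ) :
    gaussianDensity w = ∏ k, gaussianPDFReal 0 1 (w k) := by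
  unfold gaussianDensity gaussianPDFReal
  rw [Finset.prod_mul_distrib, Finset.prod_const, Finset.card_univ, ← Real.exp_sum]
  simp [Finset.sum_div, neg_div]

theorem gaussianDensity_nonneg (w : ι → ℝ) : 0 ≤ gaussianDensity w := by
  unfold gaussianDensity; positivity

theorem continuous_gaussianDensity : Continuous (gaussianDensity : (ι → ℝ) → ℝ) := by
  unfold gaussianDensity; fun_prop

theorem gaussianPi_eq_withDensity :
    gaussianPi ι = volume.withDensity fun w => ENNReal.ofReal (gaussianDensity w) := by
  classical
  refine Measure.pi_eq fun s hs => ?_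
  have hbox : MeasurableSet (univ.pi s) := MeasurableSet.univ_pi hs
  have hint1 : ∀ i, Integrable ((s i).indicator (gaussianPDFReal 0 1)) := fun i =>
    (integrable_gaussianPDFReal 0 1).indicator (hs i)
  have hprod : ∀ w : ι → ℝ, (univ.pi s).indicator gaussianDensity w
      = ∏ i, (s i).indicator (gaussianPDFReal 0 1) (w i) := by
    intro w
    by_cases hw : w ∈ univ.pi s
    · rw [indicator_of_mem hw, gaussianDensity_eq_prod]
      exact Finset.prod_congr rfl fun i _ => (indicator_of_mem (hw i (mem_univ i)) _).symm
    · rw [indicator_of_notMem hw]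
      simp only [mem_univ_pi, not_forall] at hw
      obtain ⟨i, hi⟩ := hw
      exact (Finset.prod_eq_zero (Finset.mem_univ i) (indicator_of_notMem hi _)).symm
  have hint : Integrable ((univ.pi s).indicator gaussianDensity : (ι → ℝ) → ℝ) := by
    have := Integrable.fintype_prod (μ := fun _ : ι => (volume : Measure ℝ)) hint1
    rw [← volume_pi] at this
    exact this.congr (Eventually.of_forall fun w => (hprod w).symm)
  rw [withDensity_apply _ hbox, ← lintegral_indicator hbox]
  have e1 : ∀ w : ι → ℝ, (univ.pi s).indicator (fun w => ENNReal.ofReal (gaussianDensity w)) w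
      = ENNReal.ofReal ((univ.pi s).indicator gaussianDensity w) := by
    intro w
    by_cases hw : w ∈ univ.pi s <;> simp [hw, indicator]
  simp_rw [e1]
  rw [← ofReal_integral_eq_lintegral_ofReal hint
    (Eventually.of_forall fun w => indicator_nonneg (fun w _ => gaussianDensity_nonneg w) w)]
  simp_rw [hprod]
  rw [integral_fintype_prod_volume_eq_prod, ENNReal.ofReal_prod_of_nonneg]
  · refine Finset.prod_congr rfl fun i _ => ?_
    rw [integral_indicator (hs i), gaussianReal_apply_eq_integral _ one_ne_zero]
  · exact fun i _ => integral_nonneg fun w => indicator_nonneg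
      (fun w _ => gaussianPDFReal_nonneg 0 1 w) w

theorem lintegral_gaussianPi (F : (ι → ℝ) → ENNReal) :
    ∫⁻ w, F w ∂gaussianPi ι = ∫⁻ w, ENNReal.ofReal (gaussianDensity w) * F w := by
  rw [gaussianPi_eq_withDensity, lintegral_withDensity_eq_lintegral_mul_non_measurable]
  · rfl
  · exact continuous_gaussianDensity.measurable.ennreal_ofReal
  · exact Eventually.of_forall fun w => ENNReal.ofReal_lt_top

/-- The two translates of a set by `b` and `-b` have together at least the measure of the set: the
densities at `w + b` and `w - b` add up to `2 exp (-‖b‖² / 2) cosh ⟨w, b⟩` times the density at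
`w`. -/
theorem le_gaussianPi_translates {A : Set (ι → ℝ)} (hA : MeasurableSet A) {b : ι → ℝ}
    (hb : ∑ k, b k ^ 2 ≤ 1) :
    gaussianPi ι A ≤ gaussianPi ι ((fun w => w - b) ⁻¹' A)
      + gaussianPi ι ((fun w => w + b) ⁻¹' A) := by
  have hshift : ∀ c : ι → ℝ, gaussianPi ι ((fun w => w - c) ⁻¹' A)
      = ∫⁻ w, ENNReal.ofReal (gaussianDensity (w + c)) * A.indicator 1 w := by
    intro c
    have hm : MeasurableSet ((fun w : ι → ℝ => w - c) ⁻¹' A) := (measurable_sub_const c) hA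
    rw [← lintegral_indicator_one hm, lintegral_gaussianPi,
      ← lintegral_add_right_eq_self _ c]
    refine lintegral_congr fun w => ?_
    congr 1
    by_cases h : w ∈ A <;> simp [indicator, h]
  have e2 := hshift (-b)
  simp only [sub_neg_eq_add] at e2
  rw [hshift b, e2, ← lintegral_indicator_one hA, lintegral_gaussianPi, ← lintegral_add_left]
  · refine lintegral_mono fun w => ?_
    rw [← add_mul, ← ENNReal.ofReal_add (gaussianDensity_nonneg _) (gaussianDensity_nonneg _)]
    refine mul_le_mul_left (ENNReal.ofReal_le_ofReal ?_) _
    unfold gaussianDensity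
    rw [← mul_add]
    refine mul_le_mul_of_nonneg_left ?_ (by positivity)
    set q := ∑ k, w k * b k with hq
    have f1 : -(∑ k, (w + b) k ^ 2) / 2 = -(∑ k, w k ^ 2) / 2 + (-(∑ k, b k ^ 2) / 2 + -q) := by
      simp only [Pi.add_apply, add_sq, Finset.sum_add_distrib, mul_assoc, ← Finset.mul_sum, ← hq]
      ring
    have f2 : -(∑ k, (w + -b) k ^ 2) / 2 = -(∑ k, w k ^ 2) / 2 + (-(∑ k, b k ^ 2) / 2 + q) := by
      simp only [Pi.add_apply, Pi.neg_apply, add_sq, Finset.sum_add_distrib, mul_assoc, mul_neg,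
        ← Finset.mul_sum, ← hq, neg_sq, Finset.sum_neg_distrib]
      ring
    rw [f1, f2, Real.exp_add (-(∑ k, w k ^ 2) / 2) (-(∑ k, b k ^ 2) / 2 + -q),
      Real.exp_add (-(∑ k, w k ^ 2) / 2) (-(∑ k, b k ^ 2) / 2 + q), ← mul_add]
    refine le_mul_of_one_le_right (Real.exp_pos _).le ?_
    have g1 := Real.add_one_le_exp (-(∑ k, b k ^ 2) / 2 + -q)
    have g2 := Real.add_one_le_exp (-(∑ k, b k ^ 2) / 2 + q)
    linarith
  · have : Measurable fun w : ι → ℝ => ENNReal.ofReal (gaussianDensity (w + b)) :=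
      (continuous_gaussianDensity.measurable.comp (measurable_add_const b)).ennreal_ofReal
    exact this.mul (measurable_one.indicator hA)

/-- Anticoncentration: a function that grows at least at the rate `c` in a unit direction is
unlikely to be small. The translates of the set where it is small by multiples of `3 θ / c` are
disjoint, and the translates by `b` and `-b`, for a vector `b` in the unit ball, have together at
least the measure of the set itself. -/
theorem gaussianPi_abs_le {F : (ι → ℝ) → ℝ} (hF : Measurable F) {e : ι → ℝ}
    (he : ∑ k, e k ^ 2 ≤ 1) {c θ : ℝ} (hc : 0 < c) (hθ : 0 < θ)
    (hmono : ∀ w t, 0 ≤ t → F w + c * t ≤ F (w + t • e)) :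
    gaussianPi ι {w | |F w| ≤ θ} ≤ ENNReal.ofReal (6 * θ / c) := by
  set A : Set (ι → ℝ) := {w | |F w| ≤ θ} with hAdef
  have hA : MeasurableSet A := measurableSet_le hF.abs measurable_const
  set h : ℝ := 3 * θ / c with hh
  have hpos : 0 < h := by positivity
  set N : ℕ := ⌊1 / h⌋₊ with hN
  have hN1 : N * h ≤ 1 := by
    have := Nat.floor_le (by positivity : 0 ≤ 1 / h)
    rwa [le_div_iff₀ hpos] at this
  have hN2 : 1 < (N + 1) * h := by
    have := Nat.lt_floor_add_one (1 / h)
    rwa [div_lt_iff₀ hpos] at this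
  let B : ℤ → Set (ι → ℝ) := fun j => (fun w => w - ((j : ℝ) * h) • e) ⁻¹' A
  have hB : ∀ j, MeasurableSet (B j) := fun j => (measurable_sub_const _) hA
  have hdisj : ∀ i j : ℤ, i < j → Disjoint (B i) (B j) := by
    intro i j hij
    rw [Set.disjoint_left]
    intro w hi hj
    have h1 : |F (w - ((i : ℝ) * h) • e)| ≤ θ := hi
    have h2 : |F (w - ((j : ℝ) * h) • e)| ≤ θ := hj
    have hij' : (1 : ℝ) ≤ (j : ℝ) - i := by
      have : i + 1 ≤ j := hij
      have : ((i + 1 : ℤ) : ℝ) ≤ j := by exact_mod_cast this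
      push_cast at this
      linarith
    have h3 := hmono (w - ((j : ℝ) * h) • e) (((j : ℝ) - i) * h) (by positivity)
    have e1 : w - ((j : ℝ) * h) • e + (((j : ℝ) - i) * h) • e = w - ((i : ℝ) * h) • e := by
      rw [sub_add, ← sub_smul]; congr 2; ring
    rw [e1] at h3
    have h4 : c * h ≤ c * (((j : ℝ) - i) * h) := by
      refine mul_le_mul_of_nonneg_left ?_ hc.le
      nlinarith
    have h5 : c * h = 3 * θ := by rw [hh]; field_simp
    have := abs_le.1 h1
    have := abs_le.1 h2
    linarith
  have hsum : ∑ j ∈ Finset.Icc (-(N : ℤ)) N, gaussianPi ι (B j) ≤ 1 := by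
    rw [← measure_biUnion_finset (fun i _ j _ hij => ?_) fun j _ => hB j]
    · exact prob_le_one
    · rcases lt_or_gt_of_ne hij with h | h
      · exact hdisj i j h
      · exact (hdisj j i h).symm
  have hsym : ∑ j ∈ Finset.Icc (-(N : ℤ)) N, gaussianPi ι (B (-j))
      = ∑ j ∈ Finset.Icc (-(N : ℤ)) N, gaussianPi ι (B j) := by
    refine Finset.sum_nbij' (fun j => -j) (fun j => -j) ?_ ?_ ?_ ?_ ?_ <;> simp <;> omega
  have hpair : ∀ j ∈ Finset.Icc (-(N : ℤ)) N,
      gaussianPi ι A ≤ gaussianPi ι (B j) + gaussianPi ι (B (-j)) := by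
    intro j hj
    rw [Finset.mem_Icc] at hj
    have habs : |(j : ℝ)| ≤ N := by
      rw [abs_le]; constructor
      · have := hj.1; exact_mod_cast this
      · exact_mod_cast hj.2
    have hle := le_gaussianPi_translates hA (b := ((j : ℝ) * h) • e) (by
      simp only [Pi.smul_apply, smul_eq_mul, mul_pow, ← Finset.mul_sum]
      have h0 : 0 ≤ ∑ k, e k ^ 2 := Finset.sum_nonneg fun _ _ => sq_nonneg _
      have h1 : (j : ℝ) ^ 2 * h ^ 2 ≤ 1 := by
        rw [← sq_abs (j : ℝ), ← mul_pow]
        exact pow_le_one₀ (by positivity) ((mul_le_mul_of_nonneg_right habs hpos.le).trans hN1)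
      nlinarith)
    have e1 : B (-j) = (fun w => w + ((j : ℝ) * h) • e) ⁻¹' A := by
      simp [B, neg_mul]
    rw [e1]
    exact hle
  have htotal : ((2 * N + 1 : ℕ) : ENNReal) * gaussianPi ι A ≤ 2 := by
    have h1 := Finset.sum_le_sum hpair
    rw [Finset.sum_add_distrib, hsym, Finset.sum_const, Int.card_Icc] at h1
    have h2 : ((N : ℤ) + 1 - -(N : ℤ)).toNat = 2 * N + 1 := by omega
    rw [h2, nsmul_eq_mul] at h1
    refine h1.trans ?_
    calc _ ≤ (1 : ENNReal) + 1 := add_le_add hsum hsum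
      _ = 2 := one_add_one_eq_two
  have hreal : ((2 * N + 1 : ℕ) : ℝ) * (gaussianPi ι A).toReal ≤ 2 := by
    have := ENNReal.toReal_mono (by simp) htotal
    rw [ENNReal.toReal_mul, ENNReal.toReal_natCast] at this
    exact this.trans (by simp)
  rw [← ENNReal.ofReal_toReal (measure_ne_top (gaussianPi ι) A)]
  refine ENNReal.ofReal_le_ofReal ?_
  have e1 : 6 * θ / c = 2 * h := by rw [hh]; ring
  rw [e1]
  push_cast at hreal
  have hm0 : 0 ≤ (gaussianPi ι A).toReal := ENNReal.toReal_nonneg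
  have hN0 : (0 : ℝ) ≤ N := Nat.cast_nonneg _
  by_contra hcon
  rw [not_le] at hcon
  have : (2 * (N : ℝ) + 1) * (2 * h) < 2 :=
    lt_of_lt_of_le (mul_lt_mul_of_pos_left hcon (by positivity)) hreal
  nlinarith

/-- For a function that is invariant under scaling of the coordinates in `J`, the weight
`∑ j ∈ J, z j ^ 2` costs at most a factor of the order of the number of these coordinates. The
change of variables `z j ↦ t z j` for `j ∈ J` turns a part of the density into this weight. -/
theorem lintegral_gaussianPi_sum_sq_mul_le [DecidableEq ι] (J : Finset ι) {n : ℕ} (hn : 0 < n)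
    (hJ : J.card ≤ n) {H : (ι → ℝ) → ENNReal} (hH : Measurable H)
    (hinv : ∀ z (t : ℝ), 0 < t → H (fun j => (if j ∈ J then t else 1) * z j) = H z) :
    ∫⁻ z, ENNReal.ofReal (∑ j ∈ J, z j ^ 2) * H z ∂gaussianPi ι
      ≤ ENNReal.ofReal (8 * n) * ∫⁻ z, H z ∂gaussianPi ι := by
  have hn' : (1 : ℝ) ≤ n := by exact_mod_cast hn
  -- With this scale the determinant `t ^ #J` is at least `1/2`, while
  -- `1 - t ^ 2` is of order `1 / n`.
  set t : ℝ := √(1 - 1 / (2 * n)) with ht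
  have hhalf : 1 / (2 * (n : ℝ)) ≤ 1 / 2 := by
    rw [div_le_div_iff₀ (by positivity) two_pos]; linarith
  have htsq : t ^ 2 = 1 - 1 / (2 * n) := Real.sq_sqrt (by linarith)
  have htpos : 0 < t := Real.sqrt_pos.2 (by linarith)
  have ht1 : t ≤ 1 := by
    have : 0 ≤ 1 / (2 * (n : ℝ)) := by positivity
    exact Real.sqrt_le_one.2 (by linarith)
  have htn : 1 / 2 ≤ t ^ J.card := by
    have h1 : t ^ (2 * n) ≤ t ^ J.card := pow_le_pow_of_le_one htpos.le ht1 (by omega)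
    have h2 : 1 / 2 ≤ t ^ (2 * n) := by
      rw [pow_mul, htsq]
      have := one_add_mul_le_pow (a := -(1 / (2 * (n : ℝ)))) (by linarith) n
      have e : 1 + (n : ℝ) * -(1 / (2 * n)) = 1 / 2 := by field_simp; norm_num
      rw [e] at this
      simpa [sub_eq_add_neg] using this
    exact h2.trans h1
  let D : ι → ℝ := fun j => if j ∈ J then t else 1
  have hdet : (Matrix.diagonal D).det = t ^ J.card := by
    rw [Matrix.det_diagonal]
    simp [D]
  have hdet0 : (Matrix.diagonal D).det ≠ 0 := by rw [hdet]; positivity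
  have hvol := Real.smul_map_diagonal_volume_pi hdet0
  rw [hdet, abs_of_pos (by positivity)] at hvol
  have hlin : ∀ z : ι → ℝ, Matrix.toLin' (Matrix.diagonal D) z = fun j => D j * z j := by
    intro z; ext j
    simp [Matrix.mulVec_diagonal]
  have hmeasD : Measurable (Matrix.toLin' (Matrix.diagonal D)) :=
    (LinearMap.continuous_on_pi _).measurable
  have hmeasF : Measurable fun w : ι → ℝ => ENNReal.ofReal (gaussianDensity w) * H w :=
    continuous_gaussianDensity.measurable.ennreal_ofReal.mul hH
  have hchange : ∫⁻ z, H z ∂gaussianPi ι = ENNReal.ofReal (t ^ J.card) *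
      ∫⁻ z, ENNReal.ofReal (gaussianDensity fun j => D j * z j) * H z := by
    rw [lintegral_gaussianPi]
    conv_lhs => rw [← hvol]
    rw [lintegral_smul_measure, lintegral_map hmeasF hmeasD]
    simp only [hlin, smul_eq_mul]
    congr 1
    refine lintegral_congr fun z => ?_
    rw [show H (fun j => D j * z j) = H z from hinv z t htpos]
  have hdens : ∀ z : ι → ℝ, (1 - t ^ 2) / 2 * (∑ j ∈ J, z j ^ 2) * gaussianDensity z
      ≤ gaussianDensity fun j => D j * z j := by
    intro z
    have e1 : -(∑ j, (D j * z j) ^ 2) / 2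
        = -(∑ j, z j ^ 2) / 2 + (1 - t ^ 2) / 2 * ∑ j ∈ J, z j ^ 2 := by
      have : ∀ j, (D j * z j) ^ 2 = z j ^ 2 - (1 - t ^ 2) * (if j ∈ J then z j ^ 2 else 0) := by
        intro j
        simp only [D]
        split_ifs <;> ring
      simp only [this, Finset.sum_sub_distrib, ← Finset.mul_sum, Finset.sum_ite_mem,
        Finset.univ_inter]
      ring
    unfold gaussianDensity
    rw [e1, Real.exp_add]
    have := Real.add_one_le_exp ((1 - t ^ 2) / 2 * ∑ j ∈ J, z j ^ 2)
    have hp : 0 ≤ ((√(2 * Real.pi))⁻¹) ^ Fintype.card ι * Real.exp (-(∑ k, z k ^ 2) / 2) := by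
      positivity
    nlinarith
  have hkey : ENNReal.ofReal ((1 - t ^ 2) / 2) *
      ∫⁻ z, ENNReal.ofReal (∑ j ∈ J, z j ^ 2) * H z ∂gaussianPi ι
      ≤ ∫⁻ z, ENNReal.ofReal (gaussianDensity fun j => D j * z j) * H z := by
    rw [lintegral_gaussianPi, ← lintegral_const_mul' _ _ ENNReal.ofReal_ne_top]
    refine lintegral_mono fun z => ?_
    have hS : 0 ≤ ∑ j ∈ J, z j ^ 2 := Finset.sum_nonneg fun _ _ => sq_nonneg _
    have ht2 : 0 ≤ (1 - t ^ 2) / 2 := by rw [htsq, sub_sub_cancel]; positivity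
    calc _ = ENNReal.ofReal ((1 - t ^ 2) / 2 * (∑ j ∈ J, z j ^ 2) * gaussianDensity z) * H z := by
          rw [ENNReal.ofReal_mul (by positivity), ENNReal.ofReal_mul ht2]; ring
      _ ≤ _ := by
          gcongr
          exact hdens z
  have h14 : (1 - t ^ 2) / 2 = 1 / (4 * n) := by rw [htsq]; field_simp; norm_num
  rw [h14] at hkey
  set X := ∫⁻ z, ENNReal.ofReal (∑ j ∈ J, z j ^ 2) * H z ∂gaussianPi ι
  have h1 : ENNReal.ofReal (1 / 2) * (ENNReal.ofReal (1 / (4 * n)) * X)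
      ≤ ∫⁻ z, H z ∂gaussianPi ι := by
    rw [hchange]
    exact mul_le_mul' (ENNReal.ofReal_le_ofReal htn) hkey
  calc X = ENNReal.ofReal (8 * n) *
        (ENNReal.ofReal (1 / 2) * (ENNReal.ofReal (1 / (4 * n)) * X)) := by
        rw [← mul_assoc, ← mul_assoc, ← ENNReal.ofReal_mul (by positivity),
          ← ENNReal.ofReal_mul (by positivity)]
        have : 8 * (n : ℝ) * (1 / 2) * (1 / (4 * n)) = 1 := by field_simp; norm_num
        rw [this, ENNReal.ofReal_one, one_mul]
    _ ≤ _ := by gcongr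

end Gaussian

/-! ### Convergence from a well-conditioned initialization -/

section Frame

variable {n : ℕ}

/-- For a symmetric matrix `A` whose eigenvalues are at least `lam > 0` the rescaled eigenvectors
form a basis that is orthonormal for the quadratic form of `A`. In this basis `A⁻¹ z` and
`zᵀ A⁻¹ z` are sums over the basis vectors. -/
theorem exists_orthonormal_frame {A : Matrix (Fin n) (Fin n) ℝ} (hA : A.IsHermitian) {lam : ℝ}
    (hlam : 0 < lam) (hspec : ∀ μ ∈ spectrum ℝ A, lam ≤ μ) :
    ∃ f : Fin n → Fin n → ℝ, (∀ j, f j ⬝ᵥ A.mulVec (f j) = 1) ∧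
      (∀ z, A.mulVec (∑ j, (f j ⬝ᵥ z) • f j) = z) ∧
      (∀ z, ∑ j, (f j ⬝ᵥ z) ^ 2 ≤ (z ⬝ᵥ z) / lam) ∧
      ∀ z, lam * (z ⬝ᵥ z) ≤ z ⬝ᵥ A.mulVec z := by
  set b := hA.eigenvectorBasis with hb
  set μ := hA.eigenvalues with hμ
  have hμl : ∀ j, lam ≤ μ j := fun j => hspec _ (hA.eigenvalues_mem_spectrum_real j)
  have hμ0 : ∀ j, 0 < μ j := fun j => hlam.trans_le (hμl j)
  let e : Fin n → Fin n → ℝ := fun j => (b j).ofLp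
  have hmul : ∀ j, A.mulVec (e j) = μ j • e j := fun j => hA.mulVec_eigenvectorBasis j
  have hinner : ∀ (j) (z : Fin n → ℝ), inner ℝ (b j) (WithLp.toLp 2 z : EuclideanSpace ℝ (Fin n))
      = e j ⬝ᵥ z := by
    intro j z
    rw [PiLp.inner_apply]
    exact Finset.sum_congr rfl fun k _ => by simp [e, mul_comm]
  have hee : ∀ j, e j ⬝ᵥ e j = 1 := by
    intro j
    rw [← hinner]
    exact (real_inner_self_eq_norm_sq (b j)).trans (by simp)
  have hexp : ∀ z : Fin n → ℝ, ∑ j, (e j ⬝ᵥ z) • e j = z := by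
    intro z
    have := congrArg WithLp.ofLp (b.sum_repr' (WithLp.toLp 2 z : EuclideanSpace ℝ (Fin n)))
    simp only [hinner, WithLp.ofLp_sum, WithLp.ofLp_smul] at this
    exact this
  have hpars : ∀ z : Fin n → ℝ, ∑ j, (e j ⬝ᵥ z) ^ 2 = z ⬝ᵥ z := by
    intro z
    conv_rhs => arg 1; rw [← hexp z]
    rw [sum_dotProduct]
    exact Finset.sum_congr rfl fun j _ => by rw [smul_dotProduct, smul_eq_mul, sq]
  have hsq : ∀ j, (√(μ j))⁻¹ * (√(μ j))⁻¹ = (μ j)⁻¹ := fun j => by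
    rw [← mul_inv, Real.mul_self_sqrt (hμ0 j).le]
  refine ⟨fun j => (√(μ j))⁻¹ • e j, fun j => ?_, fun z => ?_, fun z => ?_, fun z => ?_⟩
  · rw [Matrix.mulVec_smul, hmul, smul_dotProduct, dotProduct_smul, dotProduct_smul, hee]
    simp only [smul_eq_mul]
    rw [mul_one, ← mul_assoc, hsq, inv_mul_cancel₀ (hμ0 j).ne']
  · rw [Matrix.mulVec_sum]
    conv_rhs => rw [← hexp z]
    refine Finset.sum_congr rfl fun j _ => ?_
    rw [Matrix.mulVec_smul, Matrix.mulVec_smul, hmul, smul_dotProduct, smul_smul, smul_smul,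
      smul_eq_mul]
    congr 1
    have := hsq j
    calc (√(μ j))⁻¹ * (e j ⬝ᵥ z) * (√(μ j))⁻¹ * μ j
        = ((√(μ j))⁻¹ * (√(μ j))⁻¹) * μ j * (e j ⬝ᵥ z) := by ring
      _ = _ := by rw [hsq, inv_mul_cancel₀ (hμ0 j).ne', one_mul]
  · rw [← hpars z, Finset.sum_div]
    refine Finset.sum_le_sum fun j _ => ?_
    rw [smul_dotProduct, smul_eq_mul, mul_pow, sq (√(μ j))⁻¹, hsq, ← div_eq_inv_mul]
    exact div_le_div_of_nonneg_left (sq_nonneg _) hlam (hμl j)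
  · rw [← hpars z, Finset.mul_sum]
    have e1 : z ⬝ᵥ A.mulVec z = ∑ j, μ j * (e j ⬝ᵥ z) ^ 2 := by
      conv_lhs => arg 2; rw [← hexp z]
      rw [Matrix.mulVec_sum, dotProduct_sum]
      refine Finset.sum_congr rfl fun j _ => ?_
      rw [Matrix.mulVec_smul, hmul, dotProduct_smul, dotProduct_smul, dotProduct_comm z]
      simp only [smul_eq_mul]; ring
    rw [e1]
    exact Finset.sum_le_sum fun j _ => mul_le_mul_of_nonneg_right (hμl j) (sq_nonneg _)

theorem dotProduct_self_eq_l2_sq (z : Fin n → ℝ) : z ⬝ᵥ z = l2 z ^ 2 := by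
  rw [l2_sq]; exact Finset.sum_congr rfl fun _ _ => (sq _).symm

/-- The Frobenius norm bounds the operator norm. -/
theorem l2_mulVec_sq_le (B : Matrix (Fin n) (Fin n) ℝ) (v : Fin n → ℝ) :
    l2 (B.mulVec v) ^ 2 ≤ (∑ i, ∑ j, B i j ^ 2) * l2 v ^ 2 := by
  rw [l2_sq, l2_sq, Finset.sum_mul]
  exact Finset.sum_le_sum fun i _ =>
    Finset.sum_mul_sq_le_sq_mul_sq Finset.univ (fun j => B i j) v

theorem abs_dotProduct_le (v w : Fin n → ℝ) : |v ⬝ᵥ w| ≤ l2 v * l2 w := by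
  refine (Finset.abs_sum_le_sum_abs _ _).trans ?_
  simp only [abs_mul]
  exact sum_abs_mul_le v w

end Frame

/-- Cauchy–Schwarz with an indicator weight. -/
theorem sum_ite_mul_le {ι : Type*} [Fintype ι] (p : ι → Prop) [DecidablePred p] (g : ι → ℝ) :
    ∑ i, (if p i then g i else 0) ≤ √(∑ i, if p i then 1 else 0) * √(∑ i, g i ^ 2) := by
  have := Real.sum_mul_le_sqrt_mul_sqrt Finset.univ (fun i => if p i then (1 : ℝ) else 0) g
  simpa [ite_pow] using this

section Network

variable {n m d : ℕ} {ε : ℝ} {x : Fin n → Fin d → ℝ} {y : Fin n → ℝ} {a : Fin m → ℝ}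

/-- The number of pairs of an example and a neuron whose preactivation bound can change its sign
while the weight vectors move by less than `R`. -/
noncomputable def unstableNeurons (R ε : ℝ) (x : Fin n → Fin d → ℝ) (y : Fin n → ℝ)
    (a : Fin m → ℝ) (W : Weights m d) : ℝ :=
  ∑ p : Fin n × Fin m,
    if |rowQ ε (y p.1 * a p.2) (x p.1) (row W p.2)| ≤ 2 * l2 (x p.1) * R then 1 else 0

/-- The number of weights that can change their sign while moving by less than `R`. -/
noncomputable def unstableWeights (R : ℝ) (W : Weights m d) : ℝ :=
  ∑ p : Fin m × Fin d, if |W p| ≤ R then 1 else 0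

theorem abs_rowLin_le {ε s : ℝ} (hε : 0 ≤ ε) (hs : s = 1 ∨ s = -1) {x : Fin d → ℝ}
    (hx : ∀ k, ε ≤ x k) (w v : Fin d → ℝ) : |rowLin ε s x w v| ≤ 2 * (l2 v * l2 x) := by
  have hs1 : |s| = 1 := by rcases hs with h | h <;> simp [h]
  refine (Finset.abs_sum_le_sum_abs _ _).trans ?_
  refine le_trans (Finset.sum_le_sum fun k _ => ?_)
    ((Finset.mul_sum _ _ (2 : ℝ)).symm.le.trans
      (mul_le_mul_of_nonneg_left (sum_abs_mul_le v x) two_pos.le))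
  rw [abs_mul, mul_left_comm]
  refine mul_le_mul_of_nonneg_left ?_ (abs_nonneg _)
  refine (abs_sub _ _).trans ?_
  rw [abs_mul, abs_mul, hs1, one_mul, abs_of_nonneg hε]
  have h1 := mul_le_mul_of_nonneg_left (abs_real_sign_le_one (w k)) hε
  have h2 := le_abs_self (x k)
  have h3 := hx k
  linarith

theorem sum_mul_driftError_le (hε : 0 ≤ ε) (ha : ∀ r, a r = 1 ∨ a r = -1)
    (hx : ∀ i k, ε ≤ x i k) (hy : ∀ i, y i = 1 ∨ y i = -1) {M R : ℝ} (hM : ∀ i, l2 (x i) ≤ M)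
    (W V : Weights m d) {c : Fin n → ℝ} (hc : ∀ i, 0 ≤ c i) :
    ∑ i, c i * driftError R ε a W (x i) (y i) V
      ≤ (1 / √(m : ℝ)) * (4 * M * √(unstableNeurons R ε x y a W)
        + 2 * ε * √n * √(unstableWeights R W)) * l2 c * ‖V‖ := by
  have hVn : √(∑ r, l2 (row V r) ^ 2) = ‖V‖ := by
    rw [← norm_sq_eq_sum_row, Real.sqrt_sq (norm_nonneg _)]
  have hV2 : √(∑ p, |V p| ^ 2) = ‖V‖ := by
    rw [EuclideanSpace.norm_eq]; simp
  have hcn : ∑ i, c i ≤ √n * l2 c := by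
    have := Real.sum_mul_le_sqrt_mul_sqrt Finset.univ (fun _ : Fin n => (1 : ℝ)) c
    simpa [l2] using this
  have hneur : ∑ i, c i * ∑ r, (if |rowQ ε (y i * a r) (x i) (row W r)| ≤ 2 * l2 (x i) * R
      then 2 * |rowLin ε (y i * a r) (x i) (row W r) (row V r)| else 0)
      ≤ 4 * M * (√(unstableNeurons R ε x y a W) * (l2 c * ‖V‖)) := by
    have h1 := sum_ite_mul_le (fun p : Fin n × Fin m =>
      |rowQ ε (y p.1 * a p.2) (x p.1) (row W p.2)| ≤ 2 * l2 (x p.1) * R)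
      fun p => c p.1 * l2 (row V p.2)
    have h2 : √(∑ p : Fin n × Fin m, (c p.1 * l2 (row V p.2)) ^ 2) = l2 c * ‖V‖ := by
      rw [← hVn, l2, ← Real.sqrt_mul (Finset.sum_nonneg fun _ _ => sq_nonneg _),
        Fintype.sum_prod_type, Finset.sum_mul_sum]
      simp only [mul_pow]
    rw [h2] at h1
    rcases Nat.eq_zero_or_pos n with rfl | hn
    · simp [l2]
    have hM0 : 0 ≤ M := (l2_nonneg _).trans (hM ⟨0, hn⟩)
    refine le_trans ?_ (mul_le_mul_of_nonneg_left h1 (by positivity))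
    rw [Fintype.sum_prod_type, Finset.mul_sum]
    refine Finset.sum_le_sum fun i _ => ?_
    rw [Finset.mul_sum, Finset.mul_sum]
    refine Finset.sum_le_sum fun r _ => ?_
    dsimp only
    split_ifs
    · have h3 := abs_rowLin_le hε (mul_eq_one_or (hy i) (ha r)) (hx i) (row W r) (row V r)
      have h4 := mul_le_mul_of_nonneg_left (hM i) (l2_nonneg (row V r))
      have := hc i
      calc c i * (2 * |rowLin ε (y i * a r) (x i) (row W r) (row V r)|)
          ≤ c i * (2 * (2 * (l2 (row V r) * M))) := by gcongr; linarith
        _ = _ := by ring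
    · simp
  have hcoord : ∑ r, ∑ k, (if |row W r k| ≤ R then |row V r k| else 0)
      ≤ √(unstableWeights R W) * ‖V‖ := by
    have h1 := sum_ite_mul_le (fun p : Fin m × Fin d => |W p| ≤ R) fun p => |V p|
    rw [hV2, Fintype.sum_prod_type] at h1
    exact h1
  have hsplit : ∑ i, c i * driftError R ε a W (x i) (y i) V = (1 / √(m : ℝ)) *
      ((∑ i, c i * ∑ r, (if |rowQ ε (y i * a r) (x i) (row W r)| ≤ 2 * l2 (x i) * R
      then 2 * |rowLin ε (y i * a r) (x i) (row W r) (row V r)| else 0))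
      + (2 * ε) * ((∑ i, c i) * ∑ r, ∑ k, (if |row W r k| ≤ R then |row V r k| else 0))) := by
    rw [Finset.sum_mul, Finset.mul_sum, ← Finset.sum_add_distrib, Finset.mul_sum]
    refine Finset.sum_congr rfl fun i _ => ?_
    simp only [driftError, rowError]
    rw [Finset.sum_add_distrib, ← Finset.mul_sum]
    ring
  rw [hsplit, mul_assoc (1 / √(m : ℝ) * _), mul_assoc (1 / √(m : ℝ))]
  refine mul_le_mul_of_nonneg_left ?_ (by positivity)
  have h50 : 0 ≤ ∑ r, ∑ k, (if |row W r k| ≤ R then |row V r k| else 0) := by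
    refine Finset.sum_nonneg fun _ _ => Finset.sum_nonneg fun _ _ => ?_
    split_ifs <;> positivity
  have h5 : (∑ i, c i) * ∑ r, ∑ k, (if |row W r k| ≤ R then |row V r k| else 0)
      ≤ (√n * l2 c) * (√(unstableWeights R W) * ‖V‖) :=
    mul_le_mul hcn hcoord h50 (mul_nonneg (Real.sqrt_nonneg _) (l2_nonneg _))
  have h6 := mul_le_mul_of_nonneg_left h5 (by positivity : 0 ≤ 2 * ε)
  linarith

theorem driftError_self_le (hε : 0 ≤ ε) {M R : ℝ} (hR : 0 ≤ R) (hM : ∀ i, l2 (x i) ≤ M)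
    (W : Weights m d) (i : Fin n) :
    driftError R ε a W (x i) (y i) W
      ≤ (1 / √(m : ℝ)) * (4 * M * R * unstableNeurons R ε x y a W
        + 2 * ε * R * unstableWeights R W) := by
  have hM0 : 0 ≤ M := (l2_nonneg _).trans (hM i)
  unfold driftError
  refine mul_le_mul_of_nonneg_left ?_ (by positivity)
  simp only [rowError, Finset.sum_add_distrib, ← Finset.mul_sum]
  refine add_le_add ?_ ?_
  · unfold unstableNeurons
    rw [Fintype.sum_prod_type]
    have h1 : ∀ r, (if |rowQ ε (y i * a r) (x i) (row W r)| ≤ 2 * l2 (x i) * R then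
        2 * |rowLin ε (y i * a r) (x i) (row W r) (row W r)| else 0)
        ≤ 4 * M * R * (if |rowQ ε (y i * a r) (x i) (row W r)| ≤ 2 * l2 (x i) * R
          then 1 else 0) := by
      intro r
      split_ifs with h
      · rw [rowLin_self]
        have := mul_le_mul_of_nonneg_right (hM i) hR
        linarith
      · simp
    refine (Finset.sum_le_sum fun r _ => h1 r).trans ?_
    rw [← Finset.mul_sum]
    refine mul_le_mul_of_nonneg_left ?_ (mul_nonneg (by positivity) hR)
    exact Finset.single_le_sum (f := fun i => ∑ r, if |rowQ ε (y i * a r) (x i) (row W r)|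
      ≤ 2 * l2 (x i) * R then (1 : ℝ) else 0) (fun _ _ => Finset.sum_nonneg fun _ _ => by
        split_ifs <;> norm_num) (Finset.mem_univ i)
  · unfold unstableWeights
    rw [Fintype.sum_prod_type, mul_assoc (2 * ε), Finset.mul_sum _ _ R]
    refine mul_le_mul_of_nonneg_left (Finset.sum_le_sum fun r _ => ?_) (by positivity)
    rw [Finset.mul_sum]
    refine Finset.sum_le_sum fun k _ => ?_
    dsimp only [row]
    by_cases h : |W (r, k)| ≤ R <;> simp [h]

theorem inner_gradVec_gradVec (W : Weights m d) (i j : Fin n) :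
    inner ℝ (gradVec ε a W (x i) (y i)) (gradVec ε a W (x j) (y j)) = gram ε x y a W i j := by
  rw [PiLp.inner_apply]
  exact Finset.sum_congr rfl fun p _ => by simp [gradVec, mul_comm]

theorem inner_gradVec_sum (W : Weights m d) (i : Fin n) (c : Fin n → ℝ) :
    inner ℝ (gradVec ε a W (x i) (y i)) (∑ j, c j • gradVec ε a W (x j) (y j))
      = (gram ε x y a W).mulVec c i := by
  rw [inner_sum]
  exact Finset.sum_congr rfl fun j _ => by
    rw [inner_smul_right, inner_gradVec_gradVec, mul_comm]

theorem norm_sum_gradVec_sq (W : Weights m d) (c : Fin n → ℝ) :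
    ‖∑ j, c j • gradVec ε a W (x j) (y j)‖ ^ 2 = c ⬝ᵥ (gram ε x y a W).mulVec c := by
  rw [← real_inner_self_eq_norm_sq, sum_inner]
  exact Finset.sum_congr rfl fun i _ => by
    rw [inner_smul_left, inner_gradVec_sum]; rfl

end Network

section Network

variable {n m d : ℕ} {ε : ℝ} {x : Fin n → Fin d → ℝ} {y : Fin n → ℝ} {a : Fin m → ℝ}

/-- The interpolation step: if the Gram matrix `G` is close to `A`, the coefficients
`v = A⁻¹ z`, for `z` the gap between the margins `u` and the target `τ`, move the linearized
margins close to `τ`, at a cost `vᵀ G v` that is bounded. -/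
theorem interpolation_bounds {A G : Matrix (Fin n) (Fin n) ℝ} {f : Fin n → Fin n → ℝ}
    {lam τ : ℝ} (hlam : 0 < lam) (hn : 0 < n)
    (hf1 : ∀ z, A.mulVec (∑ j, (f j ⬝ᵥ z) • f j) = z)
    (hf2 : ∀ z, ∑ j, (f j ⬝ᵥ z) ^ 2 ≤ (z ⬝ᵥ z) / lam)
    (hf3 : ∀ z, lam * (z ⬝ᵥ z) ≤ z ⬝ᵥ A.mulVec z) {N b : Fin n → ℝ} (hτ : 0 ≤ τ)
    (hb : ∀ i, |b i| ≤ τ) (hN : ∑ j, (f j ⬝ᵥ N) ^ 2 ≤ τ ^ 2 * n / lam)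
    (hG : ∑ i, ∑ j, (G - A) i j ^ 2 ≤ lam ^ 2 / (576 * n)) :
    ∃ v : Fin n → ℝ, (∀ i, 7 / 8 * τ ≤ N i - b i + G.mulVec v i) ∧
      v ⬝ᵥ G.mulVec v ≤ 10 * (τ ^ 2 * n / lam) := by
  have hn' : (1 : ℝ) ≤ n := by exact_mod_cast hn
  set z : Fin n → ℝ := (fun _ => τ) - N + b with hz
  set v : Fin n → ℝ := ∑ j, (f j ⬝ᵥ z) • f j with hv
  set X := τ ^ 2 * n / lam with hX
  have hX0 : 0 ≤ X := by positivity
  have hAv : A.mulVec v = z := hf1 z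
  have hτz : ∑ j, (f j ⬝ᵥ fun _ => τ) ^ 2 ≤ X := by
    refine (hf2 _).trans (le_of_eq ?_)
    simp [dotProduct, hX]; ring
  have hbz : ∑ j, (f j ⬝ᵥ b) ^ 2 ≤ X := by
    refine (hf2 _).trans (div_le_div_of_nonneg_right ?_ hlam.le)
    have : b ⬝ᵥ b ≤ ∑ _i : Fin n, τ ^ 2 := Finset.sum_le_sum fun i _ => by
      rw [← sq, ← sq_abs]; exact pow_le_pow_left₀ (abs_nonneg _) (hb i) 2
    refine this.trans (le_of_eq ?_)
    simp [mul_comm]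
  have hzz : ∑ j, (f j ⬝ᵥ z) ^ 2 ≤ 9 * X := by
    have : ∀ j, (f j ⬝ᵥ z) ^ 2
        ≤ 3 * ((f j ⬝ᵥ fun _ => τ) ^ 2 + (f j ⬝ᵥ N) ^ 2 + (f j ⬝ᵥ b) ^ 2) := by
      intro j
      rw [hz, dotProduct_add, dotProduct_sub]
      generalize (f j ⬝ᵥ fun _ => τ) = p
      generalize (f j ⬝ᵥ N) = q
      generalize (f j ⬝ᵥ b) = r
      nlinarith [sq_nonneg (p + q), sq_nonneg (p - r), sq_nonneg (q + r)]
    refine (Finset.sum_le_sum fun j _ => this j).trans ?_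
    rw [← Finset.mul_sum, Finset.sum_add_distrib, Finset.sum_add_distrib]
    linarith
  have hvz : v ⬝ᵥ z = ∑ j, (f j ⬝ᵥ z) ^ 2 := by
    rw [hv, sum_dotProduct]
    exact Finset.sum_congr rfl fun j _ => by rw [smul_dotProduct, smul_eq_mul, sq]
  have hvv : lam * l2 v ^ 2 ≤ 9 * X := by
    have := hf3 v
    rw [hAv, hvz, dotProduct_self_eq_l2_sq] at this
    linarith
  have hE : G.mulVec v = z + (G - A).mulVec v := by
    rw [Matrix.sub_mulVec, hAv]; abel
  have hEsq : l2 ((G - A).mulVec v) ^ 2 ≤ lam ^ 2 / (576 * n) * l2 v ^ 2 :=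
    (l2_mulVec_sq_le _ _).trans (mul_le_mul_of_nonneg_right hG (sq_nonneg _))
  refine ⟨v, fun i => ?_, ?_⟩
  · have h1 : l2 ((G - A).mulVec v) ≤ τ / 8 := by
      refine (pow_le_pow_iff_left₀ (l2_nonneg _) (by positivity) two_ne_zero).1 (hEsq.trans ?_)
      calc lam ^ 2 / (576 * n) * l2 v ^ 2 = lam / (576 * n) * (lam * l2 v ^ 2) := by ring
        _ ≤ lam / (576 * n) * (9 * X) := mul_le_mul_of_nonneg_left hvv (by positivity)
        _ = (τ / 8) ^ 2 := by rw [hX]; field_simp; ring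
    have h2 := abs_le.1 ((abs_apply_le_l2 ((G - A).mulVec v) i).trans h1)
    rw [hE]
    simp only [Pi.add_apply, hz, Pi.sub_apply]
    linarith [h2.1]
  · rw [hE, dotProduct_add, hvz]
    have h1 := (abs_le.1 (abs_dotProduct_le v ((G - A).mulVec v))).2
    have h2 : l2 v * l2 ((G - A).mulVec v) ≤ X := by
      refine (pow_le_pow_iff_left₀ (mul_nonneg (l2_nonneg _) (l2_nonneg _)) hX0 two_ne_zero).1 ?_
      calc (l2 v * l2 ((G - A).mulVec v)) ^ 2
          ≤ l2 v ^ 2 * (lam ^ 2 / (576 * n) * l2 v ^ 2) := by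
            rw [mul_pow]; exact mul_le_mul_of_nonneg_left hEsq (sq_nonneg _)
        _ = (lam * l2 v ^ 2) ^ 2 / (576 * n) := by ring
        _ ≤ (9 * X) ^ 2 / (576 * n) := by
            have : 0 ≤ lam * l2 v ^ 2 := by positivity
            gcongr
        _ ≤ X ^ 2 := by
            rw [div_le_iff₀ (by positivity)]
            nlinarith [sq_nonneg X]
    linarith

/-- The drift error at the initialization is at most `τ / 8` if the numbers of unstable neurons and
weights are at most proportional to `R`; here `sd` and `sm` stand for `√d` and `√m`. -/
theorem drift_arith {sd sm n lam δ τ R ε U₁ U₂ : ℝ} (hsd : 0 < sd) (hsm : 0 < sm) (hn : 1 ≤ n)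
    (hlam : 0 < lam) (hδ : 0 < δ) (hτ : 0 < τ) (hR0 : 0 < R) (hε : 0 ≤ ε) (hεd : ε * sd ≤ 1)
    (hU₁ : U₁ ≤ 144 * (sm ^ 2 * n * R / δ)) (hU₂ : U₂ ≤ 36 * (sm ^ 2 * sd ^ 2 * R / δ))
    (hR : R = 60 * sd * τ * n / (lam * sm)) (hRs : R * (3686400 * sd ^ 2 * n ^ 2) ≤ δ * lam) :
    1 / sm * (4 * sd * R * U₁ + 2 * ε * R * U₂) ≤ τ / 8 := by
  have h1 : 1 / sm * (4 * sd * R * U₁ + 2 * ε * R * U₂)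
      ≤ 1 / sm * (4 * sd * R * (144 * (sm ^ 2 * n * R / δ))
        + 2 * ε * R * (36 * (sm ^ 2 * sd ^ 2 * R / δ))) := by gcongr
  have h2 : 1 / sm * (4 * sd * R * (144 * (sm ^ 2 * n * R / δ))
        + 2 * ε * R * (36 * (sm ^ 2 * sd ^ 2 * R / δ)))
      = sm * sd * R * R / δ * (576 * n + 72 * (ε * sd)) := by
    field_simp
    ring
  have h3 : sm * sd * R * R / δ * (576 * n + 72 * (ε * sd)) ≤ sm * sd * R * R / δ * (648 * n) := by
    refine mul_le_mul_of_nonneg_left ?_ (by positivity)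
    linarith
  have h4 : R * sm * lam = 60 * sd * τ * n := by rw [hR]; field_simp
  have h5 : sm * sd * R * R / δ * (648 * n) * (δ * lam)
      = 38880 / 3686400 * τ * (R * (3686400 * sd ^ 2 * n ^ 2)) := by
    calc sm * sd * R * R / δ * (648 * n) * (δ * lam)
        = (R * sm * lam) * (648 * n * sd * R) * (δ / δ) := by ring
      _ = _ := by rw [h4, div_self hδ.ne']; ring
  have h6 : sm * sd * R * R / δ * (648 * n) ≤ 38880 / 3686400 * τ := by
    refine le_of_mul_le_mul_right ?_ (mul_pos hδ hlam)
    rw [h5]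
    exact mul_le_mul_of_nonneg_left hRs (by positivity)
  linarith

/-- Convergence of training if the Gram matrix is close to a matrix `A` whose least eigenvalue is at
least `lam`, if few neurons and weights are unstable, and if the margins are the difference of a
part `N` that is small in the norm of `A⁻¹` and a bounded part `b`. -/
theorem IsGradientFlow.converges_of_good_init (hε : 0 ≤ ε) (ha : ∀ r, a r = 1 ∨ a r = -1)
    (hx : ∀ i k, ε ≤ x i k) (hy : ∀ i, y i = 1 ∨ y i = -1) (hM : ∀ i, l2 (x i) ≤ √d)
    (hn : 0 < n) (hd : 0 < d) (hm : 0 < m) (hεd : ε * √d ≤ 1)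
    {A : Matrix (Fin n) (Fin n) ℝ} {f : Fin n → Fin n → ℝ} {lam τ R δ : ℝ} (hlam : 0 < lam)
    (hδ : 0 < δ) (hf1 : ∀ z, A.mulVec (∑ j, (f j ⬝ᵥ z) • f j) = z)
    (hf2 : ∀ z, ∑ j, (f j ⬝ᵥ z) ^ 2 ≤ (z ⬝ᵥ z) / lam)
    (hf3 : ∀ z, lam * (z ⬝ᵥ z) ≤ z ⬝ᵥ A.mulVec z) {w₀ : Weights m d} {N b : Fin n → ℝ}
    (hu : ∀ i, marginLower ε a w₀ (x i) (y i) = N i - b i) (hτ : 16 * n ≤ τ)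
    (hb : ∀ i, |b i| ≤ τ) (hN : ∑ j, (f j ⬝ᵥ N) ^ 2 ≤ τ ^ 2 * n / lam)
    (hG : ∑ i, ∑ j, (gram ε x y a w₀ - A) i j ^ 2 ≤ lam ^ 2 / (576 * n))
    (hU1 : unstableNeurons R ε x y a w₀ ≤ 144 * (m * n * R / δ))
    (hU2 : unstableWeights R w₀ ≤ 36 * (m * d * R / δ))
    (hR : R = 60 * √d * τ * n / (lam * √m)) (hRs : R * (3686400 * d * n ^ 2) ≤ δ * lam)
    {W : ℝ → Weights m d} (hW : IsGradientFlow (robustLoss ε x y a) w₀ W) :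
    ∃ T : ℝ, 0 ≤ T ∧ T ≤ 16 * (n + robustLoss ε x y a (W 0)) / lam ∧
      (∀ t, T ≤ t → certifiedError ε x y a (W t) = 0) ∧
      ∀ t, 0 ≤ t → t ≤ T →
        robustLoss ε x y a (W t) ≤ robustLoss ε x y a (W 0)
          * Real.exp (-(lam * t / (16 * (n + robustLoss ε x y a (W 0))))) ∧
        robustLoss ε x y a (W t) ≤ Real.exp (16 * (n + robustLoss ε x y a (W 0)))
          * robustLoss ε x y a (W 0) * Real.exp (-(lam * t / 2)) := by
  have hn' : (1 : ℝ) ≤ n := by exact_mod_cast hn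
  have hd' : (1 : ℝ) ≤ d := by exact_mod_cast hd
  have hm' : (1 : ℝ) ≤ m := by exact_mod_cast hm
  have hτ0 : 0 < τ := by linarith
  have hsd : 0 < √(d : ℝ) := Real.sqrt_pos.2 (by linarith)
  have hsm : 0 < √(m : ℝ) := Real.sqrt_pos.2 (by linarith)
  have hsn : 1 ≤ √(n : ℝ) := Real.one_le_sqrt.2 hn'
  have hsd2 : √(d : ℝ) ^ 2 = d := Real.sq_sqrt (by linarith)
  have hsm2 : √(m : ℝ) ^ 2 = m := Real.sq_sqrt (by linarith)
  have hsn2 : √(n : ℝ) ^ 2 = n := Real.sq_sqrt (by linarith)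
  have hsl2 : √lam ^ 2 = lam := Real.sq_sqrt hlam.le
  have hR0 : 0 < R := by rw [hR]; positivity
  obtain ⟨v, hv1, hv2⟩ := interpolation_bounds hlam hn hf1 hf2 hf3 hτ0.le hb hN hG
  set ΔW : Weights m d := ∑ j, v j • gradVec ε a w₀ (x j) (y j) with hΔW
  have hΔ : ‖ΔW‖ ^ 2 ≤ 10 * (τ ^ 2 * n / lam) := by
    rw [hΔW, norm_sum_gradVec_sq]; exact hv2
  set ρ := √(R / δ) with hρ
  have hρ0 : 0 ≤ ρ := Real.sqrt_nonneg _
  have hρ2 : ρ ^ 2 = R / δ := Real.sq_sqrt (by positivity)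
  have hs1 : √(unstableNeurons R ε x y a w₀) ≤ 12 * √m * √n * ρ := by
    refine Real.sqrt_le_iff.2 ⟨by positivity, hU1.trans (le_of_eq ?_)⟩
    simp only [mul_pow, hsm2, hsn2, hρ2]; ring
  have hs2 : √(unstableWeights R w₀) ≤ 6 * √m * √d * ρ := by
    refine Real.sqrt_le_iff.2 ⟨by positivity, hU2.trans (le_of_eq ?_)⟩
    simp only [mul_pow, hsm2, hsd2, hρ2]; ring
  have hε1 : ε ≤ 1 := by
    have : 1 ≤ √(d : ℝ) := Real.one_le_sqrt.2 hd'
    nlinarith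
  -- The drift error is at most `η` times the norms of the loss weights and of the direction.
  set η := 60 * √(d : ℝ) * √n * ρ with hη
  have hη0 : 0 ≤ η := by positivity
  have hηsq : η ^ 2 * (1024 * n) ≤ lam := by
    rw [hη]
    simp only [mul_pow, hsd2, hsn2, hρ2]
    calc 60 ^ 2 * (d : ℝ) * n * (R / δ) * (1024 * n) = R * (3686400 * d * n ^ 2) / δ := by ring
      _ ≤ δ * lam / δ := by gcongr
      _ = lam := by field_simp
  refine hW.converges hε ha hx hy (M := √d) (R := R) (η := η) (τ := τ) (ΔW := ΔW) hlam hM hsd.le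
    (fun c => ?_) (fun c V hc => ?_) (fun i => ?_) (fun i => ?_) hη0 ?_ ?_ hτ hτ0 ?_
  · rw [norm_sum_gradVec_sq]
    have h1 : c ⬝ᵥ (gram ε x y a w₀).mulVec c
        = c ⬝ᵥ A.mulVec c + c ⬝ᵥ (gram ε x y a w₀ - A).mulVec c := by
      rw [Matrix.sub_mulVec, dotProduct_sub]; ring
    have h2 := (abs_le.1 (abs_dotProduct_le c ((gram ε x y a w₀ - A).mulVec c))).1
    have h3 : l2 ((gram ε x y a w₀ - A).mulVec c) ≤ lam / 4 * l2 c := by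
      refine (pow_le_pow_iff_left₀ (l2_nonneg _) (mul_nonneg (by positivity) (l2_nonneg _))
        two_ne_zero).1 ((l2_mulVec_sq_le _ _).trans ?_)
      rw [mul_pow]
      refine mul_le_mul_of_nonneg_right (hG.trans ?_) (sq_nonneg _)
      have : lam ^ 2 * 1 ≤ lam ^ 2 * n := mul_le_mul_of_nonneg_left hn' (sq_nonneg lam)
      rw [div_le_iff₀ (by positivity)]
      linarith [sq_nonneg lam]
    have h4 := mul_le_mul_of_nonneg_left h3 (l2_nonneg c)
    have h5 := hf3 c
    rw [dotProduct_self_eq_l2_sq] at h5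
    have h6 : l2 c * (lam / 4 * l2 c) = lam * l2 c ^ 2 / 4 := by ring
    rw [← l2_sq, h1]
    linarith
  · refine (sum_mul_driftError_le hε ha hx hy hM w₀ V hc).trans ?_
    refine mul_le_mul_of_nonneg_right (mul_le_mul_of_nonneg_right ?_ (l2_nonneg _)) (norm_nonneg _)
    calc 1 / √(m : ℝ) * (4 * √d * √(unstableNeurons R ε x y a w₀)
          + 2 * ε * √n * √(unstableWeights R w₀))
        ≤ 1 / √(m : ℝ) * (4 * √d * (12 * √m * √n * ρ) + 2 * 1 * √n * (6 * √m * √d * ρ)) := by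
          gcongr
      _ = η := by rw [hη]; field_simp; ring
  · refine (driftError_self_le hε hR0.le hM w₀ i).trans ?_
    refine drift_arith hsd hsm hn' hlam hδ hτ0 hR0 hε hεd ?_ ?_ hR ?_
    · rw [hsm2]; exact hU1
    · rw [hsm2, hsd2]; exact hU2
    · rw [hsd2]; exact hRs
  · rw [margin, hu i, hΔW, inner_gradVec_sum]
    exact hv1 i
  · refine (pow_le_pow_iff_left₀ hη0 (by positivity) two_ne_zero).1 ?_
    have : η ^ 2 * 1 ≤ η ^ 2 * n := mul_le_mul_of_nonneg_left hn' (sq_nonneg η)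
    rw [div_pow, hsl2]
    linarith
  · refine (pow_le_pow_iff_left₀ (mul_nonneg hη0 (norm_nonneg _)) (by positivity) two_ne_zero).1 ?_
    calc (η * ‖ΔW‖) ^ 2 ≤ η ^ 2 * (10 * (τ ^ 2 * n / lam)) := by rw [mul_pow]; gcongr
      _ = (η ^ 2 * (1024 * n)) * (10 / 1024 * τ ^ 2 / lam) := by ring
      _ ≤ lam * (10 / 1024 * τ ^ 2 / lam) := by gcongr
      _ ≤ (τ / 8) ^ 2 := by
          have : lam * (10 / 1024 * τ ^ 2 / lam) = 10 / 1024 * τ ^ 2 := by field_simp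
          rw [this]; linarith [sq_nonneg τ]
  · calc 2 * √(d : ℝ) / √m * (2 * ‖ΔW‖ ^ 2 / τ)
        ≤ 2 * √(d : ℝ) / √m * (2 * (10 * (τ ^ 2 * n / lam)) / τ) := by gcongr
      _ = 40 * (√d * τ * n / (lam * √m)) := by field_simp; ring
      _ < 60 * (√d * τ * n / (lam * √m)) := by
          have : 0 < √d * τ * n / (lam * √m) := by positivity
          linarith
      _ = R := by rw [hR]; ring

end Network

/-! ### The output of a ReLU network and its gradient under the Gaussian law -/

section Rotation

variable {n d : ℕ}

/-- A rotation of the Gaussian space after which the inner products with `n` given vectors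
depend on at most `n` coordinates. -/
theorem exists_rotation (x : Fin n → Fin d → ℝ) :
    ∃ (T : (Fin d → ℝ) → Fin d → ℝ) (p : Fin n → Fin d → ℝ) (J : Finset (Fin d)),
      MeasurePreserving T (gaussianPi (Fin d)) (gaussianPi (Fin d)) ∧ J.card ≤ n ∧
      (∀ z i, ∑ k, T z k * x i k = ∑ j ∈ J, z j * p i j) ∧
      ∀ c : Fin n → ℝ, ∑ j ∈ J, (∑ i, c i * p i j) ^ 2 ≤ ∑ k, (∑ i, c i * x i k) ^ 2 := by
  have hfin : Module.finrank ℝ (EuclideanSpace ℝ (Fin d)) = Fintype.card (Fin d) := by simp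
  -- Gram–Schmidt for the given vectors, padded by zeros or truncated to `d` vectors, is an
  -- orthonormal basis for which the vectors involve only the first `n` basis vectors.
  let g : Fin d → EuclideanSpace ℝ (Fin d) := fun j =>
    if h : (j : ℕ) < n then WithLp.toLp 2 (x ⟨j, h⟩) else 0
  let b : OrthonormalBasis (Fin d) ℝ (EuclideanSpace ℝ (Fin d)) :=
    InnerProductSpace.gramSchmidtOrthonormalBasis hfin g
  let X : Fin n → EuclideanSpace ℝ (Fin d) := fun i => WithLp.toLp 2 (x i)
  let J : Finset (Fin d) := Finset.univ.filter fun j => (j : ℕ) < n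
  have hJ : ∀ i, ∀ j ∉ J, inner ℝ (b j) (X i) = 0 := by
    intro i j hj
    have hj' : n ≤ (j : ℕ) := by simpa [J] using hj
    have hid : (i : ℕ) < d := i.2.trans (hj'.trans_lt j.2)
    have := InnerProductSpace.gramSchmidtOrthonormalBasis_inv_triangular hfin g
      (i := ⟨i, hid⟩) (j := j) (by rw [Fin.lt_def]; exact i.2.trans_le hj')
    simpa [g, X] using this
  have hinner : ∀ (z : Fin d → ℝ) (i : Fin n),
      ∑ k, (∑ j, z j • b j : EuclideanSpace ℝ (Fin d)) k * x i k
        = inner ℝ (∑ j, z j • b j : EuclideanSpace ℝ (Fin d)) (X i) := by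
    intro z i
    rw [PiLp.inner_apply]
    exact Finset.sum_congr rfl fun k _ => by simp [X, mul_comm]
  refine ⟨fun z => (∑ j, z j • b j : EuclideanSpace ℝ (Fin d)).ofLp,
    fun i j => inner ℝ (b j) (X i), J, ⟨?_, ?_⟩, ?_,
    fun z i => ?_, fun c => ?_⟩
  · fun_prop
  · have h1 : (gaussianPi (Fin d)).map (fun z => ∑ j, z j • b j)
        = (gaussianPi (Fin d)).map (WithLp.toLp 2) :=
      (stdGaussian_eq_map_pi_orthonormalBasis b).symm.trans map_pi_eq_stdGaussian.symm
    have h2 := congrArg (Measure.map (WithLp.ofLp : EuclideanSpace ℝ (Fin d) → Fin d → ℝ)) h1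
    rw [Measure.map_map (by fun_prop) (by fun_prop), Measure.map_map (by fun_prop) (by fun_prop)]
      at h2
    exact h2.trans Measure.map_id
  · have : J.card ≤ (Finset.range n).card :=
      Finset.card_le_card_of_injOn (fun j => (j : ℕ)) (fun j hj => by simpa [J] using hj)
        fun _ _ _ _ h => Fin.ext h
    simpa using this
  · rw [hinner, sum_inner]
    simp only [inner_smul_left, conj_trivial]
    refine (Finset.sum_subset (Finset.subset_univ J) fun j _ hj => ?_).symm
    rw [hJ i j hj, mul_zero]
  · have h1 : ∀ j, ∑ i, c i * inner ℝ (b j) (X i) = inner ℝ (b j) (∑ i, c i • X i) := by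
      intro j
      rw [inner_sum]
      exact Finset.sum_congr rfl fun i _ => by rw [inner_smul_right]
    have h2 : ∑ k, (∑ i, c i * x i k) ^ 2 = ‖∑ i, c i • X i‖ ^ 2 := by
      rw [EuclideanSpace.real_norm_sq_eq]
      refine Finset.sum_congr rfl fun k _ => ?_
      simp [X]
    simp only [h1]
    rw [h2, ← b.sum_sq_norm_inner_right]
    simp only [Real.norm_eq_abs, sq_abs]
    exact Finset.sum_le_sum_of_subset_of_nonneg (Finset.subset_univ J) fun _ _ _ => sq_nonneg _

/-- The second moment of a positively homogeneous network is bounded by that of its gradient: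
by homogeneity the network is the inner product of its gradient with the projection of the
weight to the span of the inputs, and the gradient is invariant under scaling of the latter. -/
theorem lintegral_sum_relu_sq_le (hn : 0 < n) (x : Fin n → Fin d → ℝ) (α : Fin n → ℝ) :
    ∫⁻ w, ENNReal.ofReal ((∑ i, α i * relu (∑ k, w k * x i k)) ^ 2) ∂gaussianPi (Fin d)
      ≤ ENNReal.ofReal (8 * n) * ∫⁻ w, ENNReal.ofReal
        (∑ k, (∑ i, α i * (if 0 < ∑ k, w k * x i k then x i k else 0)) ^ 2)
          ∂gaussianPi (Fin d) := by
  obtain ⟨T, p, J, hT, hJn, hT2, hp⟩ := exists_rotation x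
  let q : Fin n → (Fin d → ℝ) → ℝ := fun i z => ∑ j ∈ J, z j * p i j
  let c : (Fin d → ℝ) → Fin n → ℝ := fun z i => if 0 < q i z then α i else 0
  have hqc : ∀ i, Continuous (q i) := fun i => by fun_prop
  have hcm : ∀ i, Measurable fun z => c z i := fun i =>
    Measurable.ite (measurableSet_lt measurable_const (hqc i).measurable) measurable_const
      measurable_const
  let H : (Fin d → ℝ) → ENNReal := fun z => ENNReal.ofReal (∑ k, (∑ i, c z i * x i k) ^ 2)
  have hHm : Measurable H := by
    refine ENNReal.measurable_ofReal.comp (Finset.measurable_sum _ fun k _ => ?_)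
    exact (Finset.measurable_sum _ fun i _ => (hcm i).mul_const _).pow_const 2
  have hreluc : Continuous relu := continuous_relu
  have hL : Measurable fun w : Fin d → ℝ =>
      ENNReal.ofReal ((∑ i, α i * relu (∑ k, w k * x i k)) ^ 2) := by
    refine Measurable.ennreal_ofReal (Continuous.measurable ?_)
    fun_prop
  have hRm : Measurable fun w : Fin d → ℝ => ENNReal.ofReal
      (∑ k, (∑ i, α i * (if 0 < ∑ k, w k * x i k then x i k else 0)) ^ 2) := by
    refine Measurable.ennreal_ofReal (Finset.measurable_sum _ fun k _ => ?_)
    refine (Finset.measurable_sum _ fun i _ => ?_).pow_const 2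
    refine (Measurable.ite (measurableSet_lt measurable_const ?_) measurable_const
      measurable_const).const_mul _
    exact Continuous.measurable (by fun_prop)
  rw [← hT.lintegral_comp hL, ← hT.lintegral_comp hRm]
  have hRH : ∀ z, ENNReal.ofReal
      (∑ k, (∑ i, α i * (if 0 < ∑ k, T z k * x i k then x i k else 0)) ^ 2) = H z := by
    intro z
    simp only [hT2, H, c, q]
    congr 1
    refine Finset.sum_congr rfl fun k _ => ?_
    congr 1
    refine Finset.sum_congr rfl fun i _ => ?_
    split_ifs <;> simp
  simp only [hRH]
  refine le_trans (lintegral_mono fun z => ?_)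
    (lintegral_gaussianPi_sum_sq_mul_le J hn hJn hHm fun z t ht => ?_)
  · have e1 : ∑ i, α i * relu (∑ k, T z k * x i k) = ∑ j ∈ J, z j * ∑ i, c z i * p i j := by
      simp only [hT2, Finset.mul_sum]
      rw [Finset.sum_comm]
      refine Finset.sum_congr rfl fun i _ => ?_
      by_cases h : 0 < q i z
      · have h' : relu (∑ j ∈ J, z j * p i j) = ∑ j ∈ J, z j * p i j := max_eq_left h.le
        rw [h', Finset.mul_sum]
        exact Finset.sum_congr rfl fun j _ => by simp only [c, if_pos h]; ring
      · have h' : relu (∑ j ∈ J, z j * p i j) = 0 := max_eq_right (not_lt.1 h)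
        simp [h', c, if_neg h]
    simp only [H]
    rw [← ENNReal.ofReal_mul (Finset.sum_nonneg fun _ _ => sq_nonneg _), e1]
    refine ENNReal.ofReal_le_ofReal ?_
    exact (Finset.sum_mul_sq_le_sq_mul_sq _ _ _).trans
      (mul_le_mul_of_nonneg_left (hp (c z)) (Finset.sum_nonneg fun _ _ => sq_nonneg _))
  · have hq : ∀ i, q i (fun j => (if j ∈ J then t else 1) * z j) = t * q i z := by
      intro i
      simp only [q, Finset.mul_sum]
      refine Finset.sum_congr rfl fun j hj => ?_
      rw [if_pos hj]; ring
    have hc : c (fun j => (if j ∈ J then t else 1) * z j) = c z := by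
      funext i
      simp only [c, hq, mul_pos_iff_of_pos_left ht]
    simp only [H, hc]

end Rotation

/-! ### The law of one neuron -/

/-- The law of the weights `(a_r, w_r)` of one hidden neuron at the initialization. -/
noncomputable def neuronMeasure (d : ℕ) : Measure (ℝ × (Fin d → ℝ)) :=
  signMeasure.prod (gaussianPi (Fin d))

instance : IsProbabilityMeasure signMeasure := by
  refine ⟨?_⟩
  simp only [signMeasure, Measure.smul_apply, Measure.add_apply, measure_univ, smul_eq_mul]
  rw [one_add_one_eq_two]
  exact ENNReal.inv_mul_cancel two_ne_zero ENNReal.ofNat_ne_top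

instance (d : ℕ) : IsProbabilityMeasure (neuronMeasure d) := by
  unfold neuronMeasure; infer_instance

/-- The weights of the network, grouped by hidden neurons. -/
def neurons {m d : ℕ} (ω : (Fin m → ℝ) × (Fin m × Fin d → ℝ)) (r : Fin m) : ℝ × (Fin d → ℝ) :=
  (ω.1 r, fun k => ω.2 (r, k))

theorem measurePreserving_neurons (m d : ℕ) :
    MeasurePreserving neurons (initMeasure m d) (Measure.pi fun _ : Fin m => neuronMeasure d) := by
  have h1 := (measurePreserving_arrowProdEquivProdArrow ℝ (Fin d → ℝ) (Fin m)
    (fun _ => signMeasure) (fun _ => gaussianPi (Fin d))).symm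
  have h2 : MeasurePreserving (MeasurableEquiv.curry (Fin m) (Fin d) ℝ)
      (Measure.pi fun _ : Fin m × Fin d => gaussianReal 0 1)
      (Measure.pi fun _ : Fin m => gaussianPi (Fin d)) := by
    refine ⟨(MeasurableEquiv.curry (Fin m) (Fin d) ℝ).measurable, ?_⟩
    have := Measure.infinitePi_map_curry (ι := Fin m) (κ := Fin d) (X := ℝ)
      fun _ _ => gaussianReal 0 1
    simp only [Measure.infinitePi_eq_pi] at this
    exact this
  exact h1.comp ((MeasurePreserving.id (Measure.pi fun _ : Fin m => signMeasure)).prod h2)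

/-! ### Moments and probabilities for one neuron -/

section Neuron

variable {n d : ℕ}

theorem ae_signMeasure : ∀ᵐ s ∂signMeasure, s = 1 ∨ s = -1 := by
  unfold signMeasure
  refine Measure.ae_smul_measure ?_ _
  rw [ae_add_measure_iff, ae_dirac_eq, ae_dirac_eq]
  simp

theorem ae_neuronMeasure : ∀ᵐ p ∂neuronMeasure d, p.1 = 1 ∨ p.1 = -1 :=
  (Measure.quasiMeasurePreserving_fst (μ := signMeasure) (ν := gaussianPi (Fin d))).ae
    ae_signMeasure

theorem lintegral_neuronMeasure_le {F : ℝ × (Fin d → ℝ) → ENNReal} (hF : Measurable F)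
    {C : ENNReal} (hC : ∀ s : ℝ, s = 1 ∨ s = -1 → ∫⁻ w, F (s, w) ∂gaussianPi (Fin d) ≤ C) :
    ∫⁻ p, F p ∂neuronMeasure d ≤ C := by
  unfold neuronMeasure
  rw [lintegral_prod _ hF.aemeasurable]
  calc _ ≤ ∫⁻ _, C ∂signMeasure :=
        lintegral_mono_ae (ae_signMeasure.mono fun s hs => hC s hs)
    _ = C := by simp

theorem lintegral_neuronMeasure_snd {F : (Fin d → ℝ) → ENNReal} (hF : Measurable F) :
    ∫⁻ p, F p.2 ∂neuronMeasure d = ∫⁻ w, F w ∂gaussianPi (Fin d) :=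
  (measurePreserving_snd (μ := signMeasure) (ν := gaussianPi (Fin d))).lintegral_comp hF

theorem lintegral_sq_apply (k : Fin d) :
    ∫⁻ w, ENNReal.ofReal (w k ^ 2) ∂gaussianPi (Fin d) = 1 := by
  have h1 : MeasurePreserving (Function.eval k) (gaussianPi (Fin d)) (gaussianReal 0 1) :=
    measurePreserving_eval (μ := fun _ : Fin d => gaussianReal 0 1) k
  have h2 : ∫⁻ t, ENNReal.ofReal (t ^ 2) ∂gaussianReal 0 1 = 1 := by
    have h3 : MemLp (id : ℝ → ℝ) 2 (gaussianReal 0 1) := memLp_id_gaussianReal 2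
    rw [← ofReal_integral_eq_lintegral_ofReal (f := fun t : ℝ => t ^ 2) h3.integrable_sq
      (Eventually.of_forall fun _ => sq_nonneg _)]
    have h4 := variance_id_gaussianReal (μ := 0) (v := 1)
    rw [variance_eq_integral measurable_id.aemeasurable] at h4
    simp only [id, integral_id_gaussianReal, sub_zero] at h4
    simp [h4]
  rw [← h2]
  exact h1.lintegral_comp (f := fun t => ENNReal.ofReal (t ^ 2)) (by fun_prop)

theorem lintegral_sum_abs_sq_le :
    ∫⁻ w, ENNReal.ofReal ((∑ k, |w k|) ^ 2) ∂gaussianPi (Fin d) ≤ ENNReal.ofReal (d ^ 2) := by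
  calc ∫⁻ w, ENNReal.ofReal ((∑ k, |w k|) ^ 2) ∂gaussianPi (Fin d)
      ≤ ∫⁻ w, ENNReal.ofReal d * ∑ k, ENNReal.ofReal (w k ^ 2) ∂gaussianPi (Fin d) := by
        refine lintegral_mono fun w => ?_
        rw [← ENNReal.ofReal_sum_of_nonneg fun _ _ => sq_nonneg _,
          ← ENNReal.ofReal_mul (Nat.cast_nonneg _)]
        refine ENNReal.ofReal_le_ofReal ?_
        have := sq_sum_le_card_mul_sum_sq (s := (Finset.univ : Finset (Fin d)))
          (f := fun k => |w k|)
        simpa using this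
    _ = ENNReal.ofReal (d ^ 2) := by
        rw [lintegral_const_mul _ (by fun_prop), lintegral_finsetSum _ fun k _ => by fun_prop]
        simp only [lintegral_sq_apply]
        simp [sq, ENNReal.ofReal_mul]

theorem lintegral_sum_abs_le :
    ∫⁻ w, ENNReal.ofReal (∑ k, |w k|) ∂gaussianPi (Fin d) ≤ ENNReal.ofReal d := by
  calc ∫⁻ w, ENNReal.ofReal (∑ k, |w k|) ∂gaussianPi (Fin d)
      ≤ ∫⁻ w, ∑ k, ENNReal.ofReal (1 / 2) * (1 + ENNReal.ofReal (w k ^ 2)) ∂gaussianPi (Fin d) := by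
        refine lintegral_mono fun w => ?_
        rw [ENNReal.ofReal_sum_of_nonneg fun _ _ => abs_nonneg _]
        refine Finset.sum_le_sum fun k _ => ?_
        rw [← ENNReal.ofReal_one, ← ENNReal.ofReal_add zero_le_one (sq_nonneg _),
          ← ENNReal.ofReal_mul (by norm_num)]
        refine ENNReal.ofReal_le_ofReal ?_
        nlinarith [sq_nonneg (|w k| - 1), sq_abs (w k)]
    _ = ENNReal.ofReal d := by
        rw [lintegral_finsetSum _ fun k _ => by fun_prop]
        have : ∀ k : Fin d, ∫⁻ w, ENNReal.ofReal (1 / 2) * (1 + ENNReal.ofReal (w k ^ 2))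
            ∂gaussianPi (Fin d) = 1 := by
          intro k
          rw [lintegral_const_mul _ (by fun_prop), lintegral_add_left (by fun_prop),
            lintegral_sq_apply]
          simp only [lintegral_const, measure_univ, mul_one]
          rw [one_add_one_eq_two, ← ENNReal.ofReal_ofNat, ← ENNReal.ofReal_mul (by norm_num)]
          norm_num
        simp only [this]
        simp

/-- Anticoncentration of a preactivation bound, for a perturbation that is small compared to the
input. -/
theorem gaussianPi_abs_rowQ_le {ε s : ℝ} (hε : 0 ≤ ε) (hs : s = 1 ∨ s = -1) {x : Fin d → ℝ}
    (hx : 0 < l2 x) (hεx : ε * √d ≤ l2 x / 2) {θ : ℝ} (hθ : 0 < θ) :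
    gaussianPi (Fin d) {w | |rowQ ε s x w| ≤ θ} ≤ ENNReal.ofReal (12 * θ / l2 x) := by
  set e : Fin d → ℝ := (l2 x)⁻¹ • x with he
  have he2 : ∑ k, e k ^ 2 = 1 := by
    simp only [he, Pi.smul_apply, smul_eq_mul, mul_pow, ← Finset.mul_sum, ← l2_sq]
    rw [← mul_pow, inv_mul_cancel₀ hx.ne', one_pow]
  have he1 : ∑ k, |e k| ≤ √d := by
    have := Real.sum_mul_le_sqrt_mul_sqrt Finset.univ (fun _ : Fin d => (1 : ℝ)) fun k => |e k|
    simpa [he2] using this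
  have hex : ∑ k, e k * x k = l2 x := by
    have : ∑ k, e k * x k = (l2 x)⁻¹ * l2 x ^ 2 := by
      rw [l2_sq, Finset.mul_sum]
      exact Finset.sum_congr rfl fun k _ => by simp [he]; ring
    rw [this, sq, ← mul_assoc, inv_mul_cancel₀ hx.ne', one_mul]
  have hs1 : |s| = 1 := by rcases hs with h | h <;> simp [h]
  have := gaussianPi_abs_le (continuous_rowQ ε s x).measurable he2.le (half_pos hx) hθ
    fun w t ht => by
      have h1 : ∑ k, (w + t • e) k * x k = ∑ k, w k * x k + t * l2 x := by
        rw [← hex, Finset.mul_sum, ← Finset.sum_add_distrib]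
        exact Finset.sum_congr rfl fun k _ => by simp; ring
      have h2 : |(∑ k, |(w + t • e) k|) - (∑ k, |w k|)| ≤ t * √d := by
        rw [← Finset.sum_sub_distrib]
        refine (Finset.abs_sum_le_sum_abs _ _).trans ?_
        refine le_trans (Finset.sum_le_sum fun k _ => abs_abs_sub_abs_le _ _) ?_
        refine le_trans (le_of_eq ?_) (mul_le_mul_of_nonneg_left he1 ht)
        rw [Finset.mul_sum]
        exact Finset.sum_congr rfl fun k _ => by simp [abs_mul, abs_of_nonneg ht]
      have h3 : |s * ε * ((∑ k, |(w + t • e) k|) - (∑ k, |w k|))| ≤ t * (l2 x / 2) := by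
        rw [abs_mul, abs_mul, hs1, one_mul, abs_of_nonneg hε]
        calc ε * |(∑ k, |(w + t • e) k|) - (∑ k, |w k|)| ≤ ε * (t * √d) := by gcongr
          _ = t * (ε * √d) := by ring
          _ ≤ _ := by gcongr
      have h4 := (abs_le.1 h3).2
      simp only [rowQ]
      rw [h1]
      linarith
  refine this.trans (ENNReal.ofReal_le_ofReal (le_of_eq ?_))
  field_simp
  norm_num

theorem gaussianPi_abs_apply_le (k : Fin d) {θ : ℝ} (hθ : 0 < θ) :
    gaussianPi (Fin d) {w | |w k| ≤ θ} ≤ ENNReal.ofReal (6 * θ) := by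
  classical
  have := gaussianPi_abs_le (F := fun w : Fin d → ℝ => w k) (measurable_pi_apply k)
    (e := Pi.single k 1) (by simp [Pi.single_apply]) one_pos hθ fun w t _ => by simp
  simpa using this

/-- The probability that the perturbation changes the activation of a neuron, weighted by the
squared norm of the input. The threshold `ρ` for the `ℓ¹` norm of the weights balances Markov's
inequality with anticoncentration. -/
theorem l2_sq_mul_gaussianPi_le {ε κ ρ : ℝ} (hεκ : ε ≤ κ) (hκ : 0 < κ) (hρ : 0 < ρ)
    {x : Fin d → ℝ} (hx : 0 < l2 x) (hxd : l2 x ≤ √d) :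
    ENNReal.ofReal (l2 x ^ 2) * gaussianPi (Fin d) {w | |∑ k, w k * x k| ≤ ε * ∑ k, |w k|}
      ≤ ENNReal.ofReal (d ^ 2 / ρ + 12 * (κ * ρ * √d)) := by
  have hsub : {w : Fin d → ℝ | |∑ k, w k * x k| ≤ ε * ∑ k, |w k|}
      ⊆ {w | ENNReal.ofReal ρ ≤ ENNReal.ofReal (∑ k, |w k|)} ∪ {w | |rowQ 0 1 x w| ≤ κ * ρ} := by
    intro w hw
    by_cases h : ρ ≤ ∑ k, |w k|
    · exact Or.inl (ENNReal.ofReal_le_ofReal h)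
    · right
      rw [mem_ofPred_eq] at hw ⊢
      have h0 : 0 ≤ ∑ k, |w k| := Finset.sum_nonneg fun _ _ => abs_nonneg _
      simp only [rowQ, mul_zero, zero_mul, sub_zero]
      exact hw.trans (mul_le_mul hεκ (not_le.1 h).le h0 hκ.le)
  have h1 : gaussianPi (Fin d) {w | ENNReal.ofReal ρ ≤ ENNReal.ofReal (∑ k, |w k|)}
      ≤ ENNReal.ofReal (d / ρ) := by
    refine (meas_ge_le_lintegral_div (Measurable.aemeasurable (by fun_prop)) (by simpa using hρ)
      ENNReal.ofReal_ne_top).trans ?_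
    rw [ENNReal.ofReal_div_of_pos hρ]
    exact ENNReal.div_le_div_right lintegral_sum_abs_le _
  have h2 := gaussianPi_abs_rowQ_le (ε := 0) (s := 1) le_rfl (Or.inl rfl) hx (by linarith)
    (mul_pos hκ hρ)
  have hd : (0 : ℝ) ≤ √d := Real.sqrt_nonneg _
  have hl2 : l2 x ^ 2 ≤ d := by
    rw [← Real.sq_sqrt (Nat.cast_nonneg (α := ℝ) d)]
    exact pow_le_pow_left₀ hx.le hxd 2
  calc _ ≤ ENNReal.ofReal (l2 x ^ 2) * (ENNReal.ofReal (d / ρ)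
        + ENNReal.ofReal (12 * (κ * ρ) / l2 x)) := by
        gcongr
        exact (measure_mono hsub).trans ((measure_union_le _ _).trans (add_le_add h1 h2))
    _ = ENNReal.ofReal (l2 x ^ 2 * (d / ρ + 12 * (κ * ρ) / l2 x)) := by
        rw [← ENNReal.ofReal_add (by positivity) (by positivity),
          ← ENNReal.ofReal_mul (by positivity)]
    _ ≤ _ := by
        refine ENNReal.ofReal_le_ofReal ?_
        have e1 : l2 x ^ 2 * (d / ρ + 12 * (κ * ρ) / l2 x)
            = l2 x ^ 2 * (d / ρ) + 12 * (κ * ρ * l2 x) := by field_simp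
        rw [e1]
        have e2 : l2 x ^ 2 * (d / ρ) ≤ d * (d / ρ) := by gcongr
        have e3 : κ * ρ * l2 x ≤ κ * ρ * √d := by gcongr
        have e4 : (d : ℝ) ^ 2 / ρ = d * (d / ρ) := by ring
        rw [e4]; linarith

theorem measurable_real_sign : Measurable Real.sign := by
  unfold Real.sign
  exact Measurable.ite measurableSet_Iio measurable_const
    (Measurable.ite measurableSet_Ioi measurable_const measurable_const)

theorem continuous_rowQ_neuron (ε y : ℝ) (x : Fin d → ℝ) :
    Continuous fun p : ℝ × (Fin d → ℝ) => rowQ ε (y * p.1) x p.2 := by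
  unfold rowQ; fun_prop

theorem measurable_rowGrad (ε y : ℝ) (x : Fin d → ℝ) (k : Fin d) :
    Measurable fun p : ℝ × (Fin d → ℝ) => rowGrad ε (y * p.1) x p.2 k := by
  unfold rowGrad
  refine Measurable.mul (by fun_prop) (Measurable.ite
    (measurableSet_lt measurable_const (continuous_rowQ_neuron ε y x).measurable) ?_
    measurable_const)
  have : Measurable fun p : ℝ × (Fin d → ℝ) => Real.sign (p.2 k) :=
    measurable_real_sign.comp (by fun_prop)
  fun_prop

theorem abs_rowGrad_le {ε s : ℝ} (hε : 0 ≤ ε) (hs : s = 1 ∨ s = -1) {x : Fin d → ℝ}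
    (hx : ∀ k, ε ≤ x k) (hx1 : ∀ k, x k ≤ 1) (w : Fin d → ℝ) (k : Fin d) :
    |rowGrad ε s x w k| ≤ 2 := by
  have hs1 : |s| = 1 := by rcases hs with h | h <;> simp [h]
  unfold rowGrad
  rw [abs_mul, hs1, one_mul]
  split_ifs
  · refine (abs_sub _ _).trans ?_
    rw [abs_mul, abs_mul, hs1, one_mul, abs_of_nonneg hε, abs_of_nonneg (hε.trans (hx k))]
    have := mul_le_mul_of_nonneg_left (abs_real_sign_le_one (w k)) hε
    have := hx k
    have := hx1 k
    linarith
  · simp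

/-- The contribution of one neuron to the Gram matrix, without the factor `1 / m`. -/
noncomputable def neuronGram (ε : ℝ) (x : Fin n → Fin d → ℝ) (y : Fin n → ℝ) (i j : Fin n)
    (p : ℝ × (Fin d → ℝ)) : ℝ :=
  ∑ k, rowGrad ε (y i * p.1) (x i) p.2 k * rowGrad ε (y j * p.1) (x j) p.2 k

theorem measurable_neuronGram (ε : ℝ) (x : Fin n → Fin d → ℝ) (y : Fin n → ℝ) (i j : Fin n) :
    Measurable (neuronGram ε x y i j) :=
  Finset.measurable_sum _ fun k _ => (measurable_rowGrad _ _ _ k).mul (measurable_rowGrad _ _ _ k)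

theorem abs_neuronGram_le {ε : ℝ} (hε : 0 ≤ ε) {x : Fin n → Fin d → ℝ} (hx : ∀ i k, ε ≤ x i k)
    (hx1 : ∀ i k, x i k ≤ 1) {y : Fin n → ℝ} (hy : ∀ i, y i = 1 ∨ y i = -1) (i j : Fin n)
    {p : ℝ × (Fin d → ℝ)} (hp : p.1 = 1 ∨ p.1 = -1) : |neuronGram ε x y i j p| ≤ 4 * d := by
  refine (Finset.abs_sum_le_sum_abs _ _).trans ?_
  calc _ ≤ ∑ _k : Fin d, (2 * 2 : ℝ) := Finset.sum_le_sum fun k _ => by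
        rw [abs_mul]
        exact mul_le_mul (abs_rowGrad_le hε (mul_eq_one_or (hy i) hp) (hx i) (hx1 i) _ k)
          (abs_rowGrad_le hε (mul_eq_one_or (hy j) hp) (hx j) (hx1 j) _ k) (abs_nonneg _) two_pos.le
    _ = 4 * d := by simp; ring

theorem memLp_neuronGram {ε : ℝ} (hε : 0 ≤ ε) {x : Fin n → Fin d → ℝ} (hx : ∀ i k, ε ≤ x i k)
    (hx1 : ∀ i k, x i k ≤ 1) {y : Fin n → ℝ} (hy : ∀ i, y i = 1 ∨ y i = -1) (i j : Fin n)
    (q : ENNReal) : MemLp (neuronGram ε x y i j) q (neuronMeasure d) :=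
  MemLp.of_bound (measurable_neuronGram ε x y i j).aestronglyMeasurable (4 * d)
    (ae_neuronMeasure.mono fun _ hp => abs_neuronGram_le hε hx hx1 hy i j hp)

end Neuron

/-! ### Second moments of the output and the limiting Gram matrix -/

section Moment

variable {n d : ℕ}

/-- The expected contribution of one neuron to the Gram matrix. -/
noncomputable def meanGram (ε : ℝ) (x : Fin n → Fin d → ℝ) (y : Fin n → ℝ) :
    Matrix (Fin n) (Fin n) ℝ :=
  Matrix.of fun i j => ∫ p, neuronGram ε x y i j p ∂neuronMeasure d

theorem isHermitian_meanGram (ε : ℝ) (x : Fin n → Fin d → ℝ) (y : Fin n → ℝ) :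
    (meanGram ε x y).IsHermitian := by
  ext i j
  simp only [Matrix.conjTranspose_apply, meanGram, Matrix.of_apply, star_trivial]
  exact integral_congr_ae (Eventually.of_forall fun p =>
    Finset.sum_congr rfl fun k _ => mul_comm _ _)

theorem sum_sq_sum_rowGrad (ε : ℝ) (x : Fin n → Fin d → ℝ) (y c : Fin n → ℝ)
    (p : ℝ × (Fin d → ℝ)) :
    ∑ k, (∑ i, c i * rowGrad ε (y i * p.1) (x i) p.2 k) ^ 2
      = ∑ i, ∑ j, c i * c j * neuronGram ε x y i j p := by
  simp only [neuronGram, Finset.mul_sum, sq, Finset.sum_mul]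
  rw [Finset.sum_comm]
  refine Finset.sum_congr rfl fun i _ => ?_
  rw [Finset.sum_comm]
  exact Finset.sum_congr rfl fun j _ => Finset.sum_congr rfl fun k _ => by ring

/-- The quadratic form of the limiting Gram matrix is the second moment of the gradient of a
linear combination of the margins. -/
theorem dotProduct_meanGram {ε : ℝ} (hε : 0 ≤ ε) {x : Fin n → Fin d → ℝ}
    (hx : ∀ i k, ε ≤ x i k) (hx1 : ∀ i k, x i k ≤ 1) {y : Fin n → ℝ}
    (hy : ∀ i, y i = 1 ∨ y i = -1) (c : Fin n → ℝ) :
    c ⬝ᵥ (meanGram ε x y).mulVec c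
      = ∫ p, ∑ k, (∑ i, c i * rowGrad ε (y i * p.1) (x i) p.2 k) ^ 2 ∂neuronMeasure d := by
  have hint : ∀ i j, Integrable (fun p => c i * c j * neuronGram ε x y i j p)
      (neuronMeasure d) := fun i j =>
    (memLp_one_iff_integrable.1 (memLp_neuronGram hε hx hx1 hy i j 1)).const_mul _
  simp only [sum_sq_sum_rowGrad]
  rw [integral_finsetSum _ fun i _ => integrable_finsetSum _ fun j _ => hint i j]
  refine Finset.sum_congr rfl fun i _ => ?_
  rw [integral_finsetSum _ fun j _ => hint i j, Matrix.mulVec, dotProduct, Finset.mul_sum]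
  refine Finset.sum_congr rfl fun j _ => ?_
  rw [integral_const_mul]
  simp only [meanGram, Matrix.of_apply]
  ring

theorem ofReal_dotProduct_meanGram {ε : ℝ} (hε : 0 ≤ ε) {x : Fin n → Fin d → ℝ}
    (hx : ∀ i k, ε ≤ x i k) (hx1 : ∀ i k, x i k ≤ 1) {y : Fin n → ℝ}
    (hy : ∀ i, y i = 1 ∨ y i = -1) (c : Fin n → ℝ) :
    ENNReal.ofReal (c ⬝ᵥ (meanGram ε x y).mulVec c) = ∫⁻ p, ENNReal.ofReal
      (∑ k, (∑ i, c i * rowGrad ε (y i * p.1) (x i) p.2 k) ^ 2) ∂neuronMeasure d := by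
  rw [dotProduct_meanGram hε hx hx1 hy]
  refine ofReal_integral_eq_lintegral_ofReal ?_
    (Eventually.of_forall fun p => Finset.sum_nonneg fun _ _ => sq_nonneg _)
  simp only [sum_sq_sum_rowGrad]
  exact integrable_finsetSum _ fun i _ => integrable_finsetSum _ fun j _ =>
    (memLp_one_iff_integrable.1 (memLp_neuronGram hε hx hx1 hy i j 1)).const_mul _

theorem dotProduct_meanGram_nonneg {ε : ℝ} (hε : 0 ≤ ε) {x : Fin n → Fin d → ℝ}
    (hx : ∀ i k, ε ≤ x i k) (hx1 : ∀ i k, x i k ≤ 1) {y : Fin n → ℝ}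
    (hy : ∀ i, y i = 1 ∨ y i = -1) (c : Fin n → ℝ) : 0 ≤ c ⬝ᵥ (meanGram ε x y).mulVec c := by
  rw [dotProduct_meanGram hε hx hx1 hy]
  exact integral_nonneg fun p => Finset.sum_nonneg fun _ _ => sq_nonneg _

/-- The average of the lower and the upper bound of a neuron. -/
noncomputable def midRelu (ε : ℝ) (x w : Fin d → ℝ) : ℝ :=
  (relu (rowQ ε 1 x w) + relu (rowQ ε (-1) x w)) / 2

/-- Half of the distance between the lower and the upper bound of a neuron. -/
noncomputable def gapRelu (ε : ℝ) (x w : Fin d → ℝ) : ℝ :=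
  (relu (rowQ ε (-1) x w) - relu (rowQ ε 1 x w)) / 2

theorem mul_relu_rowQ (ε : ℝ) {s : ℝ} (hs : s = 1 ∨ s = -1) (x w : Fin d → ℝ) :
    s * relu (rowQ ε s x w) = s * midRelu ε x w - gapRelu ε x w := by
  unfold midRelu gapRelu
  rcases hs with rfl | rfl <;> ring

theorem continuous_midRelu (ε : ℝ) (x : Fin d → ℝ) : Continuous (midRelu ε x) := by
  have := continuous_relu
  have := continuous_rowQ ε 1 x
  have := continuous_rowQ ε (-1) x
  unfold midRelu
  fun_prop

theorem abs_relu_rowQ_sub_le {ε s : ℝ} (hε : 0 ≤ ε) (hs : s = 1 ∨ s = -1) (x w : Fin d → ℝ) :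
    |relu (rowQ ε s x w) - relu (∑ k, w k * x k)| ≤ ε * ∑ k, |w k| := by
  refine (abs_relu_sub_le _ _).trans (le_of_eq ?_)
  have hs1 : |s| = 1 := by rcases hs with h | h <;> simp [h]
  have h0 : 0 ≤ ∑ k, |w k| := Finset.sum_nonneg fun _ _ => abs_nonneg _
  rw [rowQ, sub_sub_cancel_left, abs_neg, abs_mul, abs_mul, hs1, abs_of_nonneg hε,
    abs_of_nonneg h0, one_mul]

theorem abs_midRelu_sub_le {ε : ℝ} (hε : 0 ≤ ε) (x w : Fin d → ℝ) :
    |midRelu ε x w - relu (∑ k, w k * x k)| ≤ ε * ∑ k, |w k| := by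
  have h1 := abs_le.1 (abs_relu_rowQ_sub_le hε (Or.inl rfl : (1 : ℝ) = 1 ∨ (1 : ℝ) = -1) x w)
  have h2 := abs_le.1 (abs_relu_rowQ_sub_le hε (Or.inr rfl : (-1 : ℝ) = 1 ∨ (-1 : ℝ) = -1) x w)
  unfold midRelu
  rw [abs_le]
  constructor <;> linarith [h1.1, h1.2, h2.1, h2.2]

theorem abs_gapRelu_le {ε : ℝ} (hε : 0 ≤ ε) (x w : Fin d → ℝ) :
    |gapRelu ε x w| ≤ ε * ∑ k, |w k| := by
  have h1 := abs_le.1 (abs_relu_rowQ_sub_le hε (Or.inl rfl : (1 : ℝ) = 1 ∨ (1 : ℝ) = -1) x w)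
  have h2 := abs_le.1 (abs_relu_rowQ_sub_le hε (Or.inr rfl : (-1 : ℝ) = 1 ∨ (-1 : ℝ) = -1) x w)
  unfold gapRelu
  rw [abs_le]
  constructor <;> linarith [h1.1, h1.2, h2.1, h2.2]

/-- The gradients of the unperturbed and the perturbed neuron differ by at most `ε` in each
coordinate, unless the perturbation can change the activation. -/
theorem activation_sub_sq_le {ε s : ℝ} (hε : 0 ≤ ε) (hs : s = 1 ∨ s = -1) {x : Fin d → ℝ}
    (hx : ∀ k, ε ≤ x k) (w : Fin d → ℝ) (k : Fin d) :
    ((if 0 < ∑ k, w k * x k then x k else 0)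
        - (if 0 < rowQ ε s x w then x k - s * ε * Real.sign (w k) else 0)) ^ 2
      ≤ ε ^ 2 + 4 * x k ^ 2 * (if |∑ k, w k * x k| ≤ ε * ∑ k, |w k| then 1 else 0) := by
  have hs1 : |s| = 1 := by rcases hs with h | h <;> simp [h]
  have h0 : 0 ≤ ∑ k, |w k| := Finset.sum_nonneg fun _ _ => abs_nonneg _
  have hsig : |s * ε * Real.sign (w k)| ≤ ε := by
    rw [abs_mul, abs_mul, hs1, one_mul, abs_of_nonneg hε]
    have := mul_le_mul_of_nonneg_left (abs_real_sign_le_one (w k)) hε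
    linarith
  have hsw : |s * ε * (∑ k, |w k|)| ≤ ε * ∑ k, |w k| := by
    rw [abs_mul, abs_mul, hs1, one_mul, abs_of_nonneg hε, abs_of_nonneg h0]
  have hsig2 : (s * ε * Real.sign (w k)) ^ 2 ≤ ε ^ 2 := by
    rw [← sq_abs]; exact pow_le_pow_left₀ (abs_nonneg _) hsig 2
  have hxk := hx k
  have hx2 := sq_nonneg (x k)
  rw [abs_le] at hsw hsig
  unfold rowQ
  set t := ∑ k, w k * x k
  set z := s * ε * ∑ k, |w k|
  set e := s * ε * Real.sign (w k)
  by_cases h1 : 0 < t <;> by_cases h2 : 0 < t - z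
  · rw [if_pos h1, if_pos h2, sub_sub_cancel]
    have : (0 : ℝ) ≤ if |t| ≤ ε * ∑ k, |w k| then 1 else 0 := by split_ifs <;> norm_num
    have := mul_nonneg (by positivity : 0 ≤ 4 * x k ^ 2) this
    linarith
  · have h3 : |t| ≤ ε * ∑ k, |w k| := by rw [abs_of_pos h1]; linarith
    rw [if_pos h1, if_neg h2, if_pos h3]
    nlinarith [sq_nonneg ε]
  · have h3 : |t| ≤ ε * ∑ k, |w k| := by rw [abs_le]; constructor <;> linarith [hsw.1]
    rw [if_neg h1, if_pos h2, if_pos h3]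
    have h4 : (x k - e) ^ 2 ≤ (2 * x k) ^ 2 := by
      rw [← sq_abs (x k - e)]
      refine pow_le_pow_left₀ (abs_nonneg _) ?_ 2
      rw [abs_le]; constructor <;> linarith [hsig.1, hsig.2]
    nlinarith [sq_nonneg ε]
  · rw [if_neg h1, if_neg h2]
    have : (0 : ℝ) ≤ if |t| ≤ ε * ∑ k, |w k| then 1 else 0 := by split_ifs <;> norm_num
    have := mul_nonneg (by positivity : 0 ≤ 4 * x k ^ 2) this
    nlinarith [sq_nonneg ε]

/-- The gradient of a combination of unperturbed neurons is controlled by the gradient of the same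
combination of margins, up to the changes of activation. -/
theorem sum_sq_gradient_le {ε : ℝ} (hε : 0 ≤ ε) {x : Fin n → Fin d → ℝ} (hx : ∀ i k, ε ≤ x i k)
    {y : Fin n → ℝ} (hy : ∀ i, y i = 1 ∨ y i = -1) (c : Fin n → ℝ) {p : ℝ × (Fin d → ℝ)}
    (hp : p.1 = 1 ∨ p.1 = -1) :
    ∑ k, (∑ i, c i * y i * (if 0 < ∑ k, p.2 k * x i k then x i k else 0)) ^ 2
      ≤ 2 * ∑ k, (∑ i, c i * rowGrad ε (y i * p.1) (x i) p.2 k) ^ 2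
        + 2 * (l2 c ^ 2 * ∑ i, (d * ε ^ 2 + 4 * (l2 (x i) ^ 2 *
          (if |∑ k, p.2 k * x i k| ≤ ε * ∑ k, |p.2 k| then 1 else 0)))) := by
  have hp1 : p.1 * p.1 = 1 := by rcases hp with h | h <;> simp [h]
  have hy2 : ∀ i, y i ^ 2 = 1 := fun i => by rcases hy i with h | h <;> simp [h]
  have hpoint : ∀ k, (∑ i, c i * y i * (if 0 < ∑ k, p.2 k * x i k then x i k else 0)) ^ 2
      ≤ 2 * (∑ i, c i * rowGrad ε (y i * p.1) (x i) p.2 k) ^ 2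
        + 2 * (l2 c ^ 2 * ∑ i, (ε ^ 2 + 4 * x i k ^ 2 *
          (if |∑ k, p.2 k * x i k| ≤ ε * ∑ k, |p.2 k| then 1 else 0))) := by
    intro k
    let e : Fin n → ℝ := fun i => (if 0 < ∑ k, p.2 k * x i k then x i k else 0)
      - (if 0 < rowQ ε (y i * p.1) (x i) p.2
        then x i k - y i * p.1 * ε * Real.sign (p.2 k) else 0)
    have h1 : ∑ i, c i * y i * (if 0 < ∑ k, p.2 k * x i k then x i k else 0)
        = p.1 * ∑ i, c i * rowGrad ε (y i * p.1) (x i) p.2 k + ∑ i, c i * (y i * e i) := by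
      rw [Finset.mul_sum, ← Finset.sum_add_distrib]
      refine Finset.sum_congr rfl fun i _ => ?_
      simp only [rowGrad, e]
      linear_combination (-(c i * y i * (if 0 < rowQ ε (y i * p.1) (x i) p.2
        then x i k - y i * p.1 * ε * Real.sign (p.2 k) else 0))) * hp1
    have h2 : (∑ i, c i * (y i * e i)) ^ 2 ≤ l2 c ^ 2 * ∑ i, (ε ^ 2 + 4 * x i k ^ 2 *
          (if |∑ k, p.2 k * x i k| ≤ ε * ∑ k, |p.2 k| then 1 else 0)) := by
      refine (Finset.sum_mul_sq_le_sq_mul_sq _ _ _).trans ?_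
      rw [← l2_sq]
      refine mul_le_mul_of_nonneg_left (Finset.sum_le_sum fun i _ => ?_) (sq_nonneg _)
      rw [mul_pow, hy2, one_mul]
      exact activation_sub_sq_le hε (mul_eq_one_or (hy i) hp) (hx i) p.2 k
    rw [h1]
    set G := ∑ i, c i * rowGrad ε (y i * p.1) (x i) p.2 k
    set F := ∑ i, c i * (y i * e i)
    have h3 : (p.1 * G) ^ 2 = G ^ 2 := by rw [mul_pow, sq p.1, hp1, one_mul]
    nlinarith [sq_nonneg (p.1 * G - F)]
  refine (Finset.sum_le_sum fun k _ => hpoint k).trans (le_of_eq ?_)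
  rw [Finset.sum_add_distrib, ← Finset.mul_sum, ← Finset.mul_sum, ← Finset.mul_sum,
    Finset.sum_comm]
  congr 4
  funext i
  rw [Finset.sum_add_distrib, ← Finset.sum_mul, ← Finset.mul_sum, ← l2_sq (x i), Finset.sum_const,
    Finset.card_univ, Fintype.card_fin, nsmul_eq_mul, mul_assoc 4]

theorem measurableSet_activation (ε : ℝ) (x : Fin d → ℝ) :
    MeasurableSet {w : Fin d → ℝ | |∑ k, w k * x k| ≤ ε * ∑ k, |w k|} :=
  measurableSet_le (Continuous.measurable (by fun_prop)) (Continuous.measurable (by fun_prop))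

/-- In expectation the perturbation changes the squared gradient by at most `lam ‖c‖²`, up to a
constant, and this is absorbed by the quadratic form of the Gram matrix. -/
theorem lintegral_gradient_le {ε lam : ℝ} (hε : 0 ≤ ε) {x : Fin n → Fin d → ℝ}
    (hx : ∀ i k, ε ≤ x i k) (hx1 : ∀ i k, x i k ≤ 1) (hxpos : ∀ i, 0 < l2 (x i))
    (hxd : ∀ i, l2 (x i) ≤ √d) {y : Fin n → ℝ} (hy : ∀ i, y i = 1 ∨ y i = -1) (hn : 0 < n)
    (hd : 0 < d) (hlam : 0 < lam) (hκ : ε * (d ^ 2 * √d * n ^ 2) ≤ lam ^ 2)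
    (hε2 : n * ε ^ 2 * d ^ 2 ≤ lam) {c : Fin n → ℝ}
    (hc : lam * l2 c ^ 2 ≤ c ⬝ᵥ (meanGram ε x y).mulVec c) :
    ∫⁻ w, ENNReal.ofReal
        (∑ k, (∑ i, c i * y i * (if 0 < ∑ k, w k * x i k then x i k else 0)) ^ 2)
          ∂gaussianPi (Fin d)
      ≤ ENNReal.ofReal (108 * (c ⬝ᵥ (meanGram ε x y).mulVec c)) := by
  have hn' : (1 : ℝ) ≤ n := by exact_mod_cast hn
  have hd' : (1 : ℝ) ≤ d := by exact_mod_cast hd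
  have hsd : 0 < √(d : ℝ) := Real.sqrt_pos.2 (by linarith)
  have hsd2 : √(d : ℝ) ^ 2 = d := Real.sq_sqrt (by linarith)
  set q := c ⬝ᵥ (meanGram ε x y).mulVec c with hq
  have hmeas1 : Measurable fun w : Fin d → ℝ => ENNReal.ofReal
      (∑ k, (∑ i, c i * y i * (if 0 < ∑ k, w k * x i k then x i k else 0)) ^ 2) := by
    refine Measurable.ennreal_ofReal (Finset.measurable_sum _ fun k _ => ?_)
    refine (Finset.measurable_sum _ fun i _ => ?_).pow_const 2
    refine (Measurable.ite (measurableSet_lt measurable_const ?_) measurable_const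
      measurable_const).const_mul _
    exact Continuous.measurable (by fun_prop)
  have hmeas2 : Measurable fun p : ℝ × (Fin d → ℝ) => ENNReal.ofReal
      (2 * ∑ k, (∑ i, c i * rowGrad ε (y i * p.1) (x i) p.2 k) ^ 2) := by
    refine Measurable.ennreal_ofReal ((Finset.measurable_sum _ fun k _ => ?_).const_mul _)
    exact (Finset.measurable_sum _ fun i _ => (measurable_rowGrad _ _ _ k).const_mul _).pow_const 2
  have hmeas3 : ∀ i, Measurable fun w : Fin d → ℝ => ENNReal.ofReal (d * ε ^ 2 + 4 * (l2 (x i) ^ 2 *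
      (if |∑ k, w k * x i k| ≤ ε * ∑ k, |w k| then 1 else 0))) := by
    intro i
    refine Measurable.ennreal_ofReal (Measurable.const_add (Measurable.const_mul
      (Measurable.const_mul ?_ _) _) _)
    exact Measurable.ite (measurableSet_activation ε (x i)) measurable_const measurable_const
  -- With `κ = lam² / (d^{5/2} n²)` and `ρ = d² n / lam` both error terms are `lam / n`.
  have hneur : ∀ i, ∫⁻ w, ENNReal.ofReal (d * ε ^ 2 + 4 * (l2 (x i) ^ 2 *
      (if |∑ k, w k * x i k| ≤ ε * ∑ k, |w k| then 1 else 0))) ∂gaussianPi (Fin d)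
      ≤ ENNReal.ofReal (53 * lam / n) := by
    intro i
    have h1 := l2_sq_mul_gaussianPi_le (ε := ε) (κ := lam ^ 2 / (d ^ 2 * √d * n ^ 2))
      (ρ := d ^ 2 * n / lam) (by rw [le_div_iff₀ (by positivity)]; exact hκ) (by positivity)
      (by positivity) (hxpos i) (hxd i)
    have e1 : (d : ℝ) ^ 2 / (d ^ 2 * n / lam)
        + 12 * (lam ^ 2 / (d ^ 2 * √d * n ^ 2) * (d ^ 2 * n / lam) * √d) = 13 * lam / n := by
      field_simp; norm_num
    rw [e1] at h1
    have h2 : ∀ w : Fin d → ℝ, ENNReal.ofReal (d * ε ^ 2 + 4 * (l2 (x i) ^ 2 *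
        (if |∑ k, w k * x i k| ≤ ε * ∑ k, |w k| then 1 else 0)))
        = ENNReal.ofReal (d * ε ^ 2) + ENNReal.ofReal 4 * (ENNReal.ofReal (l2 (x i) ^ 2) *
          {w : Fin d → ℝ | |∑ k, w k * x i k| ≤ ε * ∑ k, |w k|}.indicator 1 w) := by
      intro w
      have h0 : (0 : ℝ) ≤ if |∑ k, w k * x i k| ≤ ε * ∑ k, |w k| then 1 else 0 := by
        split_ifs <;> norm_num
      rw [ENNReal.ofReal_add (by positivity) (by positivity),
        ENNReal.ofReal_mul (p := 4) (by norm_num),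
        ENNReal.ofReal_mul (p := l2 (x i) ^ 2) (sq_nonneg _)]
      congr 3
      by_cases h : |∑ k, w k * x i k| ≤ ε * ∑ k, |w k| <;> simp [h]
    have hi : Measurable ({w : Fin d → ℝ | |∑ k, w k * x i k| ≤ ε * ∑ k, |w k|}.indicator
        (1 : (Fin d → ℝ) → ENNReal)) :=
      measurable_one.indicator (measurableSet_activation ε (x i))
    simp only [h2]
    rw [lintegral_add_left measurable_const, lintegral_const_mul _ (hi.const_mul _),
      lintegral_const_mul _ hi, lintegral_indicator_one (measurableSet_activation ε (x i)),
      lintegral_const, measure_univ, mul_one]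
    calc _ ≤ ENNReal.ofReal (d * ε ^ 2) + ENNReal.ofReal 4 * ENNReal.ofReal (13 * lam / n) := by
          gcongr
      _ = ENNReal.ofReal (d * ε ^ 2 + 4 * (13 * lam / n)) := by
          rw [ENNReal.ofReal_add (by positivity) (by positivity),
            ENNReal.ofReal_mul (p := 4) (by norm_num)]
      _ ≤ _ := by
          refine ENNReal.ofReal_le_ofReal ?_
          have h3 : d * ε ^ 2 ≤ lam / n := by
            rw [le_div_iff₀ (by positivity)]
            have : n * ε ^ 2 * (d * 1) ≤ n * ε ^ 2 * (d * d) := by gcongr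
            nlinarith
          have h4 : 53 * lam / n = lam / n + 4 * (13 * lam / n) := by ring
          rw [h4]
          linarith
  calc ∫⁻ w, ENNReal.ofReal
        (∑ k, (∑ i, c i * y i * (if 0 < ∑ k, w k * x i k then x i k else 0)) ^ 2)
          ∂gaussianPi (Fin d)
      = ∫⁻ p, ENNReal.ofReal
        (∑ k, (∑ i, c i * y i * (if 0 < ∑ k, p.2 k * x i k then x i k else 0)) ^ 2)
          ∂neuronMeasure d := (lintegral_neuronMeasure_snd hmeas1).symm
    _ ≤ ∫⁻ p, (ENNReal.ofReal (2 * ∑ k, (∑ i, c i * rowGrad ε (y i * p.1) (x i) p.2 k) ^ 2)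
        + ENNReal.ofReal (2 * l2 c ^ 2) * ∑ i, ENNReal.ofReal (d * ε ^ 2 + 4 * (l2 (x i) ^ 2 *
          (if |∑ k, p.2 k * x i k| ≤ ε * ∑ k, |p.2 k| then 1 else 0)))) ∂neuronMeasure d := by
        refine lintegral_mono_ae (ae_neuronMeasure.mono fun p hp => ?_)
        have h0 : ∀ i, 0 ≤ d * ε ^ 2 + 4 * (l2 (x i) ^ 2 *
            (if |∑ k, p.2 k * x i k| ≤ ε * ∑ k, |p.2 k| then 1 else 0)) := by
          intro i
          split_ifs <;> positivity
        rw [← ENNReal.ofReal_sum_of_nonneg fun i _ => h0 i, ← ENNReal.ofReal_mul (by positivity),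
          ← ENNReal.ofReal_add (mul_nonneg two_pos.le (Finset.sum_nonneg fun _ _ => sq_nonneg _))
            (mul_nonneg (by positivity) (Finset.sum_nonneg fun i _ => h0 i))]
        refine ENNReal.ofReal_le_ofReal ((sum_sq_gradient_le hε hx hy c hp).trans (le_of_eq ?_))
        ring
    _ = ENNReal.ofReal 2 * ENNReal.ofReal q + ENNReal.ofReal (2 * l2 c ^ 2) *
        ∑ i, ∫⁻ w, ENNReal.ofReal (d * ε ^ 2 + 4 * (l2 (x i) ^ 2 *
          (if |∑ k, w k * x i k| ≤ ε * ∑ k, |w k| then 1 else 0))) ∂gaussianPi (Fin d) := by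
        have hmeas4 : ∀ i, Measurable fun p : ℝ × (Fin d → ℝ) =>
            ENNReal.ofReal (d * ε ^ 2 + 4 * (l2 (x i) ^ 2 *
              (if |∑ k, p.2 k * x i k| ≤ ε * ∑ k, |p.2 k| then 1 else 0))) := fun i =>
          (hmeas3 i).comp measurable_snd
        rw [lintegral_add_left hmeas2, lintegral_const_mul' _ _ ENNReal.ofReal_ne_top,
          lintegral_finsetSum _ fun i _ => hmeas4 i, hq,
          ofReal_dotProduct_meanGram hε hx hx1 hy, ← lintegral_const_mul']
        · congr 1
          · refine lintegral_congr fun p => ?_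
            rw [ENNReal.ofReal_mul (by norm_num)]
          · congr 1
            exact Finset.sum_congr rfl fun i _ => lintegral_neuronMeasure_snd (hmeas3 i)
        · exact ENNReal.ofReal_ne_top
    _ ≤ ENNReal.ofReal 2 * ENNReal.ofReal q + ENNReal.ofReal (2 * l2 c ^ 2) *
        ∑ _i : Fin n, ENNReal.ofReal (53 * lam / n) := by
        gcongr with i
        exact hneur i
    _ ≤ ENNReal.ofReal (108 * q) := by
        have hq0 : 0 ≤ q := (by positivity : 0 ≤ lam * l2 c ^ 2).trans hc
        rw [← ENNReal.ofReal_sum_of_nonneg fun _ _ => by positivity,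
          ← ENNReal.ofReal_mul (by norm_num),
          ← ENNReal.ofReal_mul (by positivity),
          ← ENNReal.ofReal_add (by positivity) (by positivity)]
        refine ENNReal.ofReal_le_ofReal ?_
        have e1 : ∑ _i : Fin n, 53 * lam / n = 53 * lam := by
          rw [Finset.sum_const, Finset.card_univ, Fintype.card_fin, nsmul_eq_mul]
          field_simp
        rw [e1]
        nlinarith

/-- The second moment of a linear combination of outputs is at most of the order of `n` times the
second moment of its gradient. -/
theorem lintegral_sum_midRelu_sq_le {ε lam : ℝ} (hε : 0 ≤ ε) {x : Fin n → Fin d → ℝ}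
    (hx : ∀ i k, ε ≤ x i k) (hx1 : ∀ i k, x i k ≤ 1) (hxpos : ∀ i, 0 < l2 (x i))
    (hxd : ∀ i, l2 (x i) ≤ √d) {y : Fin n → ℝ} (hy : ∀ i, y i = 1 ∨ y i = -1) (hn : 0 < n)
    (hd : 0 < d) (hlam : 0 < lam) (hκ : ε * (d ^ 2 * √d * n ^ 2) ≤ lam ^ 2)
    (hε2 : n * ε ^ 2 * d ^ 2 ≤ lam) {c : Fin n → ℝ}
    (hc : lam * l2 c ^ 2 ≤ c ⬝ᵥ (meanGram ε x y).mulVec c) :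
    ∫⁻ w, ENNReal.ofReal ((∑ i, c i * y i * midRelu ε (x i) w) ^ 2) ∂gaussianPi (Fin d)
      ≤ ENNReal.ofReal (1730 * n * (c ⬝ᵥ (meanGram ε x y).mulVec c)) := by
  have hn' : (1 : ℝ) ≤ n := by exact_mod_cast hn
  have hgrad := lintegral_gradient_le hε hx hx1 hxpos hxd hy hn hd hlam hκ hε2 hc
  have hrad := lintegral_sum_relu_sq_le hn x fun i => c i * y i
  set q := c ⬝ᵥ (meanGram ε x y).mulVec c with hq
  have hq0 : 0 ≤ q := (by positivity : 0 ≤ lam * l2 c ^ 2).trans hc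
  have hy2 : ∀ i, y i ^ 2 = 1 := fun i => by rcases hy i with h | h <;> simp [h]
  have hpoint : ∀ w : Fin d → ℝ, (∑ i, c i * y i * midRelu ε (x i) w) ^ 2
      ≤ 2 * (∑ i, c i * y i * relu (∑ k, w k * x i k)) ^ 2
        + 2 * (n * ε ^ 2 * l2 c ^ 2) * (∑ k, |w k|) ^ 2 := by
    intro w
    have h1 : ∑ i, c i * y i * midRelu ε (x i) w = ∑ i, c i * y i * relu (∑ k, w k * x i k)
        + ∑ i, c i * (y i * (midRelu ε (x i) w - relu (∑ k, w k * x i k))) := by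
      rw [← Finset.sum_add_distrib]
      exact Finset.sum_congr rfl fun i _ => by ring
    have h2 : (∑ i, c i * (y i * (midRelu ε (x i) w - relu (∑ k, w k * x i k)))) ^ 2
        ≤ l2 c ^ 2 * (n * (ε * ∑ k, |w k|) ^ 2) := by
      refine (Finset.sum_mul_sq_le_sq_mul_sq _ _ _).trans ?_
      rw [← l2_sq]
      refine mul_le_mul_of_nonneg_left ?_ (sq_nonneg _)
      calc _ ≤ ∑ _i : Fin n, (ε * ∑ k, |w k|) ^ 2 := Finset.sum_le_sum fun i _ => by
            rw [mul_pow, hy2, one_mul, ← sq_abs]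
            exact pow_le_pow_left₀ (abs_nonneg _) (abs_midRelu_sub_le hε (x i) w) 2
        _ = _ := by simp
    rw [h1]
    generalize ∑ i, c i * y i * relu (∑ k, w k * x i k) = P at *
    generalize ∑ i, c i * (y i * (midRelu ε (x i) w - relu (∑ k, w k * x i k))) = Q at *
    nlinarith [sq_nonneg (P - Q)]
  have hmeas : Measurable fun w : Fin d → ℝ =>
      ENNReal.ofReal 2 * ENNReal.ofReal ((∑ i, c i * y i * relu (∑ k, w k * x i k)) ^ 2) := by
    have := continuous_relu
    refine Measurable.const_mul (Measurable.ennreal_ofReal (Continuous.measurable ?_)) _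
    fun_prop
  calc ∫⁻ w, ENNReal.ofReal ((∑ i, c i * y i * midRelu ε (x i) w) ^ 2) ∂gaussianPi (Fin d)
      ≤ ∫⁻ w, (ENNReal.ofReal 2 *
          ENNReal.ofReal ((∑ i, c i * y i * relu (∑ k, w k * x i k)) ^ 2)
        + ENNReal.ofReal (2 * (n * ε ^ 2 * l2 c ^ 2)) * ENNReal.ofReal ((∑ k, |w k|) ^ 2))
          ∂gaussianPi (Fin d) := by
        refine lintegral_mono fun w => ?_
        rw [← ENNReal.ofReal_mul (by norm_num), ← ENNReal.ofReal_mul (by positivity),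
          ← ENNReal.ofReal_add (by positivity) (by positivity)]
        exact ENNReal.ofReal_le_ofReal (hpoint w)
    _ ≤ ENNReal.ofReal 2 * (ENNReal.ofReal (8 * n) * ENNReal.ofReal (108 * q))
        + ENNReal.ofReal (2 * (n * ε ^ 2 * l2 c ^ 2)) * ENNReal.ofReal (d ^ 2) := by
        rw [lintegral_add_left hmeas, lintegral_const_mul' _ _ ENNReal.ofReal_ne_top,
          lintegral_const_mul' _ _ ENNReal.ofReal_ne_top]
        gcongr
        · exact hrad.trans (by gcongr)
        · exact lintegral_sum_abs_sq_le
    _ ≤ _ := by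
        rw [← ENNReal.ofReal_mul (by positivity), ← ENNReal.ofReal_mul (by positivity),
          ← ENNReal.ofReal_mul (by positivity),
          ← ENNReal.ofReal_add (by positivity) (by positivity)]
        refine ENNReal.ofReal_le_ofReal ?_
        have h1 : n * ε ^ 2 * d ^ 2 * l2 c ^ 2 ≤ q :=
          (mul_le_mul_of_nonneg_right hε2 (sq_nonneg _)).trans hc
        have h2 : q * 1 ≤ q * n := mul_le_mul_of_nonneg_left hn' hq0
        linarith

end Moment

/-! ### Concentration at the initialization -/

/-- Markov's inequality, with a level that is exceeded with probability at most `δ / 6`. -/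
theorem measure_lt_le_of_lintegral {Ω : Type*} [MeasurableSpace Ω] {μ : Measure Ω} {f : Ω → ℝ}
    (hf : Measurable f) {A δ : ℝ} (hA : 0 ≤ A) (hδ : 0 < δ)
    (h : ∫⁻ ω, ENNReal.ofReal (f ω) ∂μ ≤ ENNReal.ofReal A) :
    μ {ω | 6 / δ * A < f ω} ≤ ENNReal.ofReal (δ / 6) := by
  rcases hA.eq_or_lt with rfl | hA
  · rw [ENNReal.ofReal_zero, nonpos_iff_eq_zero, lintegral_eq_zero_iff hf.ennreal_ofReal] at h
    have h0 : μ {ω | 6 / δ * 0 < f ω} = 0 := by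
      refine measure_mono_null (fun ω hω => ?_) h
      simp only [mul_zero, mem_ofPred_eq] at hω
      simpa using hω
    rw [h0]; exact zero_le
  · have hpos : 0 < 6 / δ * A := by positivity
    calc μ {ω | 6 / δ * A < f ω}
        ≤ μ {ω | ENNReal.ofReal (6 / δ * A) ≤ ENNReal.ofReal (f ω)} :=
          measure_mono fun ω hω => ENNReal.ofReal_le_ofReal (le_of_lt hω)
      _ ≤ (∫⁻ ω, ENNReal.ofReal (f ω) ∂μ) / ENNReal.ofReal (6 / δ * A) :=
          meas_ge_le_lintegral_div hf.ennreal_ofReal.aemeasurable (by simpa using hpos)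
            ENNReal.ofReal_ne_top
      _ ≤ ENNReal.ofReal A / ENNReal.ofReal (6 / δ * A) := ENNReal.div_le_div_right h _
      _ = ENNReal.ofReal (δ / 6) := by
          rw [← ENNReal.ofReal_div_of_pos hpos]
          congr 1
          field_simp

section Neurons

variable {n m d : ℕ}

theorem lintegral_sum_neurons_le {g : ℝ × (Fin d → ℝ) → ℝ} (hg : Measurable g)
    (hg0 : ∀ p, 0 ≤ g p) {A : ℝ}
    (h : ∫⁻ p, ENNReal.ofReal (g p) ∂neuronMeasure d ≤ ENNReal.ofReal A) :
    ∫⁻ η, ENNReal.ofReal (∑ r, g (η r)) ∂(Measure.pi fun _ : Fin m => neuronMeasure d)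
      ≤ ENNReal.ofReal (m * A) := by
  have hr : ∀ r : Fin m, ∫⁻ η, ENNReal.ofReal (g (η r))
      ∂(Measure.pi fun _ : Fin m => neuronMeasure d)
        = ∫⁻ p, ENNReal.ofReal (g p) ∂neuronMeasure d :=
    fun r => (measurePreserving_eval (fun _ : Fin m => neuronMeasure d) r).lintegral_comp
      hg.ennreal_ofReal
  calc _ = ∫⁻ η, ∑ r, ENNReal.ofReal (g (η r))
        ∂(Measure.pi fun _ : Fin m => neuronMeasure d) :=
        lintegral_congr fun η => ENNReal.ofReal_sum_of_nonneg fun _ _ => hg0 _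
    _ = ∑ r : Fin m, ∫⁻ p, ENNReal.ofReal (g p) ∂neuronMeasure d := by
        have hgr : ∀ r : Fin m, Measurable fun η : Fin m → ℝ × (Fin d → ℝ) =>
            ENNReal.ofReal (g (η r)) := fun r =>
          (hg.comp (measurable_pi_apply r)).ennreal_ofReal
        rw [lintegral_finsetSum _ fun r _ => hgr r]
        exact Finset.sum_congr rfl fun r _ => hr r
    _ ≤ ∑ _r : Fin m, ENNReal.ofReal A := Finset.sum_le_sum fun _ _ => h
    _ = _ := by simp [ENNReal.ofReal_mul]

/-- The variance of a sum over the hidden neurons. -/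
theorem lintegral_sum_neurons_sub_sq_le {h : ℝ × (Fin d → ℝ) → ℝ} (hh : Measurable h) {V : ℝ}
    (hV0 : 0 ≤ V)
    (hV : ∫⁻ p, ENNReal.ofReal (h p ^ 2) ∂neuronMeasure d ≤ ENNReal.ofReal V) :
    ∫⁻ η, ENNReal.ofReal ((∑ r, h (η r) - m * ∫ p, h p ∂neuronMeasure d) ^ 2)
      ∂(Measure.pi fun _ : Fin m => neuronMeasure d) ≤ ENNReal.ofReal (m * V) := by
  have hint : Integrable (fun p => h p ^ 2) (neuronMeasure d) := by
    refine ⟨(hh.pow_const 2).aestronglyMeasurable, ?_⟩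
    rw [hasFiniteIntegral_iff_ofReal (Eventually.of_forall fun p => sq_nonneg _)]
    exact hV.trans_lt ENNReal.ofReal_lt_top
  have hL : MemLp h 2 (neuronMeasure d) :=
    (memLp_two_iff_integrable_sq hh.aestronglyMeasurable).2 hint
  have hLr : ∀ r : Fin m, MemLp (fun η : Fin m → ℝ × (Fin d → ℝ) => h (η r)) 2
      (Measure.pi fun _ : Fin m => neuronMeasure d) := fun r =>
    hL.comp_measurePreserving (measurePreserving_eval (fun _ : Fin m => neuronMeasure d) r)
  have hmean : ∀ r : Fin m, ∫ η, h (η r) ∂(Measure.pi fun _ : Fin m => neuronMeasure d)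
      = ∫ p, h p ∂neuronMeasure d := by
    intro r
    have hmp := measurePreserving_eval (fun _ : Fin m => neuronMeasure d) r
    conv_rhs => rw [← hmp.map_eq]
    rw [integral_map hmp.measurable.aemeasurable hh.aestronglyMeasurable]
  have hX : MemLp (∑ r, fun η : Fin m → ℝ × (Fin d → ℝ) => h (η r)) 2
      (Measure.pi fun _ : Fin m => neuronMeasure d) := memLp_finsetSum' _ fun r _ => hLr r
  have hmX : ∫ η, (∑ r, fun η : Fin m → ℝ × (Fin d → ℝ) => h (η r)) η
      ∂(Measure.pi fun _ : Fin m => neuronMeasure d) = m * ∫ p, h p ∂neuronMeasure d := by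
    simp only [Finset.sum_apply]
    rw [integral_finsetSum _ fun r _ => (hLr r).integrable one_le_two]
    simp [hmean]
  have hvar := variance_sum_pi (μ := fun _ : Fin m => neuronMeasure d) (X := fun _ => h)
    fun _ => hL
  have hle : Var[h; neuronMeasure d] ≤ V := by
    refine (variance_le_expectation_sq hh.aestronglyMeasurable).trans ?_
    have : ∫ p, h p ^ 2 ∂neuronMeasure d ≤ V := by
      rw [← ofReal_integral_eq_lintegral_ofReal hint (Eventually.of_forall fun p => sq_nonneg _),
        ENNReal.ofReal_le_ofReal_iff hV0] at hV
      exact hV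
    exact this
  have hev := hX.ofReal_variance_eq
  rw [evariance_eq_lintegral_ofReal, hmX, hvar] at hev
  simp only [Finset.sum_apply] at hev
  rw [← hev]
  refine ENNReal.ofReal_le_ofReal ?_
  simp only [Finset.sum_const, Finset.card_univ, Fintype.card_fin, nsmul_eq_mul]
  exact mul_le_mul_of_nonneg_left hle (Nat.cast_nonneg _)

theorem integral_signMeasure_id : ∫ s, s ∂signMeasure = 0 := by
  unfold signMeasure
  rw [integral_smul_measure, integral_add_measure (integrable_dirac (by simp))
    (integrable_dirac (by simp)), integral_dirac, integral_dirac]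
  simp

theorem neurons_apply_snd (ω : (Fin m → ℝ) × (Fin m × Fin d → ℝ)) (r : Fin m) :
    (neurons ω r).2 = row (WithLp.toLp 2 ω.2 : Weights m d) r := rfl

theorem gram_eq_sum_neuronGram {ε : ℝ} {x : Fin n → Fin d → ℝ} {y : Fin n → ℝ}
    (hy : ∀ i, y i = 1 ∨ y i = -1) {ω : (Fin m → ℝ) × (Fin m × Fin d → ℝ)}
    (hω : ∀ r, ω.1 r = 1 ∨ ω.1 r = -1) (i j : Fin n) :
    gram ε x y ω.1 (WithLp.toLp 2 ω.2 : Weights m d) i j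
      = 1 / m * ∑ r, neuronGram ε x y i j (neurons ω r) := by
  have hm : 1 / √(m : ℝ) * (1 / √(m : ℝ)) = 1 / m := by
    rw [div_mul_div_comm, one_mul, Real.mul_self_sqrt (Nat.cast_nonneg _)]
  simp only [gram, Matrix.of_apply]
  rw [Fintype.sum_prod_type, Finset.mul_sum]
  refine Finset.sum_congr rfl fun r _ => ?_
  rw [neuronGram, Finset.mul_sum]
  refine Finset.sum_congr rfl fun k _ => ?_
  rw [marginGrad_eq ε hω _ _ (hy i), marginGrad_eq ε hω _ _ (hy j), ← hm, neurons_apply_snd]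
  simp only [neurons]
  ring

theorem ae_initMeasure_sign : ∀ᵐ ω ∂initMeasure m d, ∀ r, ω.1 r = 1 ∨ ω.1 r = -1 := by
  refine (measurePreserving_neurons m d).quasiMeasurePreserving.ae (p := fun η =>
    ∀ r, (η r).1 = 1 ∨ (η r).1 = -1) ?_
  exact ae_all_iff.2 fun r => (measurePreserving_eval (fun _ : Fin m => neuronMeasure d)
    r).quasiMeasurePreserving.ae ae_neuronMeasure

/-- For a nonempty hidden layer the expected Gram matrix does not depend on the width. -/
theorem gramInf_eq_meanGram {ε : ℝ} (hε : 0 ≤ ε) {x : Fin n → Fin d → ℝ} (hx : ∀ i k, ε ≤ x i k)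
    (hx1 : ∀ i k, x i k ≤ 1) {y : Fin n → ℝ} (hy : ∀ i, y i = 1 ∨ y i = -1) (hm : 0 < m) :
    gramInf m ε x y = meanGram ε x y := by
  ext i j
  simp only [gramInf, meanGram, Matrix.of_apply]
  have hmp := fun r : Fin m => (measurePreserving_eval (fun _ : Fin m => neuronMeasure d) r).comp
    (measurePreserving_neurons m d)
  have hr : ∀ r : Fin m, ∫ ω, neuronGram ε x y i j (neurons ω r) ∂initMeasure m d
      = ∫ p, neuronGram ε x y i j p ∂neuronMeasure d := by
    intro r
    conv_rhs => rw [← (hmp r).map_eq]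
    rw [integral_map (hmp r).measurable.aemeasurable
      (measurable_neuronGram ε x y i j).aestronglyMeasurable]
    rfl
  have hi : ∀ r : Fin m, Integrable (fun ω => neuronGram ε x y i j (neurons ω r))
      (initMeasure m d) := fun r =>
    (hmp r).integrable_comp_of_integrable
      (memLp_one_iff_integrable.1 (memLp_neuronGram hε hx hx1 hy i j 1))
  rw [integral_congr_ae (ae_initMeasure_sign.mono fun ω hω => gram_eq_sum_neuronGram hy hω i j),
    integral_const_mul, integral_finsetSum _ fun r _ => hi r]
  have hm' : (m : ℝ) ≠ 0 := by positivity
  simp only [hr, Finset.sum_const, Finset.card_univ, Fintype.card_fin, nsmul_eq_mul]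
  field_simp

theorem measurable_ite_abs_le {Ω : Type*} [MeasurableSpace Ω] {F : Ω → ℝ} (hF : Measurable F)
    (θ : ℝ) : Measurable fun p => if |F p| ≤ θ then (1 : ℝ) else 0 :=
  Measurable.ite (measurableSet_le hF.abs measurable_const) measurable_const measurable_const

theorem lintegral_ite_abs_le {Ω : Type*} [MeasurableSpace Ω] {μ : Measure Ω} {F : Ω → ℝ}
    (hF : Measurable F) (θ : ℝ) :
    ∫⁻ p, ENNReal.ofReal (if |F p| ≤ θ then 1 else 0) ∂μ = μ {p | |F p| ≤ θ} := by
  rw [← lintegral_indicator_one (measurableSet_le hF.abs measurable_const)]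
  refine lintegral_congr fun p => ?_
  by_cases h : |F p| ≤ θ <;> simp [h]

theorem lintegral_unstableNeurons_le {ε R : ℝ} (hε : 0 ≤ ε) {x : Fin n → Fin d → ℝ}
    (hxpos : ∀ i, 0 < l2 (x i)) (hεx : ∀ i, ε * √d ≤ l2 (x i) / 2) {y : Fin n → ℝ}
    (hy : ∀ i, y i = 1 ∨ y i = -1) (hR : 0 < R) :
    ∫⁻ p, ENNReal.ofReal (∑ i, if |rowQ ε (y i * p.1) (x i) p.2| ≤ 2 * l2 (x i) * R then 1 else 0)
      ∂neuronMeasure d ≤ ENNReal.ofReal (n * (24 * R)) := by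
  have hF : ∀ i, Measurable fun p : ℝ × (Fin d → ℝ) => rowQ ε (y i * p.1) (x i) p.2 := fun i =>
    (continuous_rowQ_neuron ε (y i) (x i)).measurable
  have h1 : ∀ i, ∫⁻ p : ℝ × (Fin d → ℝ), ENNReal.ofReal
      (if |rowQ ε (y i * p.1) (x i) p.2| ≤ 2 * l2 (x i) * R then 1 else 0) ∂neuronMeasure d
      ≤ ENNReal.ofReal (24 * R) := by
    intro i
    refine lintegral_neuronMeasure_le (measurable_ite_abs_le (hF i) _).ennreal_ofReal fun s hs => ?_
    dsimp only
    rw [lintegral_ite_abs_le (continuous_rowQ _ _ _).measurable]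
    have := hxpos i
    refine (gaussianPi_abs_rowQ_le hε (mul_eq_one_or (hy i) hs) this (hεx i)
      (by positivity)).trans (ENNReal.ofReal_le_ofReal (le_of_eq ?_))
    field_simp
    norm_num
  calc _ = ∫⁻ p : ℝ × (Fin d → ℝ), ∑ i, ENNReal.ofReal
        (if |rowQ ε (y i * p.1) (x i) p.2| ≤ 2 * l2 (x i) * R then 1 else 0) ∂neuronMeasure d :=
        lintegral_congr fun p => ENNReal.ofReal_sum_of_nonneg fun i _ => by
          split_ifs <;> norm_num
    _ ≤ ∑ _i : Fin n, ENNReal.ofReal (24 * R) := by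
        rw [lintegral_finsetSum _ fun i _ => (measurable_ite_abs_le (hF i) _).ennreal_ofReal]
        exact Finset.sum_le_sum fun i _ => h1 i
    _ = _ := by simp [ENNReal.ofReal_mul]

theorem lintegral_unstableWeights_le {R : ℝ} (hR : 0 < R) :
    ∫⁻ p, ENNReal.ofReal (∑ k, if |p.2 k| ≤ R then 1 else 0) ∂neuronMeasure d
      ≤ ENNReal.ofReal (d * (6 * R)) := by
  have hF : ∀ k, Measurable fun p : ℝ × (Fin d → ℝ) => p.2 k := fun k => by fun_prop
  have h1 : ∀ k, ∫⁻ p : ℝ × (Fin d → ℝ), ENNReal.ofReal (if |p.2 k| ≤ R then 1 else 0)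
      ∂neuronMeasure d ≤ ENNReal.ofReal (6 * R) := by
    intro k
    refine lintegral_neuronMeasure_le (measurable_ite_abs_le (hF k) _).ennreal_ofReal fun s hs => ?_
    rw [lintegral_ite_abs_le (measurable_pi_apply k)]
    exact gaussianPi_abs_apply_le k hR
  calc _ = ∫⁻ p : ℝ × (Fin d → ℝ), ∑ k, ENNReal.ofReal (if |p.2 k| ≤ R then 1 else 0)
        ∂neuronMeasure d :=
        lintegral_congr fun p => ENNReal.ofReal_sum_of_nonneg fun i _ => by
          split_ifs <;> norm_num
    _ ≤ ∑ _i : Fin d, ENNReal.ofReal (6 * R) := by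
        rw [lintegral_finsetSum _ fun k _ => (measurable_ite_abs_le (hF k) _).ennreal_ofReal]
        exact Finset.sum_le_sum fun k _ => h1 k
    _ = _ := by simp [ENNReal.ofReal_mul]

/-- The part of the margins that is odd in the second layer; the margins differ from it by the
width of the interval bounds. -/
noncomputable def oddMargin (ε : ℝ) (a : Fin m → ℝ) (W : Weights m d) (x : Fin n → Fin d → ℝ)
    (y : Fin n → ℝ) (i : Fin n) : ℝ :=
  1 / √(m : ℝ) * ∑ r, a r * (y i * midRelu ε (x i) (row W r))

/-- The properties of the initialization that make gradient flow converge; `f` is a basis that is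
orthonormal for the expected Gram matrix. In each bound the factor after `6 / δ` is a bound for
the expectation of the left side. -/
structure GoodInit (R ε δ : ℝ) (x : Fin n → Fin d → ℝ) (y : Fin n → ℝ) (f : Fin n → Fin n → ℝ)
    (a : Fin m → ℝ) (W : Weights m d) : Prop where
  sign : ∀ r, a r = 1 ∨ a r = -1
  neurons_le : unstableNeurons R ε x y a W ≤ 6 / δ * (m * (n * (24 * R)))
  weights_le : unstableWeights R W ≤ 6 / δ * (m * (d * (6 * R)))
  gram_le : ∑ i, ∑ j, (m * (gram ε x y a W - meanGram ε x y) i j) ^ 2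
    ≤ 6 / δ * (n * (n * (m * (4 * d) ^ 2)))
  sum_abs_le : ∑ r, ε * ∑ k, |row W r k| ≤ 6 / δ * (m * (ε * d))
  margin_le : ∑ j, (√m * (f j ⬝ᵥ oddMargin ε a W x y)) ^ 2 ≤ 6 / δ * (n * (m * (1730 * n)))

/-- A bad initialization has probability at most `δ`: the second layer consists of signs almost
surely, and each of the five other conditions fails with probability at most `δ / 6`. -/
theorem initMeasure_not_goodInit_le {ε lam R δ : ℝ} (hε : 0 ≤ ε) {x : Fin n → Fin d → ℝ}
    (hx : ∀ i k, ε ≤ x i k) (hx1 : ∀ i k, x i k ≤ 1) (hxpos : ∀ i, 0 < l2 (x i))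
    (hxd : ∀ i, l2 (x i) ≤ √d) (hεx : ∀ i, ε * √d ≤ l2 (x i) / 2) {y : Fin n → ℝ}
    (hy : ∀ i, y i = 1 ∨ y i = -1) (hn : 0 < n) (hd : 0 < d) (hm : 0 < m) (hlam : 0 < lam)
    (hκ : ε * (d ^ 2 * √d * n ^ 2) ≤ lam ^ 2) (hε2 : n * ε ^ 2 * d ^ 2 ≤ lam) (hR : 0 < R)
    (hδ : 0 < δ) {f : Fin n → Fin n → ℝ} (hf : ∀ j, f j ⬝ᵥ (meanGram ε x y).mulVec (f j) = 1)
    (hfl : ∀ z, lam * (z ⬝ᵥ z) ≤ z ⬝ᵥ (meanGram ε x y).mulVec z) :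
    initMeasure m d {ω | ¬ GoodInit R ε δ x y f ω.1 (WithLp.toLp 2 ω.2 : Weights m d)}
      ≤ ENNReal.ofReal δ := by
  let P : Measure (Fin m → ℝ × (Fin d → ℝ)) := Measure.pi fun _ => neuronMeasure d
  let g₁ : ℝ × (Fin d → ℝ) → ℝ := fun p =>
    ∑ i, if |rowQ ε (y i * p.1) (x i) p.2| ≤ 2 * l2 (x i) * R then 1 else 0
  let g₂ : ℝ × (Fin d → ℝ) → ℝ := fun p => ∑ k, if |p.2 k| ≤ R then 1 else 0
  let g₄ : ℝ × (Fin d → ℝ) → ℝ := fun p => ε * ∑ k, |p.2 k|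
  let h : Fin n → ℝ × (Fin d → ℝ) → ℝ := fun j p =>
    p.1 * ∑ i, f j i * y i * midRelu ε (x i) p.2
  let F₃ : Fin n → Fin n → (Fin m → ℝ × (Fin d → ℝ)) → ℝ := fun i j η =>
    (∑ r, neuronGram ε x y i j (η r) - m * ∫ p, neuronGram ε x y i j p ∂neuronMeasure d) ^ 2
  let F₅ : Fin n → (Fin m → ℝ × (Fin d → ℝ)) → ℝ := fun j η => (∑ r, h j (η r)) ^ 2
  have hsum : ∀ g : ℝ × (Fin d → ℝ) → ℝ, Measurable g →
      Measurable fun η : Fin m → ℝ × (Fin d → ℝ) => ∑ r, g (η r) := fun g hg =>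
    Finset.measurable_sum _ fun r _ => hg.comp (measurable_pi_apply r)
  have hg₁ : Measurable g₁ := Finset.measurable_sum _ fun i _ =>
    measurable_ite_abs_le (continuous_rowQ_neuron ε (y i) (x i)).measurable _
  have hg₂ : Measurable g₂ := Finset.measurable_sum _ fun k _ =>
    measurable_ite_abs_le (by fun_prop) _
  have hg₄ : Measurable g₄ := by simp only [g₄]; fun_prop
  have hh : ∀ j, Measurable (h j) := fun j => by
    have : ∀ i, Measurable fun p : ℝ × (Fin d → ℝ) => midRelu ε (x i) p.2 := fun i =>
      (continuous_midRelu ε (x i)).measurable.comp measurable_snd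
    simp only [h]
    fun_prop
  have hF₃ : ∀ i j, Measurable (F₃ i j) := fun i j =>
    ((hsum _ (measurable_neuronGram ε x y i j)).sub_const _).pow_const 2
  have hF₅ : ∀ j, Measurable (F₅ j) := fun j => (hsum _ (hh j)).pow_const 2
  have b₁ := measure_lt_le_of_lintegral (μ := P) (hsum g₁ hg₁) (by positivity) hδ
    (lintegral_sum_neurons_le (m := m) hg₁ (fun p => Finset.sum_nonneg fun i _ => by
      split_ifs <;> norm_num) (lintegral_unstableNeurons_le hε hxpos hεx hy hR))
  have b₂ := measure_lt_le_of_lintegral (μ := P) (hsum g₂ hg₂) (by positivity) hδ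
    (lintegral_sum_neurons_le (m := m) hg₂ (fun p => Finset.sum_nonneg fun i _ => by
      split_ifs <;> norm_num) (lintegral_unstableWeights_le hR))
  have b₃ : P {η | 6 / δ * (n * (n * (m * (4 * d) ^ 2))) < ∑ i, ∑ j, F₃ i j η}
      ≤ ENNReal.ofReal (δ / 6) := by
    refine measure_lt_le_of_lintegral (Finset.measurable_sum _ fun i _ =>
      Finset.measurable_sum _ fun j _ => hF₃ i j) (by positivity) hδ ?_
    have h1 : ∀ i j, ∫⁻ η, ENNReal.ofReal (F₃ i j η) ∂P ≤ ENNReal.ofReal (m * (4 * d) ^ 2) := by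
      intro i j
      refine lintegral_sum_neurons_sub_sq_le (measurable_neuronGram ε x y i j) (by positivity) ?_
      calc _ ≤ ∫⁻ _, ENNReal.ofReal ((4 * d) ^ 2) ∂neuronMeasure d := by
            refine lintegral_mono_ae (ae_neuronMeasure.mono fun p hp => ENNReal.ofReal_le_ofReal ?_)
            rw [← sq_abs]
            exact pow_le_pow_left₀ (abs_nonneg _) (abs_neuronGram_le hε hx hx1 hy i j hp) 2
        _ = _ := by simp
    calc _ = ∫⁻ η, ∑ i, ∑ j, ENNReal.ofReal (F₃ i j η) ∂P := lintegral_congr fun η => by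
          rw [ENNReal.ofReal_sum_of_nonneg fun i _ => Finset.sum_nonneg fun j _ => sq_nonneg _]
          exact Finset.sum_congr rfl fun i _ => ENNReal.ofReal_sum_of_nonneg fun j _ => sq_nonneg _
      _ = ∑ i, ∑ j, ∫⁻ η, ENNReal.ofReal (F₃ i j η) ∂P := by
          rw [lintegral_finsetSum _ fun i _ => Finset.measurable_sum _ fun j _ =>
            (hF₃ i j).ennreal_ofReal]
          exact Finset.sum_congr rfl fun i _ =>
            lintegral_finsetSum _ fun j _ => (hF₃ i j).ennreal_ofReal
      _ ≤ ∑ _i : Fin n, ∑ _j : Fin n, ENNReal.ofReal (m * (4 * d) ^ 2) :=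
          Finset.sum_le_sum fun i _ => Finset.sum_le_sum fun j _ => h1 i j
      _ = _ := by
          simp only [Finset.sum_const, Finset.card_univ, Fintype.card_fin, nsmul_eq_mul]
          rw [ENNReal.ofReal_mul (p := n) (by positivity),
            ENNReal.ofReal_mul (p := n) (by positivity), ENNReal.ofReal_natCast]
  have b₄ := measure_lt_le_of_lintegral (μ := P) (hsum g₄ hg₄) (A := m * (ε * d)) (by positivity) hδ
    (lintegral_sum_neurons_le (m := m) hg₄ (fun p => mul_nonneg hε
      (Finset.sum_nonneg fun _ _ => abs_nonneg _)) (by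
        simp only [g₄, ENNReal.ofReal_mul hε]
        rw [lintegral_const_mul' _ _ ENNReal.ofReal_ne_top,
          lintegral_neuronMeasure_snd (F := fun w : Fin d → ℝ => ENNReal.ofReal (∑ k, |w k|))
            (by fun_prop)]
        gcongr
        exact lintegral_sum_abs_le))
  have b₅ : P {η | 6 / δ * (n * (m * (1730 * n))) < ∑ j, F₅ j η} ≤ ENNReal.ofReal (δ / 6) := by
    refine measure_lt_le_of_lintegral (Finset.measurable_sum _ fun j _ => hF₅ j)
      (by positivity) hδ ?_
    have h1 : ∀ j, ∫⁻ η, ENNReal.ofReal (F₅ j η) ∂P ≤ ENNReal.ofReal (m * (1730 * n)) := by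
      intro j
      -- The mean vanishes because the sign of the second layer is symmetric.
      have h0 : ∫ p, h j p ∂neuronMeasure d = 0 := by
        have := integral_prod_mul (μ := signMeasure) (ν := gaussianPi (Fin d)) (fun s : ℝ => s)
          fun w => ∑ i, f j i * y i * midRelu ε (x i) w
        rw [integral_signMeasure_id, zero_mul] at this
        exact this
      have h2 := lintegral_sum_neurons_sub_sq_le (m := m) (hh j) (V := 1730 * n) (by positivity) ?_
      · simpa only [h0, mul_zero, sub_zero] using h2
      · have h3 := lintegral_sum_midRelu_sq_le hε hx hx1 hxpos hxd hy hn hd hlam hκ hε2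
          (c := f j) (by rw [← dotProduct_self_eq_l2_sq]; exact hfl (f j))
        rw [hf j, mul_one] at h3
        refine le_trans (le_of_eq ?_) h3
        rw [← lintegral_neuronMeasure_snd]
        · refine lintegral_congr_ae (ae_neuronMeasure.mono fun p hp => ?_)
          have hp2 : p.1 ^ 2 = 1 := by rcases hp with h | h <;> simp [h]
          simp only [h, mul_pow, hp2, one_mul]
        · have := fun i => continuous_midRelu ε (x i)
          exact (Continuous.measurable (by fun_prop)).ennreal_ofReal
    calc _ = ∫⁻ η, ∑ j, ENNReal.ofReal (F₅ j η) ∂P := lintegral_congr fun η =>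
          ENNReal.ofReal_sum_of_nonneg fun j _ => sq_nonneg _
      _ = ∑ j, ∫⁻ η, ENNReal.ofReal (F₅ j η) ∂P :=
          lintegral_finsetSum _ fun j _ => (hF₅ j).ennreal_ofReal
      _ ≤ ∑ _j : Fin n, ENNReal.ofReal (m * (1730 * n)) := Finset.sum_le_sum fun j _ => h1 j
      _ = _ := by
          simp only [Finset.sum_const, Finset.card_univ, Fintype.card_fin, nsmul_eq_mul]
          rw [ENNReal.ofReal_mul (p := n) (by positivity), ENNReal.ofReal_natCast]
  set B₁ := {η : Fin m → ℝ × (Fin d → ℝ) | 6 / δ * (m * (n * (24 * R))) < ∑ r, g₁ (η r)}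
  set B₂ := {η : Fin m → ℝ × (Fin d → ℝ) | 6 / δ * (m * (d * (6 * R))) < ∑ r, g₂ (η r)}
  set B₃ := {η | 6 / δ * (n * (n * (m * (4 * d) ^ 2))) < ∑ i, ∑ j, F₃ i j η}
  set B₄ := {η : Fin m → ℝ × (Fin d → ℝ) | 6 / δ * (m * (ε * d)) < ∑ r, g₄ (η r)}
  set B₅ := {η | 6 / δ * (n * (m * (1730 * n))) < ∑ j, F₅ j η}
  have hm' : (0 : ℝ) < m := by exact_mod_cast hm
  have hsm : √(m : ℝ) ≠ 0 := (Real.sqrt_pos.2 hm').ne'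
  have hsub : {ω | ¬ GoodInit R ε δ x y f ω.1 (WithLp.toLp 2 ω.2 : Weights m d)}
      ⊆ {ω | ¬ ∀ r, ω.1 r = 1 ∨ ω.1 r = -1}
        ∪ neurons ⁻¹' (B₁ ∪ (B₂ ∪ (B₃ ∪ (B₄ ∪ B₅)))) := by
    intro ω hω
    by_contra hcon
    simp only [mem_union, mem_preimage, not_or] at hcon
    obtain ⟨hs, c₁, c₂, c₃, c₄, c₅⟩ := hcon
    rw [mem_ofPred_eq, not_not] at hs
    simp only [B₁, B₂, B₃, B₄, B₅, mem_ofPred_eq, not_lt] at c₁ c₂ c₃ c₄ c₅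
    refine hω ⟨hs, ?_, ?_, ?_, ?_, ?_⟩
    · refine le_trans (le_of_eq ?_) c₁
      rw [unstableNeurons, Fintype.sum_prod_type, Finset.sum_comm]
      rfl
    · refine le_trans (le_of_eq ?_) c₂
      rw [unstableWeights, Fintype.sum_prod_type]
      rfl
    · refine le_trans (le_of_eq ?_) c₃
      refine Finset.sum_congr rfl fun i _ => Finset.sum_congr rfl fun j _ => ?_
      simp only [F₃]
      rw [Matrix.sub_apply, gram_eq_sum_neuronGram hy hs]
      simp only [meanGram, Matrix.of_apply]
      congr 1
      field_simp
    · exact c₄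
    · refine le_trans (le_of_eq ?_) c₅
      refine Finset.sum_congr rfl fun j _ => ?_
      simp only [F₅, h, oddMargin, dotProduct]
      congr 1
      simp only [Finset.mul_sum]
      rw [Finset.sum_comm]
      refine Finset.sum_congr rfl fun r _ => Finset.sum_congr rfl fun i _ => ?_
      rw [neurons_apply_snd]
      simp only [neurons]
      field_simp
  calc _ ≤ initMeasure m d {ω | ¬ ∀ r, ω.1 r = 1 ∨ ω.1 r = -1}
        + initMeasure m d (neurons ⁻¹' (B₁ ∪ (B₂ ∪ (B₃ ∪ (B₄ ∪ B₅))))) :=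
        (measure_mono hsub).trans (measure_union_le _ _)
    _ ≤ 0 + P (B₁ ∪ (B₂ ∪ (B₃ ∪ (B₄ ∪ B₅)))) := by
        refine add_le_add (le_of_eq ae_initMeasure_sign) ?_
        have hmp := measurePreserving_neurons m d
        refine (Measure.le_map_apply hmp.measurable.aemeasurable _).trans (le_of_eq ?_)
        rw [hmp.map_eq]
    _ ≤ ENNReal.ofReal (δ / 6) + (ENNReal.ofReal (δ / 6) + (ENNReal.ofReal (δ / 6)
        + (ENNReal.ofReal (δ / 6) + ENNReal.ofReal (δ / 6)))) := by
        rw [zero_add]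
        exact (measure_union_le _ _).trans (add_le_add b₁ ((measure_union_le _ _).trans
          (add_le_add b₂ ((measure_union_le _ _).trans (add_le_add b₃
            ((measure_union_le _ _).trans (add_le_add b₄ b₅)))))))
    _ ≤ ENNReal.ofReal δ := by
        simp only [← ENNReal.ofReal_add (by positivity : 0 ≤ δ / 6) (by positivity : 0 ≤ δ / 6),
          ← ENNReal.ofReal_add (by positivity : 0 ≤ δ / 6) (by positivity : 0 ≤ δ / 6 + δ / 6),
          ← ENNReal.ofReal_add (by positivity : 0 ≤ δ / 6)
            (by positivity : 0 ≤ δ / 6 + (δ / 6 + δ / 6)),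
          ← ENNReal.ofReal_add (by positivity : 0 ≤ δ / 6)
            (by positivity : 0 ≤ δ / 6 + (δ / 6 + (δ / 6 + δ / 6)))]
        exact ENNReal.ofReal_le_ofReal (by linarith)

end Neurons

/-! ### Parameters -/

/-- The width makes the required displacement `R` of the weights small: the three summands of
the target margin `τ` are compared separately. Here and below `sd` and `sm` stand for `√d` and
`√m`. -/
theorem displacement_bound {d sd sm n δ lam ε B : ℝ} (hd : 0 < d) (hsd : 0 < sd)
    (hn : 1 ≤ n) (hδ : 0 < δ) (hδ1 : δ ≤ 1) (hlam : 0 < lam) (hB : 0 < B)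
    (hsm : 0 < sm) (h1 : 18 * B * (ε * (d ^ 2 * sd * n ^ 3)) ≤ δ ^ 2 * lam ^ 2)
    (h2 : 400 * B * (d * sd * n ^ 4 * max 1 (δ * lam)) ≤ sm * (δ ^ 2 * lam ^ 2)) :
    B * (d * sd * n ^ 3) * (16 * n + √(10380 * (n * lam / δ)) + 6 * ε * sm * d / δ)
      ≤ δ * lam ^ 2 * sm := by
  have hx : 0 < δ * lam := by positivity
  have e1 : B * (d * sd * n ^ 3) * (16 * n) ≤ δ * lam ^ 2 * sm / 3 := by
    have k1 : d * sd * n ^ 4 * 1 ≤ d * sd * n ^ 4 * max 1 (δ * lam) := by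
      gcongr; exact le_max_left _ _
    have k2 : sm * (δ ^ 2 * lam ^ 2) ≤ δ * lam ^ 2 * sm := by
      have : δ * (δ * lam ^ 2 * sm) ≤ 1 * (δ * lam ^ 2 * sm) := by gcongr
      linarith
    have k3 := mul_le_mul_of_nonneg_left k1 hB.le
    have k4 : 0 ≤ B * (d * sd * n ^ 4) := by positivity
    have k5 : B * (d * sd * n ^ 3) * (16 * n) = 16 * (B * (d * sd * n ^ 4)) := by ring
    rw [k5]; linarith
  have e2 : B * (d * sd * n ^ 3) * √(10380 * (n * lam / δ)) ≤ δ * lam ^ 2 * sm / 3 := by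
    refine (pow_le_pow_iff_left₀ (by positivity) (by positivity) two_ne_zero).1 ?_
    have hr : √(10380 * (n * lam / δ)) ^ 2 = 10380 * (n * lam / δ) :=
      Real.sq_sqrt (by positivity)
    have k1 : (400 * B * (d * sd * n ^ 4)) ^ 2 * (δ * lam) ≤ (sm * (δ ^ 2 * lam ^ 2)) ^ 2 := by
      have k2 := pow_le_pow_left₀ (by positivity) h2 2
      refine le_trans ?_ k2
      have k3 : δ * lam ≤ max 1 (δ * lam) ^ 2 := by
        have := le_max_left 1 (δ * lam)
        have := le_max_right 1 (δ * lam)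
        nlinarith
      calc (400 * B * (d * sd * n ^ 4)) ^ 2 * (δ * lam)
          ≤ (400 * B * (d * sd * n ^ 4)) ^ 2 * max 1 (δ * lam) ^ 2 := by gcongr
        _ = _ := by ring
    have k4 : (B * (d * sd * n ^ 3)) ^ 2 * n ≤ (B * (d * sd * n ^ 4)) ^ 2 := by
      have : (B * (d * sd * n ^ 3)) ^ 2 * n * 1 ≤ (B * (d * sd * n ^ 3)) ^ 2 * n * n := by gcongr
      linarith
    have k5 : (B * (d * sd * n ^ 4)) ^ 2 * 160000 ≤ sm ^ 2 * (δ ^ 3 * lam ^ 3) := by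
      refine le_of_mul_le_mul_right ?_ hx
      linarith
    rw [mul_pow, hr, ← sub_nonneg]
    have k6 : (δ * lam ^ 2 * sm / 3) ^ 2 - (B * (d * sd * n ^ 3)) ^ 2 * (10380 * (n * lam / δ))
        = (lam / δ) * (sm ^ 2 * (δ ^ 3 * lam ^ 3) / 9
          - 10380 * ((B * (d * sd * n ^ 3)) ^ 2 * n)) := by field_simp; ring
    rw [k6]
    refine mul_nonneg (by positivity) ?_
    have : 0 ≤ (B * (d * sd * n ^ 4)) ^ 2 := sq_nonneg _
    linarith
  have e3 : B * (d * sd * n ^ 3) * (6 * ε * sm * d / δ) ≤ δ * lam ^ 2 * sm / 3 := by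
    have k1 := mul_le_mul_of_nonneg_right h1 (by positivity : 0 ≤ sm / δ)
    have k2 : δ ^ 2 * lam ^ 2 * (sm / δ) = δ * lam ^ 2 * sm := by field_simp
    have k3 : B * (d * sd * n ^ 3) * (6 * ε * sm * d / δ)
        = 18 * B * (ε * (d ^ 2 * sd * n ^ 3)) * (sm / δ) / 3 := by ring
    rw [k3]; linarith
  linarith

/-- The width makes the fluctuations of the Gram matrix small. -/
theorem gram_fluctuation_bound {d sd sm n δ lam S : ℝ} (hd : 1 ≤ d) (hsd : 0 < sd)
    (hsd2 : sd ^ 2 = d) (hn : 1 ≤ n) (hδ : 0 < δ) (hδ1 : δ ≤ 1) (hlam : 0 < lam) (hS : 55296 ≤ S)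
    (h2 : S * (d * sd * n ^ 4 * max 1 (δ * lam)) ≤ sm * (δ ^ 2 * lam ^ 2)) :
    55296 * (n ^ 3 * d ^ 2) ≤ δ * lam ^ 2 * sm ^ 2 := by
  have hx : 0 < δ * lam := by positivity
  have k1 : S * (d * sd * n ^ 4) ≤ sm * (δ * lam) := by
    refine le_of_mul_le_mul_right ?_ hx
    have : d * sd * n ^ 4 * (δ * lam) ≤ d * sd * n ^ 4 * max 1 (δ * lam) := by
      gcongr; exact le_max_right _ _
    have := mul_le_mul_of_nonneg_left this (by linarith : 0 ≤ S)
    linarith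
  have hS0 : 0 ≤ S := by linarith
  have k2 := pow_le_pow_left₀ (by positivity) k1 2
  have k3 : 55296 * (n ^ 3 * d ^ 2) ≤ (S * (d * sd * n ^ 4)) ^ 2 := by
    calc 55296 * (n ^ 3 * d ^ 2) ≤ S * (n ^ 3 * d ^ 2) := by gcongr
      _ ≤ S ^ 2 * (n ^ 8 * d ^ 3) := by
          have : n ^ 3 ≤ n ^ 8 := pow_le_pow_right₀ hn (by norm_num)
          have : d ^ 2 ≤ d ^ 3 := pow_le_pow_right₀ hd (by norm_num)
          have : S ≤ S ^ 2 := by nlinarith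
          gcongr
      _ = (S * (d * sd * n ^ 4)) ^ 2 := by rw [← hsd2]; ring
  have k4 : (sm * (δ * lam)) ^ 2 ≤ δ * lam ^ 2 * sm ^ 2 := by
    have : δ * (δ * lam ^ 2 * sm ^ 2) ≤ 1 * (δ * lam ^ 2 * sm ^ 2) := by gcongr
    linarith
  linarith

/-- The perturbation is small compared to the least eigenvalue; the trivial bound `lam ≤ 4 * d` for
the latter bounds it in terms of the dimension as well. -/
theorem perturbation_bounds {d sd n δ lam ε C₁ : ℝ} (hd : 1 ≤ d) (hsd : 0 < sd)
    (hsd2 : sd ^ 2 = d) (hn : 1 ≤ n) (hδ : 0 < δ) (hδ1 : δ ≤ 1) (hlam : 0 < lam) (hε : 0 ≤ ε)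
    (hC : 0 < C₁) (hC1 : C₁ ≤ 1 / 16) (hlamd : lam ≤ 4 * d)
    (h1 : ε * (d ^ 2 * sd * n ^ 3) ≤ C₁ * (δ ^ 2 * lam ^ 2)) :
    ε * (d ^ 2 * sd * n ^ 2) ≤ lam ^ 2 ∧ n * ε ^ 2 * d ^ 2 ≤ lam ∧ ε * sd ≤ 16 * C₁ := by
  have hn23 : n ^ 2 ≤ n ^ 3 := pow_le_pow_right₀ hn (by norm_num)
  have h2 : ε * (d ^ 2 * sd * n ^ 3) ≤ C₁ * lam ^ 2 := by
    have : δ ^ 2 * lam ^ 2 ≤ 1 * lam ^ 2 := by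
      have : δ ^ 2 ≤ 1 := pow_le_one₀ hδ.le hδ1
      gcongr
    have := mul_le_mul_of_nonneg_left this hC.le
    linarith
  have hd0 : 0 < d := by linarith
  refine ⟨?_, ?_, ?_⟩
  · calc ε * (d ^ 2 * sd * n ^ 2) ≤ ε * (d ^ 2 * sd * n ^ 3) := by gcongr
      _ ≤ C₁ * lam ^ 2 := h2
      _ ≤ 1 * lam ^ 2 := by gcongr; linarith
      _ = lam ^ 2 := one_mul _
  · have k1 := pow_le_pow_left₀ (by positivity) h2 2
    have k2 : lam ^ 3 ≤ (4 * d) ^ 3 := pow_le_pow_left₀ hlam.le hlamd 3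
    have k3 : C₁ ^ 2 ≤ (1 / 16) ^ 2 := pow_le_pow_left₀ hC.le hC1 2
    have k4 : n * 1 ≤ n * n ^ 5 := by
      gcongr; exact one_le_pow₀ hn
    refine le_of_mul_le_mul_right ?_ (by positivity : 0 < d ^ 3)
    calc n * ε ^ 2 * d ^ 2 * d ^ 3 = (n * 1) * (ε ^ 2 * d ^ 5) := by ring
      _ ≤ (n * n ^ 5) * (ε ^ 2 * d ^ 5) := by gcongr
      _ = (ε * (d ^ 2 * sd * n ^ 3)) ^ 2 := by
          have : (ε * (d ^ 2 * sd * n ^ 3)) ^ 2 = ε ^ 2 * d ^ 4 * n ^ 6 * sd ^ 2 := by ring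
          rw [this, hsd2]; ring
      _ ≤ (C₁ * lam ^ 2) ^ 2 := k1
      _ = C₁ ^ 2 * lam * lam ^ 3 := by ring
      _ ≤ (1 / 16) ^ 2 * lam * (4 * d) ^ 3 := by gcongr
      _ ≤ lam * d ^ 3 := by
          have : 0 < lam * d ^ 3 := by positivity
          linarith
  · refine le_of_mul_le_mul_right ?_ (by positivity : 0 < d ^ 2)
    have k1 : lam ^ 2 ≤ (4 * d) ^ 2 := pow_le_pow_left₀ hlam.le hlamd 2
    have k2 : 1 ≤ n ^ 3 := one_le_pow₀ hn
    calc ε * sd * d ^ 2 = ε * (d ^ 2 * sd * 1) := by ring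
      _ ≤ ε * (d ^ 2 * sd * n ^ 3) := by gcongr
      _ ≤ C₁ * lam ^ 2 := h2
      _ ≤ C₁ * (4 * d) ^ 2 := by gcongr
      _ = 16 * C₁ * d ^ 2 := by ring

section Network

variable {n m d : ℕ}

theorem meanGram_apply_self_le {ε : ℝ} (hε : 0 ≤ ε) {x : Fin n → Fin d → ℝ}
    (hx : ∀ i k, ε ≤ x i k) (hx1 : ∀ i k, x i k ≤ 1) {y : Fin n → ℝ}
    (hy : ∀ i, y i = 1 ∨ y i = -1) (i : Fin n) : meanGram ε x y i i ≤ 4 * d := by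
  have := norm_integral_le_of_norm_le_const (μ := neuronMeasure d) (f := neuronGram ε x y i i)
    (C := 4 * d) (ae_neuronMeasure.mono fun p hp => abs_neuronGram_le hε hx hx1 hy i i hp)
  rw [probReal_univ, mul_one] at this
  exact (le_abs_self _).trans this

theorem nonneg_of_mem_spectrum_meanGram {ε : ℝ} (hε : 0 ≤ ε) {x : Fin n → Fin d → ℝ}
    (hx : ∀ i k, ε ≤ x i k) (hx1 : ∀ i k, x i k ≤ 1) {y : Fin n → ℝ}
    (hy : ∀ i, y i = 1 ∨ y i = -1) {lam : ℝ} (h : lam ∈ spectrum ℝ (meanGram ε x y)) :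
    0 ≤ lam := by
  have hH := isHermitian_meanGram ε x y
  rw [hH.spectrum_real_eq_range_eigenvalues] at h
  obtain ⟨i, rfl⟩ := h
  have hP : (meanGram ε x y).PosSemidef :=
    Matrix.PosSemidef.of_dotProduct_mulVec_nonneg hH fun c => by
      simpa using dotProduct_meanGram_nonneg hε hx hx1 hy c
  exact hP.eigenvalues_nonneg i

theorem marginLower_eq_oddMargin_sub (ε : ℝ) {a : Fin m → ℝ} (ha : ∀ r, a r = 1 ∨ a r = -1)
    (W : Weights m d) (x : Fin n → Fin d → ℝ) {y : Fin n → ℝ} (hy : ∀ i, y i = 1 ∨ y i = -1)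
    (i : Fin n) :
    marginLower ε a W (x i) (y i)
      = oddMargin ε a W x y i - 1 / √(m : ℝ) * ∑ r, gapRelu ε (x i) (row W r) := by
  rw [marginLower_eq ε ha W (x i) (hy i), oddMargin, ← mul_sub, ← Finset.sum_sub_distrib]
  congr 1
  refine Finset.sum_congr rfl fun r _ => ?_
  rw [mul_relu_rowQ ε (mul_eq_one_or (hy i) (ha r))]
  ring

/-- Convergence from a good initialization, with the target margin `τ` and the displacement `R`
for which the probability of a bad initialization is at most `δ`. -/
theorem GoodInit.converges {ε lam R δ τ : ℝ} {x : Fin n → Fin d → ℝ} {y : Fin n → ℝ}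
    {f : Fin n → Fin n → ℝ} {a : Fin m → ℝ} {w₀ : Weights m d}
    (hgood : GoodInit R ε δ x y f a w₀) (hε : 0 ≤ ε) (hx : ∀ i k, ε ≤ x i k)
    (hy : ∀ i, y i = 1 ∨ y i = -1) (hxd : ∀ i, l2 (x i) ≤ √d) (hn : 0 < n) (hd : 0 < d)
    (hm : 0 < m) (hlam : 0 < lam) (hδ : 0 < δ) (hεd : ε * √d ≤ 1)
    (hf1 : ∀ z, (meanGram ε x y).mulVec (∑ j, (f j ⬝ᵥ z) • f j) = z)
    (hf2 : ∀ z, ∑ j, (f j ⬝ᵥ z) ^ 2 ≤ (z ⬝ᵥ z) / lam)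
    (hf3 : ∀ z, lam * (z ⬝ᵥ z) ≤ z ⬝ᵥ (meanGram ε x y).mulVec z)
    (hτ : τ = 16 * n + √(10380 * (n * lam / δ)) + 6 * ε * √m * d / δ)
    (hR : R = 60 * √d * τ * n / (lam * √m)) (hRs : R * (3686400 * d * n ^ 2) ≤ δ * lam)
    (hfluct : 55296 * (n ^ 3 * d ^ 2) ≤ δ * lam ^ 2 * m)
    {W : ℝ → Weights m d} (hW : IsGradientFlow (robustLoss ε x y a) w₀ W) :
    ∃ T : ℝ, 0 ≤ T ∧ T ≤ 16 * (n + robustLoss ε x y a (W 0)) / lam ∧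
      (∀ t, T ≤ t → certifiedError ε x y a (W t) = 0) ∧
      ∀ t, 0 ≤ t → t ≤ T →
        robustLoss ε x y a (W t) ≤ robustLoss ε x y a (W 0)
          * Real.exp (-(lam * t / (16 * (n + robustLoss ε x y a (W 0))))) ∧
        robustLoss ε x y a (W t) ≤ Real.exp (16 * (n + robustLoss ε x y a (W 0)))
          * robustLoss ε x y a (W 0) * Real.exp (-(lam * t / 2)) := by
  have hn' : (0 : ℝ) < n := by exact_mod_cast hn
  have hm' : (0 : ℝ) < m := by exact_mod_cast hm
  have hsm : 0 < √(m : ℝ) := Real.sqrt_pos.2 hm'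
  have hsm2 : √(m : ℝ) ^ 2 = m := Real.sq_sqrt hm'.le
  have hr := Real.sqrt_nonneg (10380 * (n * lam / δ))
  have hβ : 0 ≤ 6 * ε * √m * d / δ := by positivity
  refine hW.converges_of_good_init hε hgood.sign hx hy hxd hn hd hm hεd hlam hδ hf1 hf2 hf3
    (fun i => marginLower_eq_oddMargin_sub ε hgood.sign w₀ x hy i) (τ := τ) ?_ ?_ ?_ ?_ ?_ ?_ hR hRs
  · linarith
  · intro i
    rw [abs_mul, abs_of_pos (by positivity : 0 < 1 / √(m : ℝ))]
    have h1 : |∑ r, gapRelu ε (x i) (row w₀ r)| ≤ 6 / δ * (m * (ε * d)) :=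
      (Finset.abs_sum_le_sum_abs _ _).trans
        ((Finset.sum_le_sum fun r _ => abs_gapRelu_le hε (x i) (row w₀ r)).trans hgood.sum_abs_le)
    calc _ ≤ 1 / √(m : ℝ) * (6 / δ * (m * (ε * d))) := by gcongr
      _ = 6 * ε * √m * d / δ := by
          nth_rewrite 2 [← hsm2]
          field_simp
      _ ≤ τ := by linarith
  · have h1 := hgood.margin_le
    simp only [mul_pow, hsm2, ← Finset.mul_sum] at h1
    have h2 : 10380 * (n * lam / δ) ≤ τ ^ 2 := by
      rw [← Real.sq_sqrt (by positivity : 0 ≤ 10380 * (n * lam / δ))]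
      exact pow_le_pow_left₀ hr (by linarith) 2
    calc ∑ j, (f j ⬝ᵥ oddMargin ε a w₀ x y) ^ 2 ≤ 6 / δ * (n * (1730 * n)) := by
          refine le_of_mul_le_mul_left ?_ hm'
          linarith
      _ = 10380 * (n * lam / δ) * n / lam := by field_simp; norm_num
      _ ≤ τ ^ 2 * n / lam := by gcongr
  · have h1 := hgood.gram_le
    simp only [mul_pow, ← Finset.mul_sum] at h1
    refine le_of_mul_le_mul_left ?_ (by positivity : 0 < (m : ℝ) ^ 2)
    refine h1.trans ?_
    rw [← sub_nonneg]
    have e1 : (m : ℝ) ^ 2 * (lam ^ 2 / (576 * n)) - 6 / δ * (n * (n * (m * (4 ^ 2 * d ^ 2))))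
        = m / (576 * n * δ) * (δ * lam ^ 2 * m - 55296 * (n ^ 3 * d ^ 2)) := by
      field_simp; ring
    rw [e1]
    exact mul_nonneg (by positivity) (sub_nonneg.2 hfluct)
  · exact hgood.neurons_le.trans (le_of_eq (by ring))
  · exact hgood.weights_le.trans (le_of_eq (by ring))

end Network

end IBP

/-! ### Convergence with high probability -/

theorem mainTheorem1 :
    ∃ K : ℝ, 0 < K ∧ ∀ ξ : ℝ, 0 < ξ → ∃ C₁ C₂ : ℝ, 0 < C₁ ∧ 0 < C₂ ∧
      ∀ (n d m : ℕ) (x : Fin n → Fin d → ℝ) (y : Fin n → ℝ) (ε δ lam : ℝ),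
        (∀ i, y i = 1 ∨ y i = -1) →
        0 ≤ ε → ε ≤ 1 → 0 < δ → δ < 1 →
        IBP.InputRange ε ξ x →
        IBP.NonParallel ε x →
        -- `lam` is the least eigenvalue of `H^∞`
        IsLeast (spectrum ℝ (IBP.gramInf m ε x y)) lam →
        -- the perturbation radius is small
        ε ≤ C₁ * (δ ^ 2 * lam ^ 2 / ((d : ℝ) ^ (5 / 2 : ℝ) * (n : ℝ) ^ 3)) →
        ε * Real.log (√(2 * Real.pi * d / IBP.radius ξ δ lam d n) * ξ)
          ≤ C₁ * (√(2 * d) * IBP.radius ξ δ lam d n) →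
        -- the network is wide
        0 < δ ^ 2 * lam ^ 2 - ε * (d : ℝ) ^ (5 / 2 : ℝ) * (n : ℝ) ^ 4 →
        C₂ * ((d : ℝ) ^ (3 / 2 : ℝ) * (n : ℝ) ^ 4 * max 1 (δ * lam)
            / (δ ^ 2 * lam ^ 2 - ε * (d : ℝ) ^ (5 / 2 : ℝ) * (n : ℝ) ^ 4)) ^ 2 ≤ (m : ℝ) →
        -- the initializations for which the conclusion fails have probability at most `δ`
        IBP.initMeasure m d {ω | ¬
          ((∃ W : ℝ → IBP.Weights m d,
              IBP.IsGradientFlow (IBP.robustLoss ε x y ω.1) (WithLp.toLp 2 ω.2) W) ∧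
            ∀ W : ℝ → IBP.Weights m d,
              IBP.IsGradientFlow (IBP.robustLoss ε x y ω.1) (WithLp.toLp 2 ω.2) W →
              ∃ T : ℝ, 0 ≤ T ∧
                T ≤ K * (n + IBP.robustLoss ε x y ω.1 (W 0)) / lam ∧
                (∀ t, T ≤ t → IBP.certifiedError ε x y ω.1 (W t) = 0) ∧
                ∀ t, 0 ≤ t → t ≤ T →
                  IBP.robustLoss ε x y ω.1 (W t) ≤ IBP.robustLoss ε x y ω.1 (W 0)
                    * Real.exp (-(lam * t / (K * (n + IBP.robustLoss ε x y ω.1 (W 0))))) ∧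
                  IBP.robustLoss ε x y ω.1 (W t)
                    ≤ Real.exp (K * (n + IBP.robustLoss ε x y ω.1 (W 0)))
                      * IBP.robustLoss ε x y ω.1 (W 0) * Real.exp (-(lam * t / 2)))}
          ≤ ENNReal.ofReal δ := by
  refine ⟨16, by norm_num, fun ξ hξ => ?_⟩
  -- `B = 60 * 3686400` is the product of the constants in the displacement `R` and in the bound
  -- that is required of it; the constants for `ε` and `m` make each of the three summands of `τ`
  -- contribute at most a third of this bound. The bound `ξ / 32` for the former makes the
  -- perturbation at most half as long as the inputs.
  set B : ℝ := 221184000 with hB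
  refine ⟨min (1 / (18 * B)) (ξ / 32), (400 * B) ^ 2, by positivity, by positivity, ?_⟩
  intro n d m x y ε δ lam hy hε hε1 hδ hδ1 hrange _ hspec heps _ hden hwidth
  set C₁ : ℝ := min (1 / (18 * B)) (ξ / 32) with hC₁
  have hC₁0 : 0 < C₁ := by positivity
  have hC₁B : C₁ ≤ 1 / (18 * B) := min_le_left _ _
  have hC₁ξ : C₁ ≤ ξ / 32 := min_le_right _ _
  -- There are no eigenvalues without data, and no inputs of positive norm in dimension zero.
  have hn : 0 < n := by
    rcases Nat.eq_zero_or_pos n with rfl | h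
    · exact absurd (isUnit_of_subsingleton _) hspec.1
    · exact h
  have hξx : ∀ i, ξ ≤ IBP.l2 (x i) := fun i => (hrange i).2
  have hxpos : ∀ i, 0 < IBP.l2 (x i) := fun i => hξ.trans_le (hξx i)
  have hd : 0 < d := by
    rcases Nat.eq_zero_or_pos d with rfl | h
    · have := hxpos ⟨0, hn⟩
      simp [IBP.l2] at this
    · exact h
  have hn' : (1 : ℝ) ≤ n := by exact_mod_cast hn
  have hd' : (1 : ℝ) ≤ d := by exact_mod_cast hd
  have hd0 : (0 : ℝ) < d := by linarith
  have hsd : 0 < √(d : ℝ) := Real.sqrt_pos.2 hd0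
  have hsd2 : √(d : ℝ) ^ 2 = d := Real.sq_sqrt hd0.le
  have hpow5 : (d : ℝ) ^ (5 / 2 : ℝ) = d ^ 2 * √d := by
    rw [Real.sqrt_eq_rpow, ← Real.rpow_natCast, ← Real.rpow_add hd0]; norm_num
  have hpow3 : (d : ℝ) ^ (3 / 2 : ℝ) = d * √d := by
    rw [Real.sqrt_eq_rpow]
    nth_rewrite 2 [← Real.rpow_one (d : ℝ)]
    rw [← Real.rpow_add hd0]; norm_num
  rw [hpow5] at heps hden hwidth
  rw [hpow3] at hwidth
  have hx : ∀ i k, ε ≤ x i k := fun i k => ((hrange i).1 k).1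
  have hx1 : ∀ i k, x i k ≤ 1 := fun i k => ((hrange i).1 k).2
  have hxd : ∀ i, IBP.l2 (x i) ≤ √d := fun i => by
    refine Real.sqrt_le_sqrt ?_
    calc ∑ k, x i k ^ 2 ≤ ∑ _k : Fin d, (1 : ℝ) := Finset.sum_le_sum fun k _ =>
          pow_le_one₀ (hε.trans (hx i k)) (hx1 i k)
      _ = d := by simp
  -- The width condition presupposes a positive denominator, which excludes `lam = 0`.
  have hlam0 : lam ≠ 0 := by
    rintro rfl
    have : 0 ≤ ε * (d ^ 2 * √d) * n ^ 4 := by positivity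
    linarith
  have hm : 0 < m := by
    rcases Nat.eq_zero_or_pos m with rfl | h
    · refine absurd hwidth (not_le.2 ?_)
      have : 0 < max 1 (δ * lam) := lt_max_of_lt_left one_pos
      rw [Nat.cast_zero]
      positivity
    · exact h
  rw [IBP.gramInf_eq_meanGram hε hx hx1 hy hm] at hspec
  have hlam : 0 < lam := lt_of_le_of_ne
    (IBP.nonneg_of_mem_spectrum_meanGram hε hx hx1 hy hspec.1) hlam0.symm
  obtain ⟨f, hf0, hf1, hf2, hf3⟩ := IBP.exists_orthonormal_frame
    (IBP.isHermitian_meanGram ε x y) hlam fun μ hμ => hspec.2 hμ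
  have hlamd : lam ≤ 4 * d := by
    have h1 := hf3 (Pi.single ⟨0, hn⟩ 1)
    have h2 := IBP.meanGram_apply_self_le hε hx hx1 hy ⟨0, hn⟩
    simp at h1
    linarith
  have hm' : (0 : ℝ) < m := by exact_mod_cast hm
  have hsm : 0 < √(m : ℝ) := Real.sqrt_pos.2 hm'
  have hsm2 : √(m : ℝ) ^ 2 = m := Real.sq_sqrt hm'.le
  have heps' : ε * (d ^ 2 * √d * n ^ 3) ≤ C₁ * (δ ^ 2 * lam ^ 2) := by
    rwa [← mul_div_assoc, le_div_iff₀ (by positivity)] at heps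
  have hC₁16 : C₁ ≤ 1 / 16 := hC₁B.trans (by rw [hB]; norm_num)
  obtain ⟨hκ, hε2, hεd⟩ := IBP.perturbation_bounds hd' hsd hsd2 hn' hδ hδ1.le hlam hε hC₁0 hC₁16
    hlamd heps'
  have heps18 : 18 * B * (ε * (d ^ 2 * √d * n ^ 3)) ≤ δ ^ 2 * lam ^ 2 := by
    have h1 : C₁ * (18 * B) ≤ 1 := by rwa [le_div_iff₀ (by positivity)] at hC₁B
    have h2 := mul_le_mul_of_nonneg_right h1 (by positivity : 0 ≤ δ ^ 2 * lam ^ 2)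
    have h3 := mul_le_mul_of_nonneg_left heps' (by positivity : 0 ≤ 18 * B)
    linarith
  have hwide : 400 * B * (d * √d * n ^ 4 * max 1 (δ * lam)) ≤ √m * (δ ^ 2 * lam ^ 2) := by
    set X := (d : ℝ) * √d * n ^ 4 * max 1 (δ * lam) with hX
    set D := δ ^ 2 * lam ^ 2 - ε * (d ^ 2 * √d) * n ^ 4 with hD
    have hX0 : 0 ≤ X := by
      have : 0 < max 1 (δ * lam) := lt_max_of_lt_left one_pos
      positivity
    have h1 : 400 * B * (X / D) ≤ √m := by
      refine Real.le_sqrt_of_sq_le ?_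
      rw [mul_pow]
      exact hwidth
    rw [← mul_div_assoc, div_le_iff₀ hden] at h1
    have h2 : D ≤ δ ^ 2 * lam ^ 2 := by
      have : 0 ≤ ε * (d ^ 2 * √d) * n ^ 4 := by positivity
      linarith
    exact h1.trans (mul_le_mul_of_nonneg_left h2 hsm.le)
  have hdisp := IBP.displacement_bound hd0 hsd hn' hδ hδ1.le hlam (by positivity) hsm heps18 hwide
  have hfluct := IBP.gram_fluctuation_bound hd' hsd hsd2 hn' hδ hδ1.le hlam
    (by rw [hB]; norm_num) hwide
  rw [hsm2] at hfluct
  -- `τ` is the target margin and `R` the distance within which the hidden neurons stay.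
  obtain ⟨τ, hτ⟩ : ∃ τ, τ = 16 * n + √(10380 * (n * lam / δ)) + 6 * ε * √m * d / δ := ⟨_, rfl⟩
  rw [← hτ] at hdisp
  have hτ0 : 0 < τ := by rw [hτ]; positivity
  obtain ⟨R, hR⟩ : ∃ R, R = 60 * √d * τ * n / (lam * √m) := ⟨_, rfl⟩
  have hR0 : 0 < R := by rw [hR]; positivity
  have hRs : R * (3686400 * d * n ^ 2) ≤ δ * lam := by
    have h1 : R * (3686400 * d * n ^ 2) = B * (d * √d * n ^ 3) * τ / (lam * √m) := by
      rw [hR, hB]; ring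
    rw [h1, div_le_iff₀ (by positivity)]
    linarith
  have hprob := IBP.initMeasure_not_goodInit_le hε hx hx1 hxpos hxd
    (fun i => by have := hξx i; linarith) hy hn hd hm hlam hκ hε2 hR0 hδ hf0 hf3
  refine (measure_mono ?_).trans hprob
  intro ω hω hgood
  refine hω ?_
  obtain ⟨K, hK⟩ := IBP.robustLoss_lipschitz (m := m) hε hgood.sign hx hy
  exact ⟨IBP.exists_isGradientFlow hK _, fun W hW => hgood.converges hε hx hy hxd hn hd hm hlam hδ
    (by linarith) hf1 hf2 hf3 hτ hR hRs hfluct hW⟩
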